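/- Let $N\ge 1$, let $P$ be a continuous symmetric real $N\times N$ matrix-valued function on $[0,\pi]$, and let $A,B,\mathcal A,\mathcal B$ be real $N\times N$ matrices with $BA^*=AB^*$, $\mathcal B\mathcal A^*=\mathcal A\mathcal B^*$ and $\operatorname{rank}[A,B]=\operatorname{rank}[\mathcal A,\mathcal B]=N$, where ${}^*$ denotes the transpose. Write $(P,A,B,\mathcal A,\mathcal B)$ for the eigenvalue problem $$-\phi''(x)+P(x)\phi(x)=\lambda\phi(x)\quad(0\le x\le\pi),\qquad B\phi'(0)+A\phi(0)=\mathcal B\phi'(\pi)+\mathcal A\phi(\pi)=\mathbf 0,$$ for $\mathbf R^N$-valued functions $\phi$, and $\Sigma(P,A,B,\mathcal A,\mathcal B)$ for the ascending sequence $\mu_0\le\mu_1\le\mu_2\le\cdots$ of its eigenvalues, each repeated according to its multiplicity. Let $\lambda_0<\lambda_1<\lambda_2<\cdots$ be its distinct eigenvalues, $m_k$ the multiplicity of $\lambda_k$, and $\phi_{1,k},\dots,\phi_{m_k,k}$ an orthogonal basis of the eigenspace of $\lambda_k$ with respect to $\langle f,g\rangle=\int_0^\pi f^*(x)g(x)\,dx$;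 put $\|f\|^2=\langle f,f\rangle$. Assume that the eigenfunctions are complete: every $f\in L^2([0,\pi];\mathbf R^N)$ orthogonal to all of them is $0$ almost everywhere. **Theorem 3.1.** Let $c_k^i$ ($1\le i\le m_k$, $k\ge 0$) be real numbers with $1+c_k^i\|\phi_{i,k}\|^2>0$ for all $k$ and $i$, such that the series $$\mathcal F(x,y)=\sum_{k=0}^\infty\sum_{i=1}^{m_k}c_k^i\,\phi_{i,k}(x)\,\phi_{i,k}^*(y)$$ converges uniformly on $[0,\pi]^2$ and its sum is of class $C^2$ there. Then the integral equation $$K(x,y)+\mathcal F(x,y)+\int_0^xK(x,t)\mathcal F(t,y)\,dt=0,\qquad 0\le y<x\le\pi,$$ has a solution $K$ that is continuous on the closed triangle $0\le y\le x\le\pi$. For every such $K$, the function $x\mapsto K(x,x)$ is continuously differentiable on $[0,\pi]$, and with $$Q(x)=P(x)+2\frac{d}{dx}K(x,x),\qquad \tilde A=A-BK(0,0),\qquad \tilde{\mathcal A}=\mathcal A-\mathcal BK(\pi,\pi),$$ $Q$ is continuous and symmetric, the problem $(Q,\tilde A,B,\tilde{\mathcal A},\mathcal B)$ satisfies $B\tilde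 A^*=\tilde AB^*$, $\mathcal B\tilde{\mathcal A}^*=\tilde{\mathcal A}\mathcal B^*$ and $\operatorname{rank}[\tilde A,B]=\operatorname{rank}[\tilde{\mathcal A},\mathcal B]=N$, and $$\Sigma(Q,\tilde A,B,\tilde{\mathcal A},\mathcal B)=\Sigma(P,A,B,\mathcal A,\mathcal B).$$ -/

import Mathlib

open Set Filter MeasureTheory Matrix

/-- The data `(P, A, B, 𝒜, ℬ)` of an `N`-dimensional vectorial Sturm-Liouville problem
`-u'' + P(x) u = l u` on `[0, π]`, `B u'(0) + A u(0) = 0`, `ℬ u'(π) + 𝒜 u(π) = 0`. -/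
structure SLProblem (N : ℕ) where
  P : ℝ → Matrix (Fin N) (Fin N) ℝ
  A : Matrix (Fin N) (Fin N) ℝ
  B : Matrix (Fin N) (Fin N) ℝ
  Api : Matrix (Fin N) (Fin N) ℝ
  Bpi : Matrix (Fin N) (Fin N) ℝ

namespace SLProblem

variable {N : ℕ}

/-- The standing assumptions: `P` is continuous and symmetric on `[0, π]`, and the boundary
conditions are selfadjoint: `B A* = A B*`, `ℬ 𝒜* = 𝒜 ℬ*`, `rank [A, B] = rank [𝒜, ℬ] = N`. -/
structure IsSelfAdjoint (p : SLProblem N) : Prop where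
  continuousOn_P : ContinuousOn p.P (Icc 0 Real.pi)
  symm_P : ∀ x ∈ Icc (0 : ℝ) Real.pi, (p.P x)ᵀ = p.P x
  symm_zero : p.B * p.Aᵀ = p.A * p.Bᵀ
  symm_pi : p.Bpi * p.Apiᵀ = p.Api * p.Bpiᵀ
  rank_zero : (Matrix.fromCols p.A p.B).rank = N
  rank_pi : (Matrix.fromCols p.Api p.Bpi).rank = N

/-- `u` solves the boundary value problem with parameter `l` on `[0, π]`;
`v` is the derivative `u'` (one-sided at the endpoints). -/
def IsSolution (p : SLProblem N) (l : ℝ) (u : ℝ → Fin N → ℝ) : Prop :=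
  ∃ v : ℝ → Fin N → ℝ,
    (∀ x ∈ Icc (0 : ℝ) Real.pi, HasDerivWithinAt u (v x) (Icc 0 Real.pi) x) ∧
    (∀ x ∈ Icc (0 : ℝ) Real.pi,
      HasDerivWithinAt v (p.P x *ᵥ u x - l • u x) (Icc 0 Real.pi) x) ∧
    p.B *ᵥ v 0 + p.A *ᵥ u 0 = 0 ∧
    p.Bpi *ᵥ v Real.pi + p.Api *ᵥ u Real.pi = 0

/-- The space of all solutions for the parameter `l`. A function on `[0, π]` is represented by
the function on `ℝ` that agrees with it on `[0, π]` and vanishes elsewhere. -/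
def eigenspace (p : SLProblem N) (l : ℝ) : Submodule ℝ (ℝ → Fin N → ℝ) where
  carrier := {u | (∀ x, x ∉ Icc (0 : ℝ) Real.pi → u x = 0) ∧ p.IsSolution l u}
  zero_mem' := by
    refine ⟨fun _ _ => rfl, 0, fun x _ => ?_, fun x _ => ?_, ?_, ?_⟩
    · exact hasDerivWithinAt_const x _ (0 : Fin N → ℝ)
    · have h : p.P x *ᵥ (0 : ℝ → Fin N → ℝ) x - l • (0 : ℝ → Fin N → ℝ) x = 0 := by
        rw [Pi.zero_apply, mulVec_zero, smul_zero, sub_zero]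
      rw [h]
      exact hasDerivWithinAt_const x (Icc 0 Real.pi) (0 : Fin N → ℝ)
    · simp
    · simp
  add_mem' := by
    rintro u w ⟨hu, v, h1, h2, h3, h4⟩ ⟨hw, z, g1, g2, g3, g4⟩
    refine ⟨fun x hx => by simp [hu x hx, hw x hx], v + z, fun x hx => (h1 x hx).add (g1 x hx),
      fun x hx => ?_, ?_, ?_⟩
    · have h : p.P x *ᵥ (u + w) x - l • (u + w) x =
          (p.P x *ᵥ u x - l • u x) + (p.P x *ᵥ w x - l • w x) := by
        rw [Pi.add_apply, mulVec_add, smul_add]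
        abel
      rw [h]
      exact (h2 x hx).add (g2 x hx)
    · simp only [Pi.add_apply, mulVec_add]
      rw [add_add_add_comm, h3, g3, add_zero]
    · simp only [Pi.add_apply, mulVec_add]
      rw [add_add_add_comm, h4, g4, add_zero]
  smul_mem' := by
    rintro a u ⟨hu, v, h1, h2, h3, h4⟩
    refine ⟨fun x hx => by simp [hu x hx], a • v, fun x hx => (h1 x hx).const_smul a,
      fun x hx => ?_, ?_, ?_⟩
    · have h : p.P x *ᵥ (a • u) x - l • (a • u) x = a • (p.P x *ᵥ u x - l • u x) := by
        rw [Pi.smul_apply, mulVec_smul, smul_sub, smul_comm a l]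
      rw [h]
      exact (h2 x hx).const_smul a
    · simp only [Pi.smul_apply, mulVec_smul]
      rw [← smul_add, h3, smul_zero]
    · simp only [Pi.smul_apply, mulVec_smul]
      rw [← smul_add, h4, smul_zero]

/-- The set `σ(P, A, B, 𝒜, ℬ)` of eigenvalues. -/
def eigenvalues (p : SLProblem N) : Set ℝ := {l | p.eigenspace l ≠ ⊥}

/-- The multiplicity of `l` (zero when `l` is not an eigenvalue). -/
noncomputable def multiplicity (p : SLProblem N) (l : ℝ) : ℕ :=
  Module.finrank ℝ (p.eigenspace l)

/-- `μ 0 ≤ μ 1 ≤ μ 2 ≤ ⋯` is the sequence `Σ(P, A, B, 𝒜, ℬ)`: it lists every eigenvalue,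
as many times as its multiplicity, and nothing else. (Such a sequence is unique.) -/
def IsEigenvalueSequence (p : SLProblem N) (μ : ℕ → ℝ) : Prop :=
  Monotone μ ∧ ∀ l : ℝ, {n : ℕ | μ n = l}.encard = (p.multiplicity l : ℕ∞)

/-- Both problems have an ascending sequence of eigenvalues, and it is the same one. -/
def Isospectral (p q : SLProblem N) : Prop :=
  ∃ μ : ℕ → ℝ, p.IsEigenvalueSequence μ ∧ q.IsEigenvalueSequence μ

/-- Completeness of the eigenfunctions in `L²([0, π]; ℝ^N)`. -/
def CompleteEigenfunctions (p : SLProblem N) : Prop :=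
  ∀ f : ℝ → Fin N → ℝ, MemLp f 2 (volume.restrict (Icc 0 Real.pi)) →
    (∀ l : ℝ, ∀ u ∈ p.eigenspace l, ∫ x in (0 : ℝ)..Real.pi, f x ⬝ᵥ u x = 0) →
    f =ᵐ[volume.restrict (Icc 0 Real.pi)] 0

/-- `u` is an orthogonal basis (for the `L²` inner product) of the solution space at `l`. -/
def IsOrthogonalEigenbasis (p : SLProblem N) (l : ℝ)
    (u : Fin (p.multiplicity l) → ℝ → Fin N → ℝ) : Prop :=
  Submodule.span ℝ (Set.range u) = p.eigenspace l ∧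
    ∀ i j, i ≠ j → ∫ x in (0 : ℝ)..Real.pi, u i x ⬝ᵥ u j x = 0

/-- `K`, continuous on the closed triangle `0 ≤ y ≤ x ≤ π`, solves
`K(x,y) + F(x,y) + ∫_0^x K(x,t) F(t,y) dt = 0` for `0 ≤ y < x ≤ π`. -/
def SolvesIE (F K : ℝ → ℝ → Matrix (Fin N) (Fin N) ℝ) : Prop :=
  ContinuousOn (fun q : ℝ × ℝ => K q.1 q.2) {q | 0 ≤ q.2 ∧ q.2 ≤ q.1 ∧ q.1 ≤ Real.pi} ∧
    ∀ x y : ℝ, 0 ≤ y → y < x → x ≤ Real.pi → ∀ a b : Fin N,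
      K x y a b + F x y a b + ∫ t in (0 : ℝ)..x, (K x t * F t y) a b = 0

/-- The problem `(Q, A - B K(0,0), B, 𝒜 - ℬ K(π,π), ℬ)`, where `Q(x) = P(x) + 2 d/dx K(x,x)`
(derivative within `[0, π]`). -/
noncomputable def transform (p : SLProblem N) (K : ℝ → ℝ → Matrix (Fin N) (Fin N) ℝ) :
    SLProblem N where
  P := fun x => p.P x +
    (2 : ℝ) • Matrix.of fun a b => derivWithin (fun t => K t t a b) (Icc 0 Real.pi) x
  A := p.A - p.B * K 0 0
  B := p.B
  Api := p.Api - p.Bpi * K Real.pi Real.pi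
  Bpi := p.Bpi

end SLProblem

/-! Regard $\mathcal F$ as an integral operator. It multiplies $\phi_{i,k}$ by
$c_k^i\|\phi_{i,k}\|^2 > -1$, so it commutes with the boundary value problem. Uniform convergence
forces all but finitely many of these factors above $-1/2$, hence they stay away from $-1$. So
$1+\mathcal F$ is coercive on $L^2(0,x)$ with a constant independent of $x$ (`exists_neg_le`,
`exists_coercive`). Coercivity becomes a uniform sup-norm lower bound
(`exists_uniformlyBoundedBelow`), and the method of continuity (`isUnit_one_add_of_norm_le`) then
solves the integral equation. Solved for all $y \in [0,\pi]$, not only $y < x$, it gives a $K$ on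
the square that inherits the smoothness of $\mathcal F$ (`exists_hasSecondPartials`).

The series is never differentiated term by term. Instead, $\mathcal F_{xx} - P(x)\mathcal F =
\mathcal F_{yy} - \mathcal F P(y)$ and the boundary conditions of $\mathcal F$ follow by testing
against eigenfunctions and using completeness (`AdmissibleKernel.equation`,
`AdmissibleKernel.boundary`). The defect in $K_{xx} - Q(x)K = K_{yy} - K P(y)$ then solves the
homogeneous integral equation, so it vanishes (`kernel_equation`).

Consequently $u \mapsto u + \int_0^x K(x,t)u(t)\,dt$ carries solutions for $P$ to solutions for $Q$
with the same $\lambda$. The new condition at $0$ is immediate. At $\pi$, write $u = (1+\mathcal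
F)w$ with $w$ in the same eigenspace, which is possible since $1+c_k^i\|\phi_{i,k}\|^2 \ne 0$; the
integral equation at $x=\pi$ reduces the transformed boundary values to $w(\pi)$ and
$w'(\pi)+K(\pi,\pi)w(\pi)$ (`isSolution_matrix`). Symmetry of $K(x,x)$ makes the new problem
selfadjoint.

The map is injective because it is a Volterra operator of the second kind. It is onto each new
eigenspace because the images of the old eigenfunctions are total (`eq_zero_of_orthogonal`) and
eigenspaces of the new problem are mutually orthogonal (`eigenspaceMap_surjective`). So
multiplicities agree for every real $\lambda$, and no eigenvalue is gained or lost. -/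

section Transform

open Function

/-! ### Parameter integrals, Leibniz' rule and Grönwall's inequality -/

section Calculus

variable {E : Type*} [NormedAddCommGroup E] [NormedSpace ℝ E]

@[fun_prop]
theorem Continuous.intervalIntegral_param {X : Type*} [TopologicalSpace X] {f : X → ℝ → E}
    {a b : X → ℝ} (hf : Continuous (uncurry f)) (ha : Continuous a) (hb : Continuous b) :
    Continuous (fun x => ∫ t in a x..b x, f x t) := by
  have h1 := intervalIntegral.continuous_parametric_intervalIntegral_of_continuous
    (μ := volume) (a₀ := 0) hf ha
  have h2 := intervalIntegral.continuous_parametric_intervalIntegral_of_continuous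
    (μ := volume) (a₀ := 0) hf hb
  have h : (fun x => ∫ t in a x..b x, f x t) =
      fun x => (∫ t in (0 : ℝ)..b x, f x t) - ∫ t in (0 : ℝ)..a x, f x t := by
    ext x
    have hc : Continuous (f x) := by fun_prop
    rw [intervalIntegral.integral_interval_sub_left] <;> exact hc.intervalIntegrable _ _
  rw [h]
  exact h2.sub h1

theorem intervalIntegral_swap {g : ℝ → ℝ → E} (hg : Continuous (uncurry g)) (a b c d : ℝ) :
    ∫ s in a..b, ∫ t in c..d, g s t = ∫ t in c..d, ∫ s in a..b, g s t := by
  refine intervalIntegral_intervalIntegral_swap ?_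
  exact (hg.continuousOn.integrableOn_compact (isCompact_uIcc.prod isCompact_uIcc)).mono_set
    (prod_mono uIoc_subset_uIcc uIoc_subset_uIcc)

variable [CompleteSpace E]

/-- The fundamental theorem of calculus for one-sided derivatives at the end points. -/
theorem integral_eq_sub_of_hasDerivWithinAt_Icc {L : ℝ} {f f' : ℝ → E}
    (hf : ∀ x ∈ Icc 0 L, HasDerivWithinAt f (f' x) (Icc 0 L) x) (hf' : Continuous f')
    {x : ℝ} (hx : x ∈ Icc 0 L) : ∫ t in (0 : ℝ)..x, f' t = f x - f 0 := by
  refine intervalIntegral.integral_eq_sub_of_hasDerivAt_of_le hx.1 (fun t ht => ?_)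
    (fun t ht => ?_) (hf'.intervalIntegrable _ _)
  · exact ((hf t ⟨ht.1, ht.2.trans hx.2⟩).continuousWithinAt).mono (Icc_subset_Icc_right hx.2)
  · exact (hf t ⟨ht.1.le, ht.2.le.trans hx.2⟩).hasDerivAt
      (Icc_mem_nhds ht.1 (ht.2.trans_le hx.2))

theorem hasDerivAt_integral_right {f : ℝ → E} (hf : Continuous f) (a x : ℝ) :
    HasDerivAt (fun x => ∫ t in a..x, f t) (f x) x :=
  intervalIntegral.integral_hasDerivAt_right (hf.intervalIntegrable _ _)
    (hf.stronglyMeasurableAtFilter _ _) hf.continuousAt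

/-- With independent upper limits the double integral has continuous partial derivatives, so it is
jointly differentiable; the chain rule along the diagonal finishes. -/
theorem hasDerivAt_integral_integral_diag {g : ℝ → ℝ → E} (hg : Continuous (uncurry g)) (x : ℝ) :
    HasDerivAt (fun x => ∫ t in (0 : ℝ)..x, ∫ s in (0 : ℝ)..x, g s t)
      ((∫ s in (0 : ℝ)..x, g s x) + ∫ t in (0 : ℝ)..x, g x t) x := by
  have h := hasStrictFDerivAt_uncurry_coprod (𝕜 := ℝ) (u := (x, x))
    (f := fun a b : ℝ => ∫ t in (0 : ℝ)..a, ∫ s in (0 : ℝ)..b, g s t)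
    (f₁ := fun a b => ContinuousLinearMap.toSpanSingleton ℝ (∫ s in (0 : ℝ)..b, g s a))
    (f₂ := fun a b => ContinuousLinearMap.toSpanSingleton ℝ (∫ t in (0 : ℝ)..a, g b t))
    (Eventually.of_forall fun v => by
      have := hasDerivAt_integral_right (E := E)
        (f := fun t => ∫ s in (0 : ℝ)..v.2, g s t) (by fun_prop) 0 v.1
      exact this.hasFDerivAt)
    (Eventually.of_forall fun v => by
      have := hasDerivAt_integral_right (E := E)
        (f := fun s => ∫ t in (0 : ℝ)..v.1, g s t) (by fun_prop) 0 v.2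
      simp_rw [intervalIntegral_swap hg] at this
      exact this.hasFDerivAt)
    (by
      refine Continuous.continuousAt ?_
      exact (ContinuousLinearMap.toSpanSingletonCLE (𝕜 := ℝ) (E := E)).continuous.comp
        (by fun_prop : Continuous fun v : ℝ × ℝ => ∫ s in (0 : ℝ)..v.2, g s v.1))
    (by
      refine Continuous.continuousAt ?_
      exact (ContinuousLinearMap.toSpanSingletonCLE (𝕜 := ℝ) (E := E)).continuous.comp
        (by fun_prop : Continuous fun v : ℝ × ℝ => ∫ t in (0 : ℝ)..v.1, g v.2 t))
  have h2 := h.hasFDerivAt.comp_hasDerivAt x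
    (f := fun x : ℝ => (x, x)) ((hasDerivAt_id x).prodMk (hasDerivAt_id x))
  simpa [HasUncurry.uncurry, Function.comp_def] using h2

/-- Leibniz' rule for a variable upper limit. -/
theorem hasDerivWithinAt_integral_leibniz {L : ℝ} {f f1 : ℝ → ℝ → E}
    (hf : Continuous (uncurry f)) (hf1 : Continuous (uncurry f1))
    (hd : ∀ x ∈ Icc 0 L, ∀ t ∈ Icc 0 L, HasDerivWithinAt (fun x => f x t) (f1 x t) (Icc 0 L) x)
    {x : ℝ} (hx : x ∈ Icc 0 L) :
    HasDerivWithinAt (fun x => ∫ t in (0 : ℝ)..x, f x t)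
      (f x x + ∫ t in (0 : ℝ)..x, f1 x t) (Icc 0 L) x := by
  -- The integrated form of `hd` replaces one-sided derivatives by integrals of functions continuous
  -- on the plane.
  have key : ∀ y ∈ Icc 0 L, ∀ t ∈ Icc 0 L, f y t = f 0 t + ∫ s in (0 : ℝ)..y, f1 s t := by
    intro y hy t ht
    rw [integral_eq_sub_of_hasDerivWithinAt_Icc (fun x hx => hd x hx t ht) (by fun_prop) hy]
    abel
  have h1 : ∀ y ∈ Icc 0 L, ∫ t in (0 : ℝ)..y, f y t =
      (∫ t in (0 : ℝ)..y, f 0 t) + ∫ t in (0 : ℝ)..y, ∫ s in (0 : ℝ)..y, f1 s t := by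
    intro y hy
    rw [← intervalIntegral.integral_add]
    · refine intervalIntegral.integral_congr fun t ht => ?_
      rw [uIcc_of_le hy.1] at ht
      exact key y hy t ⟨ht.1, ht.2.trans hy.2⟩
    · exact Continuous.intervalIntegrable (by fun_prop) _ _
    · exact Continuous.intervalIntegrable (by fun_prop) _ _
  have h2 := (hasDerivAt_integral_right (f := f 0) (by fun_prop) 0 x).add
    (hasDerivAt_integral_integral_diag hf1 x)
  rw [key x hx x hx, add_assoc]
  exact h2.hasDerivWithinAt.congr h1 (h1 x hx)

theorem hasDerivWithinAt_integral_param {L : ℝ} {f f1 : ℝ → ℝ → E}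
    (hf : Continuous (uncurry f)) (hf1 : Continuous (uncurry f1))
    (hd : ∀ x ∈ Icc 0 L, ∀ t ∈ Icc 0 L, HasDerivWithinAt (fun x => f x t) (f1 x t) (Icc 0 L) x)
    {b : ℝ} (hb : b ∈ Icc 0 L) {x : ℝ} (hx : x ∈ Icc 0 L) :
    HasDerivWithinAt (fun x => ∫ t in (0 : ℝ)..b, f x t)
      (∫ t in (0 : ℝ)..b, f1 x t) (Icc 0 L) x := by
  have h1 : ∀ y ∈ Icc 0 L, ∫ t in (0 : ℝ)..b, f y t =
      (∫ t in (0 : ℝ)..b, f 0 t) + ∫ s in (0 : ℝ)..y, ∫ t in (0 : ℝ)..b, f1 s t := by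
    intro y hy
    rw [intervalIntegral_swap hf1, ← intervalIntegral.integral_add]
    · refine intervalIntegral.integral_congr fun t ht => ?_
      rw [uIcc_of_le hb.1] at ht
      show f y t = _
      rw [integral_eq_sub_of_hasDerivWithinAt_Icc
        (fun x hx => hd x hx t ⟨ht.1, ht.2.trans hb.2⟩) (by fun_prop) hy]
      abel
    · exact Continuous.intervalIntegrable (by fun_prop) _ _
    · exact Continuous.intervalIntegrable (by fun_prop) _ _
  have h2 := (hasDerivAt_integral_right
    (f := fun s => ∫ t in (0 : ℝ)..b, f1 s t) (by fun_prop) 0 x).const_add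
    (∫ t in (0 : ℝ)..b, f 0 t)
  exact h2.hasDerivWithinAt.congr h1 (h1 x hx)

/-- Fubini's theorem on the triangle `0 ≤ t ≤ s ≤ L`. -/
theorem integral_triangle_swap {L : ℝ} (hL : 0 ≤ L) {g : ℝ → ℝ → E}
    (hg : Continuous (uncurry g)) :
    ∫ s in (0 : ℝ)..L, ∫ t in (0 : ℝ)..s, g s t = ∫ t in (0 : ℝ)..L, ∫ s in t..L, g s t := by
  -- The right side, as a function of its upper limit, has the outer integrand on the left as
  -- derivative: in Leibniz' rule the boundary term is an integral over $[x,x]$.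
  have h := integral_eq_sub_of_hasDerivWithinAt_Icc (L := L)
    (f := fun x => ∫ t in (0 : ℝ)..x, ∫ s in t..x, g s t)
    (f' := fun s => ∫ t in (0 : ℝ)..s, g s t) (fun x hx => ?_) (by fun_prop)
    (right_mem_Icc.2 hL)
  · simpa using h
  · have := hasDerivWithinAt_integral_leibniz (L := L) (f := fun x t => ∫ s in t..x, g s t)
      (f1 := g) (by fun_prop) hg (fun x _ t _ =>
        (hasDerivAt_integral_right (f := fun s => g s t) (by fun_prop) t x).hasDerivWithinAt) hx
    simpa using this

/-- Grönwall is applied to the primitive $\int_0^x |d|$, which is differentiable although `d` is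
only continuous. -/
theorem eq_zero_of_le_integral {L C : ℝ} {d : ℝ → ℝ} (hd : Continuous d)
    (h : ∀ x ∈ Icc 0 L, |d x| ≤ C * ∫ t in (0 : ℝ)..x, |d t|) :
    ∀ x ∈ Icc 0 L, d x = 0 := by
  have hg := norm_le_gronwallBound_of_norm_deriv_right_le (a := 0) (b := L) (δ := 0) (ε := 0)
    (K := C) (f := fun x => ∫ t in (0 : ℝ)..x, |d t|) (f' := fun x => |d x|)
    (Continuous.continuousOn (by fun_prop))
    (fun x _ => (hasDerivAt_integral_right (f := fun t => |d t|)
      (by fun_prop) 0 x).hasDerivWithinAt) (by simp) (fun x hx => by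
        have h0 : 0 ≤ ∫ t in (0 : ℝ)..x, |d t| :=
          intervalIntegral.integral_nonneg hx.1 fun _ _ => abs_nonneg _
        simpa [abs_of_nonneg h0] using h x ⟨hx.1, hx.2.le⟩)
  intro x hx
  have h1 := hg x hx
  have h0 : 0 ≤ ∫ t in (0 : ℝ)..x, |d t| :=
    intervalIntegral.integral_nonneg hx.1 fun _ _ => abs_nonneg _
  simp only [gronwallBound_ε0, zero_mul, Real.norm_eq_abs, abs_of_nonneg h0] at h1
  have h2 := h x hx
  rw [le_antisymm h1 h0, mul_zero] at h2
  exact abs_nonpos_iff.1 h2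

theorem eq_zero_of_norm_le_integral {E : Type*} [NormedAddCommGroup E] {L C : ℝ} {d : ℝ → E} (hd : Continuous d)
    (h : ∀ x ∈ Icc 0 L, ‖d x‖ ≤ C * ∫ t in (0 : ℝ)..x, ‖d t‖) :
    ∀ x ∈ Icc 0 L, d x = 0 := by
  intro x hx
  exact norm_eq_zero.1 (eq_zero_of_le_integral (C := C) (L := L) (d := fun x => ‖d x‖)
    (by fun_prop) (by simpa using h) x hx)

theorem exists_norm_le_of_continuous {E : Type*} [NormedAddCommGroup E] (L : ℝ) {F : ℝ → ℝ → E} (hF : Continuous (uncurry F)) :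
    ∃ C, 0 ≤ C ∧ ∀ x ∈ Icc 0 L, ∀ y ∈ Icc 0 L, ‖F x y‖ ≤ C := by
  obtain ⟨C, hC⟩ := ((isCompact_Icc (a := (0:ℝ)) (b := L)).prod
    (isCompact_Icc (a := (0:ℝ)) (b := L))).exists_bound_of_continuousOn hF.continuousOn
  exact ⟨max C 0, le_max_right _ _, fun x hx y hy => (hC (x, y) ⟨hx, hy⟩).trans (le_max_left _ _)⟩

end Calculus

/-! ### Solvability of the integral equation and smoothness in the parameter -/

section Resolvent

variable {R : Type*} [NormedRing R]

/-- Extension of a continuous function on a square to the plane. -/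
noncomputable def squareExtend {L : ℝ} (hL : 0 ≤ L) (k : C(Icc 0 L × Icc 0 L, R)) : ℝ → ℝ → R :=
  fun x y => k (projIcc 0 L hL x, projIcc 0 L hL y)

theorem continuous_squareExtend {L : ℝ} (hL : 0 ≤ L) (k : C(Icc 0 L × Icc 0 L, R)) :
    Continuous (uncurry (squareExtend hL k)) := by
  have : Continuous fun q : ℝ × ℝ => k (projIcc 0 L hL q.1, projIcc 0 L hL q.2) :=
    k.continuous.comp ((continuous_projIcc.comp continuous_fst).prodMk
      (continuous_projIcc.comp continuous_snd))
  exact this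

theorem squareExtend_coe {L : ℝ} (hL : 0 ≤ L) (k : C(Icc 0 L × Icc 0 L, R)) (x y : Icc 0 L) :
    squareExtend hL k x y = k (x, y) := by
  simp [squareExtend]

theorem norm_squareExtend_le {L : ℝ} (hL : 0 ≤ L) (k : C(Icc 0 L × Icc 0 L, R)) (x y : ℝ) :
    ‖squareExtend hL k x y‖ ≤ ‖k‖ := k.norm_coe_le_norm _

variable [NormedAlgebra ℝ R]

/-- The operators `h ↦ h + s ∫_0^x h(t) F(t, ·) dt` on `C([0, L])` are bounded below by `C⁻¹`,
uniformly in `x ∈ [0, L]` and `s ∈ [0, 1]`. -/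
def UniformlyBoundedBelow (L C : ℝ) (F : ℝ → ℝ → R) : Prop :=
  ∀ s ∈ Icc (0 : ℝ) 1, ∀ x ∈ Icc 0 L, ∀ h : ℝ → R, Continuous h → ∀ ε : ℝ,
    (∀ y ∈ Icc 0 L, ‖h y + s • ∫ t in (0 : ℝ)..x, h t * F t y‖ ≤ ε) →
      ∀ y ∈ Icc 0 L, ‖h y‖ ≤ C * ε

theorem UniformlyBoundedBelow.eq_zero {L C : ℝ} {F : ℝ → ℝ → R}
    (hB : UniformlyBoundedBelow L C F) {x : ℝ} (hx : x ∈ Icc 0 L) {h : ℝ → R} (hh : Continuous h)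
    (h0 : ∀ y ∈ Icc 0 L, h y + ∫ t in (0 : ℝ)..x, h t * F t y = 0) :
    ∀ y ∈ Icc 0 L, h y = 0 := by
  intro y hy
  have := hB 1 (by simp) x hx h hh 0 (fun y hy => by simp [h0 y hy]) y hy
  simpa using this

/-- The operator `k ↦ ∫_0^x k(x, t) F(t, y) dt` on `C([0, L]²)`. -/
noncomputable def kernelOperator {L : ℝ} (hL : 0 ≤ L) {F : ℝ → ℝ → R}
    (hF : Continuous (uncurry F)) :
    C(Icc 0 L × Icc 0 L, R) →L[ℝ] C(Icc 0 L × Icc 0 L, R) :=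
  LinearMap.mkContinuousOfExistsBound
    { toFun := fun k => ⟨fun q => ∫ t in (0 : ℝ)..q.1, squareExtend hL k q.1 t * F t q.2, by
        have := continuous_squareExtend hL k
        fun_prop⟩
      map_add' := by
        intro k l
        ext q
        have h1 := continuous_squareExtend hL k
        have h2 := continuous_squareExtend hL l
        simp only [ContinuousMap.coe_mk, ContinuousMap.add_apply]
        rw [← intervalIntegral.integral_add]
        · simp [squareExtend, add_mul]
        · exact Continuous.intervalIntegrable (by fun_prop) _ _
        · exact Continuous.intervalIntegrable (by fun_prop) _ _
      map_smul' := by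
        intro c k
        ext q
        simp only [ContinuousMap.coe_mk, ContinuousMap.smul_apply, RingHom.id_apply]
        rw [← intervalIntegral.integral_smul]
        simp [squareExtend] }
    (by
      obtain ⟨C, hC0, hC⟩ := exists_norm_le_of_continuous L hF
      refine ⟨C * L, fun k => ?_⟩
      refine (ContinuousMap.norm_le _ (by positivity)).2 fun q => ?_
      obtain ⟨⟨x, hx⟩, y, hy⟩ := q
      refine (intervalIntegral.norm_integral_le_of_norm_le_const (C := ‖k‖ * C)
        fun t ht => ?_).trans ?_
      · rw [uIoc_of_le hx.1] at ht
        exact (norm_mul_le _ _).trans (mul_le_mul (norm_squareExtend_le hL k _ _)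
          (hC t ⟨ht.1.le, ht.2.trans hx.2⟩ y hy) (norm_nonneg _) (norm_nonneg _))
      · rw [sub_zero, abs_of_nonneg hx.1]
        calc ‖k‖ * C * x ≤ ‖k‖ * C * L := by
              have := hx.2
              gcongr
          _ = C * L * ‖k‖ := by ring)

theorem kernelOperator_apply {L : ℝ} (hL : 0 ≤ L) {F : ℝ → ℝ → R}
    (hF : Continuous (uncurry F)) (k : C(Icc 0 L × Icc 0 L, R)) (q : Icc 0 L × Icc 0 L) :
    kernelOperator hL hF k q = ∫ t in (0 : ℝ)..q.1, squareExtend hL k q.1 t * F t q.2 := rfl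

/-- The variable $x$ is a mere parameter of `kernelOperator`, so the one-variable bound applies on
each slice $k(x,\cdot)$; uniformity in $x$ gives the bound on the square. -/
theorem UniformlyBoundedBelow.norm_le {L C : ℝ} {F : ℝ → ℝ → R}
    (hB : UniformlyBoundedBelow L C F) (hL : 0 ≤ L) (hC : 0 ≤ C) (hF : Continuous (uncurry F))
    {s : ℝ} (hs : s ∈ Icc (0 : ℝ) 1) (k : C(Icc 0 L × Icc 0 L, R)) :
    ‖k‖ ≤ C * ‖(1 + s • kernelOperator hL hF) k‖ := by
  refine (ContinuousMap.norm_le _ (by positivity)).2 fun q => ?_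
  obtain ⟨x, y⟩ := q
  have hk := continuous_squareExtend hL k
  have := hB s hs x x.2 (squareExtend hL k x) (by fun_prop)
    ‖(1 + s • kernelOperator hL hF) k‖ (fun z hz => ?_) y y.2
  · rwa [squareExtend_coe] at this
  · have := ((1 + s • kernelOperator hL hF) k).norm_coe_le_norm (x, ⟨z, hz⟩)
    refine le_trans (le_of_eq ?_) this
    congr 1
    simp only [_root_.add_apply, _root_.smul_apply, one_apply_eq_self,
      ContinuousMap.add_apply, ContinuousMap.smul_apply, kernelOperator_apply]
    rw [← squareExtend_coe hL k x ⟨z, hz⟩]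

/-- Method of continuity: invertibility is carried from $s=0$ to $s=1$. The lower bound controls
every inverse by the same `C`, so a fixed step length suffices for a Neumann series. -/
theorem isUnit_one_add_of_norm_le {X : Type*} [NormedAddCommGroup X] [NormedSpace ℝ X]
    [CompleteSpace X] (T : X →L[ℝ] X) {C : ℝ} (hC : 0 ≤ C)
    (hT : ∀ s ∈ Icc (0 : ℝ) 1, ∀ k, ‖k‖ ≤ C * ‖(1 + s • T) k‖) : IsUnit (1 + T) := by
  -- With steps of length $1/n$, the perturbation $n^{-1}u^{-1}T$ has norm below $1$.
  obtain ⟨n, hn⟩ := exists_nat_gt (C * ‖T‖)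
  have hn0 : (0 : ℝ) < n := lt_of_le_of_lt (by positivity) hn
  have key : ∀ j : ℕ, j ≤ n → IsUnit (1 + ((j : ℝ) / n) • T) := by
    intro j
    induction j with
    | zero => simp
    | succ j ih =>
      intro hj
      obtain ⟨u, hu⟩ := ih (by omega)
      have hs : ((j : ℝ) / n) ∈ Icc (0 : ℝ) 1 := by
        refine ⟨by positivity, (div_le_one hn0).2 ?_⟩
        exact_mod_cast (by omega : j ≤ n)
      have hinv : ‖(↑u⁻¹ : X →L[ℝ] X)‖ ≤ C := by
        refine ContinuousLinearMap.opNorm_le_bound _ hC fun k => ?_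
        have h1 := hT _ hs ((↑u⁻¹ : X →L[ℝ] X) k)
        rw [← hu, ← mul_apply_eq_comp, Units.mul_inv,
          one_apply_eq_self] at h1
        exact h1
      have ht : ‖-((1 / (n : ℝ)) • ((↑u⁻¹ : X →L[ℝ] X) * T))‖ < 1 := by
        rw [norm_neg, norm_smul, Real.norm_of_nonneg (by positivity), one_div,
          inv_mul_lt_iff₀ hn0, mul_one]
        refine lt_of_le_of_lt ((norm_mul_le _ _).trans ?_) hn
        gcongr
      have h2 : (1 + (((j + 1 : ℕ) : ℝ) / n) • T) =
          u * (Units.oneSub _ ht : (X →L[ℝ] X)ˣ) := by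
        rw [Units.val_oneSub, sub_neg_eq_add, mul_add, mul_one, mul_smul_comm, ← mul_assoc,
          Units.mul_inv, one_mul, hu, add_assoc, ← add_smul]
        congr 2
        push_cast
        ring
      rw [h2]
      exact u.isUnit.mul (Units.isUnit _)
  have := key n le_rfl
  rwa [div_self hn0.ne', one_smul] at this

variable [CompleteSpace R]

/-- The inhomogeneity `H` is independent of `F` because the $x$-derivatives of $K$ solve the same
equation with other right-hand sides. -/
theorem UniformlyBoundedBelow.exists_solution {L C : ℝ} {F : ℝ → ℝ → R}
    (hB : UniformlyBoundedBelow L C F) (hL : 0 ≤ L) (hC : 0 ≤ C) (hF : Continuous (uncurry F))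
    {H : ℝ → ℝ → R} (hH : Continuous (uncurry H)) :
    ∃ K : ℝ → ℝ → R, Continuous (uncurry K) ∧ ∀ x ∈ Icc 0 L, ∀ y ∈ Icc 0 L,
      K x y + H x y + ∫ t in (0 : ℝ)..x, K x t * F t y = 0 := by
  obtain ⟨u, hu⟩ := isUnit_one_add_of_norm_le (kernelOperator hL hF) hC
    fun s hs k => hB.norm_le hL hC hF hs k
  let H' : C(Icc 0 L × Icc 0 L, R) := ⟨fun q => - H q.1 q.2, by fun_prop⟩
  let k := (↑u⁻¹ : C(Icc 0 L × Icc 0 L, R) →L[ℝ] C(Icc 0 L × Icc 0 L, R)) H'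
  have hk : k + kernelOperator hL hF k = H' := by
    have : (u : C(Icc 0 L × Icc 0 L, R) →L[ℝ] C(Icc 0 L × Icc 0 L, R)) k = H' := by
      rw [← mul_apply_eq_comp, Units.mul_inv, one_apply_eq_self]
    rw [hu] at this
    exact this
  refine ⟨squareExtend hL k, continuous_squareExtend hL k, fun x hx y hy => ?_⟩
  have h1 := congrArg (fun f => f (⟨x, hx⟩, ⟨y, hy⟩)) hk
  simp only [ContinuousMap.add_apply, kernelOperator_apply] at h1
  rw [← squareExtend_coe hL k] at h1
  have h2 : squareExtend hL k x y + (∫ t in (0 : ℝ)..x, squareExtend hL k x t * F t y)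
    = - H x y := h1
  rw [add_right_comm, h2, neg_add_cancel]

/-- Solutions of the integral equation are differentiable in the parameter `x`. -/
theorem UniformlyBoundedBelow.exists_hasDerivWithinAt {L C : ℝ} {F : ℝ → ℝ → R}
    (hB : UniformlyBoundedBelow L C F) (hL : 0 ≤ L) (hC : 0 ≤ C) (hF : Continuous (uncurry F))
    {K H H1 : ℝ → ℝ → R} (hK : Continuous (uncurry K))
    (hH1 : Continuous (uncurry H1))
    (hd : ∀ x ∈ Icc 0 L, ∀ y ∈ Icc 0 L, HasDerivWithinAt (fun x => H x y) (H1 x y) (Icc 0 L) x)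
    (hKH : ∀ x ∈ Icc 0 L, ∀ y ∈ Icc 0 L,
      K x y + H x y + ∫ t in (0 : ℝ)..x, K x t * F t y = 0) :
    ∃ K1 : ℝ → ℝ → R, Continuous (uncurry K1) ∧
      (∀ x ∈ Icc 0 L, ∀ y ∈ Icc 0 L,
        HasDerivWithinAt (fun x => K x y) (K1 x y) (Icc 0 L) x) ∧
      ∀ x ∈ Icc 0 L, ∀ y ∈ Icc 0 L,
        K1 x y + (H1 x y + K x x * F x y) + ∫ t in (0 : ℝ)..x, K1 x t * F t y = 0 := by
  -- Formal differentiation in $x$ gives the equation for the candidate derivative; the term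
  -- $K(x,x)F(x,y)$ comes from the upper limit.
  obtain ⟨K1, hK1, hK1e⟩ := hB.exists_solution hL hC hF
    (H := fun x y => H1 x y + K x x * F x y) (by fun_prop)
  let S : ℝ → ℝ → R := fun x y => K 0 y + ∫ s in (0 : ℝ)..x, K1 s y
  have hS : Continuous (uncurry S) := by fun_prop
  have hSd : ∀ x y, HasDerivAt (fun x => S x y) (K1 x y) x := fun x y =>
    (hasDerivAt_integral_right (f := fun s => K1 s y) (by fun_prop) 0 x).const_add _
  let D : ℝ → ℝ → R := fun x y => S x y - K x y
  have hD : Continuous (uncurry D) := by fun_prop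
  -- The equation of `K1` contains $K(x,x)F$ where differentiating the equation for `S` produces
  -- $S(x,x)F$; the mismatch is the diagonal of `D`.
  have hDe : ∀ x ∈ Icc 0 L, ∀ y ∈ Icc 0 L,
      D x y + ∫ t in (0 : ℝ)..x, D x t * F t y = ∫ s in (0 : ℝ)..x, D s s * F s y := by
    intro x hx y hy
    have hW : ∀ z ∈ Icc 0 L, HasDerivWithinAt
        (fun z => S z y + H z y + ∫ t in (0 : ℝ)..z, S z t * F t y) (D z z * F z y)
        (Icc 0 L) z := by
      intro z hz
      have h1 := ((hSd z y).hasDerivWithinAt.add (hd z hz y hy)).add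
        (hasDerivWithinAt_integral_leibniz (L := L) (f := fun z t => S z t * F t y)
          (f1 := fun z t => K1 z t * F t y) (by fun_prop) (by fun_prop)
          (fun z _ t _ => (hSd z t).hasDerivWithinAt.mul_const _) hz)
      refine h1.congr_deriv ?_
      have h2 := hK1e z hz y hy
      have h3 : D z z * F z y = S z z * F z y - K z z * F z y := sub_mul _ _ _
      rw [h3, ← sub_eq_zero, ← h2]
      abel
    have hI := integral_eq_sub_of_hasDerivWithinAt_Icc hW (by fun_prop) hx
    have h0 : S 0 y + H 0 y + ∫ t in (0 : ℝ)..0, S 0 t * F t y = 0 := by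
      have := hKH 0 (left_mem_Icc.2 hL) y hy
      simpa [S] using this
    rw [hI, h0, sub_zero]
    have h4 : ∫ t in (0 : ℝ)..x, D x t * F t y =
        (∫ t in (0 : ℝ)..x, S x t * F t y) - ∫ t in (0 : ℝ)..x, K x t * F t y := by
      rw [← intervalIntegral.integral_sub]
      · simp [D, sub_mul]
      · exact Continuous.intervalIntegrable (by fun_prop) _ _
      · exact Continuous.intervalIntegrable (by fun_prop) _ _
    have h5 := hKH x hx y hy
    rw [h4, ← sub_eq_zero, ← neg_eq_zero, ← h5]
    simp only [D]
    abel
  obtain ⟨M, hM0, hM⟩ := exists_norm_le_of_continuous L hF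
  have hDb : ∀ x ∈ Icc 0 L, ∀ y ∈ Icc 0 L,
      ‖D x y‖ ≤ C * (M * ∫ s in (0 : ℝ)..x, ‖D s s‖) := by
    intro x hx
    refine hB 1 (by simp) x hx (D x) (by fun_prop) _ fun y hy => ?_
    rw [one_smul, hDe x hx y hy, ← intervalIntegral.integral_const_mul]
    refine intervalIntegral.norm_integral_le_of_norm_le hx.1 (Eventually.of_forall
      fun s hs => ?_) (Continuous.intervalIntegrable (by fun_prop) _ _)
    refine (norm_mul_le _ _).trans ?_
    rw [mul_comm]
    gcongr
    exact hM s ⟨hs.1.le, hs.2.trans hx.2⟩ y hy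
  -- At $y = x$ the bound on `D` involves only its diagonal, so Grönwall kills the diagonal, and
  -- then the same bound kills `D` everywhere.
  have hdiag := eq_zero_of_norm_le_integral (L := L) (C := C * M) (d := fun x => D x x)
    (by fun_prop) (fun x hx => by rw [mul_assoc]; exact hDb x hx x hx)
  have hD0 : ∀ x ∈ Icc 0 L, ∀ y ∈ Icc 0 L, K x y = S x y := by
    intro x hx y hy
    have h1 := hDb x hx y hy
    have h2 : ∫ s in (0 : ℝ)..x, ‖D s s‖ = 0 := by
      rw [intervalIntegral.integral_congr (g := fun _ => (0 : ℝ))]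
      · simp
      · intro s hs
        rw [uIcc_of_le hx.1] at hs
        simp [hdiag s ⟨hs.1, hs.2.trans hx.2⟩]
    rw [h2, mul_zero, mul_zero] at h1
    exact (sub_eq_zero.1 (norm_le_zero_iff.1 h1)).symm
  exact ⟨K1, hK1, fun x hx y hy => (hSd x y).hasDerivWithinAt.congr
    (fun z hz => hD0 z hz y hy) (hD0 x hx y hy), hK1e⟩

end Resolvent

/-! ### Coercivity of $1+\mathcal F$ from the orthogonal expansion -/

section Coercivity

attribute [local instance] Matrix.linftyOpNormedAddCommGroup Matrix.linftyOpNormedSpace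
  Matrix.linftyOpNormedRing Matrix.linftyOpNormedAlgebra

variable {N : ℕ}

theorem abs_entry_le_linfty_opNorm (A : Matrix (Fin N) (Fin N) ℝ) (a b : Fin N) :
    |A a b| ≤ ‖A‖ := by
  rw [linfty_opNorm_def, ← Real.norm_eq_abs, ← coe_nnnorm]
  refine NNReal.coe_le_coe.2 ((Finset.single_le_sum (f := fun b => ‖A a b‖₊)
    (fun _ _ => zero_le) (Finset.mem_univ b)).trans ?_)
  exact Finset.le_sup (f := fun a => ∑ b, ‖A a b‖₊) (Finset.mem_univ a)

/-- Entrywise $|ab| \le (a^2+b^2)/2$. It makes a uniformly small remainder kernel small as a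
quadratic form. -/
theorem integral_dotProduct_mulVec_le {L ε : ℝ} {D : ℝ → ℝ → Matrix (Fin N) (Fin N) ℝ}
    (hD : ∀ t ∈ Icc 0 L, ∀ y ∈ Icc 0 L, ∀ a b, |D t y a b| ≤ ε) {x : ℝ} (hx : x ∈ Icc 0 L)
    {h : ℝ → Fin N → ℝ} (hh : Continuous h) :
    |∫ y in (0 : ℝ)..x, ∫ t in (0 : ℝ)..x, h t ⬝ᵥ (D t y *ᵥ h y)| ≤
      ε * N * x * ∫ t in (0 : ℝ)..x, h t ⬝ᵥ h t := by
  have hp : ∀ t ∈ Ioc 0 x, ∀ y ∈ Ioc 0 x,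
      ‖h t ⬝ᵥ (D t y *ᵥ h y)‖ ≤ ε * N / 2 * (h t ⬝ᵥ h t) + ε * N / 2 * (h y ⬝ᵥ h y) := by
    intro t ht y hy
    have h1 : ε * N / 2 * (h t ⬝ᵥ h t) + ε * N / 2 * (h y ⬝ᵥ h y) =
        ∑ a, ∑ b, ε * ((h t a * h t a + h y b * h y b) / 2) := by
      have h0 : ∀ a, ∑ b, ε * ((h t a * h t a + h y b * h y b) / 2) =
          ε * N / 2 * (h t a * h t a) + ε / 2 * (h y ⬝ᵥ h y) := by
        intro a
        rw [← Finset.mul_sum, ← Finset.sum_div, Finset.sum_add_distrib]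
        simp only [dotProduct, Finset.sum_const, Finset.card_univ, Fintype.card_fin, nsmul_eq_mul]
        ring
      simp only [h0, Finset.sum_add_distrib, ← Finset.mul_sum]
      simp only [dotProduct, Finset.sum_const, Finset.card_univ, Fintype.card_fin, nsmul_eq_mul]
      ring
    rw [h1]
    simp only [dotProduct, mulVec, Finset.mul_sum, Real.norm_eq_abs]
    refine (Finset.abs_sum_le_sum_abs _ _).trans (Finset.sum_le_sum fun a _ => ?_)
    refine (Finset.abs_sum_le_sum_abs _ _).trans (Finset.sum_le_sum fun b _ => ?_)
    have h2 := hD t ⟨ht.1.le, ht.2.trans hx.2⟩ y ⟨hy.1.le, hy.2.trans hx.2⟩ a b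
    have h3 : |h t a * (D t y a b * h y b)| = |D t y a b| * (|h t a| * |h y b|) := by
      rw [abs_mul, abs_mul]; ring
    rw [h3]
    refine mul_le_mul h2 ?_ (by positivity) ((abs_nonneg _).trans h2)
    nlinarith [sq_nonneg (|h t a| - |h y b|), abs_mul_abs_self (h t a), abs_mul_abs_self (h y b)]
  have hJ : Continuous fun t => h t ⬝ᵥ h t := by fun_prop
  have hin : ∀ y ∈ Ioc 0 x, ‖∫ t in (0 : ℝ)..x, h t ⬝ᵥ (D t y *ᵥ h y)‖ ≤
      ε * N / 2 * (∫ t in (0 : ℝ)..x, h t ⬝ᵥ h t) + x * (ε * N / 2 * (h y ⬝ᵥ h y)) := by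
    intro y hy
    refine (intervalIntegral.norm_integral_le_of_norm_le hx.1 (Eventually.of_forall
      fun t ht => hp t ht y hy) (Continuous.intervalIntegrable (by fun_prop) _ _)).trans
      (le_of_eq ?_)
    rw [intervalIntegral.integral_add (Continuous.intervalIntegrable (by fun_prop) _ _)
      (Continuous.intervalIntegrable (by fun_prop) _ _), intervalIntegral.integral_const_mul,
      intervalIntegral.integral_const]
    simp
  rw [← Real.norm_eq_abs]
  refine (intervalIntegral.norm_integral_le_of_norm_le hx.1 (Eventually.of_forall hin)
    (Continuous.intervalIntegrable (by fun_prop) _ _)).trans (le_of_eq ?_)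
  rw [intervalIntegral.integral_add (Continuous.intervalIntegrable (by fun_prop) _ _)
    (Continuous.intervalIntegrable (by fun_prop) _ _), intervalIntegral.integral_const_mul,
    intervalIntegral.integral_const_mul, intervalIntegral.integral_const_mul,
    intervalIntegral.integral_const]
  simp only [sub_zero, smul_eq_mul]
  ring

theorem integral_dotProduct_sub_mulVec {A B : ℝ → ℝ → Matrix (Fin N) (Fin N) ℝ}
    (hA : Continuous (uncurry A)) (hB : Continuous (uncurry B)) (x : ℝ) {h : ℝ → Fin N → ℝ}
    (hh : Continuous h) :
    ∫ y in (0 : ℝ)..x, ∫ t in (0 : ℝ)..x, h t ⬝ᵥ ((A t y - B t y) *ᵥ h y) =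
      (∫ y in (0 : ℝ)..x, ∫ t in (0 : ℝ)..x, h t ⬝ᵥ (A t y *ᵥ h y)) -
      ∫ y in (0 : ℝ)..x, ∫ t in (0 : ℝ)..x, h t ⬝ᵥ (B t y *ᵥ h y) := by
  rw [← intervalIntegral.integral_sub]
  · refine intervalIntegral.integral_congr fun y _ => ?_
    show _ = (∫ t in (0 : ℝ)..x, h t ⬝ᵥ (A t y *ᵥ h y)) - _
    rw [← intervalIntegral.integral_sub]
    · simp only [sub_mulVec, dotProduct_sub]
    all_goals exact Continuous.intervalIntegrable (by fun_prop) _ _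
  all_goals exact Continuous.intervalIntegrable (by fun_prop) _ _

variable {ι : Type*}

/-- The finite-rank kernel `∑ c_q e_q(x) e_q(y)*`. -/
def sumKernel (c : ι → ℝ) (e : ι → ℝ → Fin N → ℝ) (s : Finset ι) (x y : ℝ) :
    Matrix (Fin N) (Fin N) ℝ :=
  ∑ q ∈ s, c q • vecMulVec (e q x) (e q y)

theorem sumKernel_mulVec (c : ι → ℝ) (e : ι → ℝ → Fin N → ℝ) (s : Finset ι) (x y : ℝ)
    (v : Fin N → ℝ) :
    sumKernel c e s x y *ᵥ v = ∑ q ∈ s, (c q * (e q y ⬝ᵥ v)) • e q x := by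
  simp only [sumKernel, sum_mulVec, smul_mulVec, vecMulVec_mulVec]
  refine Finset.sum_congr rfl fun q _ => ?_
  ext a
  simp
  ring

theorem continuous_sumKernel {c : ι → ℝ} {e : ι → ℝ → Fin N → ℝ} (he : ∀ q, Continuous (e q))
    (s : Finset ι) : Continuous (uncurry (sumKernel c e s)) := by
  have : Continuous fun z : ℝ × ℝ => ∑ q ∈ s, c q • vecMulVec (e q z.1) (e q z.2) := by
    refine continuous_finsetSum _ fun q _ => Continuous.fun_const_smul ?_ _
    exact Continuous.matrix_vecMulVec ((he q).comp continuous_fst) ((he q).comp continuous_snd)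
  exact this

theorem integral_dotProduct_sumKernel {c : ι → ℝ} {e : ι → ℝ → Fin N → ℝ}
    (he : ∀ q, Continuous (e q)) (s : Finset ι) (x : ℝ) {h : ℝ → Fin N → ℝ} (hh : Continuous h) :
    ∫ y in (0 : ℝ)..x, ∫ t in (0 : ℝ)..x, h t ⬝ᵥ (sumKernel c e s t y *ᵥ h y) =
      ∑ q ∈ s, c q * (∫ t in (0 : ℝ)..x, h t ⬝ᵥ e q t) ^ 2 := by
  have h1 : ∀ y t, h t ⬝ᵥ (sumKernel c e s t y *ᵥ h y) =
      ∑ q ∈ s, (c q * (h y ⬝ᵥ e q y)) * (h t ⬝ᵥ e q t) := by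
    intro y t
    rw [sumKernel_mulVec, dotProduct_sum]
    refine Finset.sum_congr rfl fun q _ => ?_
    rw [dotProduct_smul, smul_eq_mul, dotProduct_comm (e q y)]
  have h2 : ∀ y, ∫ t in (0 : ℝ)..x, h t ⬝ᵥ (sumKernel c e s t y *ᵥ h y) =
      ∑ q ∈ s, (c q * ∫ t in (0 : ℝ)..x, h t ⬝ᵥ e q t) * (h y ⬝ᵥ e q y) := by
    intro y
    simp only [h1]
    rw [intervalIntegral.integral_finsetSum]
    · refine Finset.sum_congr rfl fun q _ => ?_
      rw [intervalIntegral.integral_const_mul]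
      ring
    · intro q _
      have := he q
      exact Continuous.intervalIntegrable (by fun_prop) _ _
  simp only [h2]
  rw [intervalIntegral.integral_finsetSum]
  · refine Finset.sum_congr rfl fun q _ => ?_
    rw [intervalIntegral.integral_const_mul]
    ring
  · intro q _
    have := he q
    exact Continuous.intervalIntegrable (by fun_prop) _ _

/-- A weighted Bessel inequality for a finite orthogonal family. -/
theorem neg_sum_mul_sq_integral_le {L κ : ℝ} (hκ : 0 < κ) {c : ι → ℝ} {e : ι → ℝ → Fin N → ℝ}
    (he : ∀ q, Continuous (e q))
    (horth : ∀ p q, p ≠ q → ∫ t in (0 : ℝ)..L, e p t ⬝ᵥ e q t = 0)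
    (hc : ∀ q, -(c q * ∫ t in (0 : ℝ)..L, e q t ⬝ᵥ e q t) ≤ κ) (s : Finset ι) {x : ℝ}
    (hx : x ∈ Icc 0 L) {h : ℝ → Fin N → ℝ} (hh : Continuous h) :
    -∑ q ∈ s, c q * (∫ t in (0 : ℝ)..x, h t ⬝ᵥ e q t) ^ 2 ≤
      κ * ∫ t in (0 : ℝ)..x, h t ⬝ᵥ h t := by
  classical
  set b : ι → ℝ := fun q => ∫ t in (0 : ℝ)..x, h t ⬝ᵥ e q t with hb
  set ν : ι → ℝ := fun q => ∫ t in (0 : ℝ)..L, e q t ⬝ᵥ e q t with hν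
  have hν0 : ∀ q, 0 ≤ ν q := fun q =>
    intervalIntegral.integral_nonneg (hx.1.trans hx.2) fun t _ => by
      simpa using dotProduct_star_self_nonneg (e q t)
  set d : ι → ℝ := fun q => max (-c q) 0 with hd
  have hdν : ∀ q, d q * ν q ≤ κ := by
    intro q
    simp only [hd]
    rcases max_cases (-c q) 0 with h1 | h1 <;> rw [h1.1]
    · rw [neg_mul]; exact hc q
    · rw [zero_mul]; exact hκ.le
  have hd0 : ∀ q, 0 ≤ d q := fun q => le_max_right _ _
  -- With `d` the negative part of `c`, these weights give $\kappa\sum w_q b_q = \sum d_q b_q^2$,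
  -- and $d_q\nu_q \le \kappa$ gives $\sum w_q^2\nu_q \le \sum w_q b_q$. Hence $0 \le \int_0^x
  -- |h-g|^2 \le \int_0^x |h|^2 - \sum w_q b_q$.
  set w : ι → ℝ := fun q => d q * b q / κ with hw
  set g : ℝ → Fin N → ℝ := fun t => ∑ q ∈ s, w q • e q t with hg
  have hgc : Continuous g := continuous_finsetSum _ fun q _ => (he q).fun_const_smul _
  have hhg : ∫ t in (0 : ℝ)..x, h t ⬝ᵥ g t = ∑ q ∈ s, w q * b q := by
    simp only [hg, dotProduct_sum, dotProduct_smul, smul_eq_mul]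
    rw [intervalIntegral.integral_finsetSum]
    · simp [hb]
    · intro q _
      have := he q
      exact Continuous.intervalIntegrable (by fun_prop) _ _
  have hgg : ∫ t in (0 : ℝ)..L, g t ⬝ᵥ g t = ∑ q ∈ s, w q * (w q * ν q) := by
    have h1 : ∀ q ∈ s, ∫ t in (0 : ℝ)..L, g t ⬝ᵥ e q t = w q * ν q := by
      intro q hq
      simp only [hg, sum_dotProduct, smul_dotProduct, smul_eq_mul]
      rw [intervalIntegral.integral_finsetSum, Finset.sum_eq_single q]
      · rw [intervalIntegral.integral_const_mul]
      · intro p _ hpq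
        rw [intervalIntegral.integral_const_mul, horth p q hpq, mul_zero]
      · exact fun h => absurd hq h
      · intro p _
        have := he q
        have := he p
        exact Continuous.intervalIntegrable (by fun_prop) _ _
    have h2 : ∀ t, g t ⬝ᵥ g t = ∑ q ∈ s, w q * (g t ⬝ᵥ e q t) := by
      intro t
      conv_lhs => rw [show g t ⬝ᵥ g t = g t ⬝ᵥ ∑ q ∈ s, w q • e q t from rfl]
      simp [dotProduct_sum, dotProduct_smul]
    simp only [h2]
    rw [intervalIntegral.integral_finsetSum]
    · refine Finset.sum_congr rfl fun q hq => ?_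
      rw [intervalIntegral.integral_const_mul, h1 q hq]
    · intro p _
      have := he p
      exact Continuous.intervalIntegrable (by fun_prop) _ _
  have hsq : 0 ≤ ∫ t in (0 : ℝ)..x, (h t - g t) ⬝ᵥ (h t - g t) :=
    intervalIntegral.integral_nonneg hx.1 fun t _ => by
      simpa using dotProduct_star_self_nonneg (h t - g t)
  have hexp : ∫ t in (0 : ℝ)..x, (h t - g t) ⬝ᵥ (h t - g t) =
      (∫ t in (0 : ℝ)..x, h t ⬝ᵥ h t) - 2 * (∫ t in (0 : ℝ)..x, h t ⬝ᵥ g t) +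
        ∫ t in (0 : ℝ)..x, g t ⬝ᵥ g t := by
    rw [← intervalIntegral.integral_const_mul, ← intervalIntegral.integral_sub,
      ← intervalIntegral.integral_add]
    · refine intervalIntegral.integral_congr fun t _ => ?_
      simp only [sub_dotProduct, dotProduct_sub, dotProduct_comm (g t) (h t)]
      ring
    all_goals exact Continuous.intervalIntegrable (by fun_prop) _ _
  have hmono : ∫ t in (0 : ℝ)..x, g t ⬝ᵥ g t ≤ ∫ t in (0 : ℝ)..L, g t ⬝ᵥ g t := by
    have h1 : 0 ≤ ∫ t in x..L, g t ⬝ᵥ g t :=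
      intervalIntegral.integral_nonneg hx.2 fun t _ => by
        simpa using dotProduct_star_self_nonneg (g t)
    rw [← intervalIntegral.integral_add_adjacent_intervals (a := 0) (b := x) (c := L)]
    · linarith
    all_goals exact Continuous.intervalIntegrable (by fun_prop) _ _
  have hle : ∑ q ∈ s, w q * (w q * ν q) ≤ ∑ q ∈ s, w q * b q := by
    refine Finset.sum_le_sum fun q _ => ?_
    have h1 : w q * (w q * ν q) = (d q * b q ^ 2 / κ) * (d q * ν q / κ) := by
      simp only [hw]; ring
    have h2 : w q * b q = (d q * b q ^ 2 / κ) * 1 := by simp only [hw]; ring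
    rw [h1, h2]
    refine mul_le_mul_of_nonneg_left ((div_le_one hκ).2 (hdν q)) ?_
    have := hd0 q
    positivity
  have hfin : -∑ q ∈ s, c q * b q ^ 2 ≤ κ * ∑ q ∈ s, w q * b q := by
    rw [Finset.mul_sum, ← Finset.sum_neg_distrib]
    refine Finset.sum_le_sum fun q _ => ?_
    have h2 : κ * (w q * b q) = d q * b q ^ 2 := by simp only [hw]; field_simp
    rw [h2, ← neg_mul]
    exact mul_le_mul_of_nonneg_right (le_max_left _ _) (sq_nonneg _)
  refine hfin.trans (mul_le_mul_of_nonneg_left ?_ hκ.le)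
  linarith

/-- The hypotheses on the series `∑ c_q e_q(x) e_q(y)*`, with partial sums over `s n`. -/
structure OrthogonalExpansion (L : ℝ) (c : ι → ℝ) (e : ι → ℝ → Fin N → ℝ) (s : ℕ → Finset ι)
    (F : ℝ → ℝ → Matrix (Fin N) (Fin N) ℝ) : Prop where
  nonneg : 0 ≤ L
  continuous_kernel : Continuous (uncurry F)
  continuous_fun (q : ι) : Continuous (e q)
  orthogonal (p q : ι) : p ≠ q → ∫ t in (0 : ℝ)..L, e p t ⬝ᵥ e q t = 0
  exists_mem (q : ι) : ∃ n₀, ∀ n ≥ n₀, q ∈ s n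
  uniform (ε : ℝ) : 0 < ε → ∃ n₀, ∀ n ≥ n₀, ∀ x ∈ Icc 0 L, ∀ y ∈ Icc 0 L, ∀ a b,
    |F x y a b - sumKernel c e (s n) x y a b| ≤ ε
  pos (q : ι) : 0 < 1 + c q * ∫ t in (0 : ℝ)..L, e q t ⬝ᵥ e q t

namespace OrthogonalExpansion

variable {L : ℝ} {c : ι → ℝ} {e : ι → ℝ → Fin N → ℝ} {s : ℕ → Finset ι}
    {F : ℝ → ℝ → Matrix (Fin N) (Fin N) ℝ}

/-- Orthogonality leaves only the term of `q` in each partial sum that contains it, and uniform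
convergence passes the identity to the limit. -/
theorem integral_mulVec (H : OrthogonalExpansion L c e s F) (q : ι) {x : ℝ} (hx : x ∈ Icc 0 L) :
    ∫ y in (0 : ℝ)..L, F x y *ᵥ e q y =
      (c q * ∫ t in (0 : ℝ)..L, e q t ⬝ᵥ e q t) • e q x := by
  classical
  have hFc := H.continuous_kernel
  have hec := H.continuous_fun
  have heq := hec q
  obtain ⟨M, hM⟩ := (isCompact_Icc (a := (0:ℝ)) (b := L)).exists_bound_of_continuousOn
    heq.continuousOn
  obtain ⟨n₁, hn₁⟩ := H.exists_mem q
  have hsum : ∀ n ≥ n₁, ∫ y in (0 : ℝ)..L, sumKernel c e (s n) x y *ᵥ e q y =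
      (c q * ∫ t in (0 : ℝ)..L, e q t ⬝ᵥ e q t) • e q x := by
    intro n hn
    simp only [sumKernel_mulVec]
    rw [intervalIntegral.integral_finsetSum, Finset.sum_eq_single q]
    · rw [intervalIntegral.integral_smul_const, intervalIntegral.integral_const_mul]
    · intro p _ hpq
      rw [intervalIntegral.integral_smul_const, intervalIntegral.integral_const_mul,
        H.orthogonal p q hpq, mul_zero, zero_smul]
    · exact fun h => absurd (hn₁ n hn) h
    · intro p _
      have := hec p
      exact Continuous.intervalIntegrable (by fun_prop) _ _
  have hbd : ∀ ε > 0, ‖(∫ y in (0 : ℝ)..L, F x y *ᵥ e q y) -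
      (c q * ∫ t in (0 : ℝ)..L, e q t ⬝ᵥ e q t) • e q x‖ ≤ ε * (N * |M| * L) := by
    intro ε hε
    obtain ⟨n₀, hn₀⟩ := H.uniform ε hε
    have hsc := continuous_sumKernel (c := c) hec (s (max n₀ n₁))
    rw [← hsum (max n₀ n₁) (le_max_right _ _), ← intervalIntegral.integral_sub]
    · refine (intervalIntegral.norm_integral_le_of_norm_le_const (C := ε * (N * |M|))
        fun y hy => ?_).trans (le_of_eq ?_)
      · rw [uIoc_of_le H.nonneg] at hy
        rw [← sub_mulVec]
        refine (pi_norm_le_iff_of_nonneg (by positivity)).2 fun a => ?_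
        simp only [mulVec, dotProduct, Real.norm_eq_abs]
        refine (Finset.abs_sum_le_sum_abs _ _).trans ?_
        refine (Finset.sum_le_card_nsmul _ _ (ε * |M|) fun b _ => ?_).trans (le_of_eq ?_)
        · rw [abs_mul]
          refine mul_le_mul (hn₀ _ (le_max_left _ _) x hx y ⟨hy.1.le, hy.2⟩ a b) ?_
            (abs_nonneg _) hε.le
          exact (norm_le_pi_norm (e q y) b).trans ((hM y ⟨hy.1.le, hy.2⟩).trans (le_abs_self _))
        · simp; ring
      · rw [sub_zero, abs_of_nonneg H.nonneg]; ring
    all_goals exact Continuous.intervalIntegrable (by fun_prop) _ _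
  refine sub_eq_zero.1 (norm_le_zero_iff.1 (le_of_forall_pos_le_add fun η hη => ?_))
  have hK : 0 ≤ N * |M| * L := by have := H.nonneg; positivity
  refine (hbd (η / (N * |M| * L + 1)) (by positivity)).trans ?_
  rw [zero_add, div_mul_eq_mul_div, div_le_iff₀ (by positivity)]
  nlinarith

/-- Finitely many indices are handled by positivity alone. For `q` outside a late partial sum,
testing the small remainder against `e q` yields $c_q\nu_q^2$, with $\nu_q = \|e_q\|^2$, so
$|c_q\nu_q| \le 1/2$ unless $\nu_q = 0$. -/
theorem exists_neg_le (H : OrthogonalExpansion L c e s F) :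
    ∃ κ, 0 < κ ∧ κ < 1 ∧ ∀ q, -(c q * ∫ t in (0 : ℝ)..L, e q t ⬝ᵥ e q t) ≤ κ := by
  classical
  have hFc := H.continuous_kernel
  have hec := H.continuous_fun
  have hL := H.nonneg
  have hNL : (0 : ℝ) ≤ N * L := by positivity
  -- Chosen so that the remainder form on $[0,L]$ is at most half the squared norm; the $+1$ keeps
  -- the denominator positive when $NL = 0$.
  obtain ⟨n, hn⟩ := H.uniform (1 / (2 * (N * L + 1))) (by positivity)
  have hsc := continuous_sumKernel (c := c) hec (s n)
  have hout : ∀ q ∉ s n, -(c q * ∫ t in (0 : ℝ)..L, e q t ⬝ᵥ e q t) ≤ 1 / 2 := by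
    intro q hq
    have heq := hec q
    set ν := ∫ t in (0 : ℝ)..L, e q t ⬝ᵥ e q t with hν
    have hν0 : 0 ≤ ν := intervalIntegral.integral_nonneg hL fun t _ => by
      simpa using dotProduct_star_self_nonneg (e q t)
    have h1 := integral_dotProduct_mulVec_le (D := fun t y => F t y - sumKernel c e (s n) t y)
      (fun t ht y hy a b => hn n le_rfl t ht y hy a b) (right_mem_Icc.2 hL) heq
    have h2 : ∫ y in (0 : ℝ)..L, ∫ t in (0 : ℝ)..L,
        e q t ⬝ᵥ ((F t y - sumKernel c e (s n) t y) *ᵥ e q y) = c q * ν * ν := by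
      have h3 : ∫ y in (0 : ℝ)..L, ∫ t in (0 : ℝ)..L, e q t ⬝ᵥ (F t y *ᵥ e q y) =
          c q * ν * ν := by
        rw [intervalIntegral_swap (by fun_prop)]
        rw [intervalIntegral.integral_congr (g := fun t => c q * ν * (e q t ⬝ᵥ e q t)),
          intervalIntegral.integral_const_mul]
        intro t ht
        rw [uIcc_of_le hL] at ht
        have h4 := H.integral_mulVec q ht
        have h5 := ((LinearMap.toContinuousLinearMap
          (dotProductBilin ℝ ℝ (e q t)))).intervalIntegral_comp_comm
          (f := fun y => F t y *ᵥ e q y) (μ := volume) (a := 0) (b := L)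
          (Continuous.intervalIntegrable (by fun_prop) _ _)
        rw [h4] at h5
        simpa using h5
      have h4 := integral_dotProduct_sumKernel (c := c) hec (s n) L heq
      rw [Finset.sum_eq_zero] at h4
      · rw [integral_dotProduct_sub_mulVec hFc hsc L heq, h3, h4, sub_zero]
      · intro p hp
        rw [H.orthogonal q p (fun h => hq (h ▸ hp))]
        simp
    rw [h2] at h1
    rcases hν0.eq_or_lt with h0 | h0
    · rw [← h0]; norm_num
    · have h3 : 1 / (2 * (N * L + 1)) * N * L * ν ≤ 1 / 2 * ν := by
        refine mul_le_mul_of_nonneg_right ?_ hν0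
        rw [div_mul_eq_mul_div, div_mul_eq_mul_div, div_le_div_iff₀ (by positivity) (by positivity)]
        linarith
      have h4 := (neg_le_abs _).trans (h1.trans h3)
      rw [← neg_mul] at h4
      exact le_of_mul_le_mul_right h4 h0
  obtain ⟨κ, hκ1, hκ⟩ : ∃ κ < 1, ∀ q ∈ s n,
      -(c q * ∫ t in (0 : ℝ)..L, e q t ⬝ᵥ e q t) ≤ κ := by
    induction s n using Finset.induction_on with
    | empty => exact ⟨0, by norm_num, by simp⟩
    | insert q t _ ih =>
      obtain ⟨κ, hκ1, hκ⟩ := ih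
      refine ⟨max κ (-(c q * ∫ t in (0 : ℝ)..L, e q t ⬝ᵥ e q t)), max_lt hκ1 ?_, ?_⟩
      · linarith [H.pos q]
      · intro p hp
        rcases Finset.mem_insert.1 hp with rfl | hp
        · exact le_max_right _ _
        · exact (hκ p hp).trans (le_max_left _ _)
  refine ⟨max κ (1 / 2), by positivity, max_lt hκ1 (by norm_num), fun q => ?_⟩
  by_cases hq : q ∈ s n
  · exact (hκ q hq).trans (le_max_left _ _)
  · exact (hout q hq).trans (le_max_right _ _)

/-- The quadratic form of `1 + F` is coercive, uniformly over the intervals `[0, x]`. -/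
theorem exists_coercive (H : OrthogonalExpansion L c e s F) :
    ∃ δ, 0 < δ ∧ δ ≤ 1 ∧ ∀ x ∈ Icc 0 L, ∀ h : ℝ → Fin N → ℝ, Continuous h →
      δ * ∫ t in (0 : ℝ)..x, h t ⬝ᵥ h t ≤ (∫ t in (0 : ℝ)..x, h t ⬝ᵥ h t) +
        ∫ y in (0 : ℝ)..x, ∫ t in (0 : ℝ)..x, h t ⬝ᵥ (F t y *ᵥ h y) := by
  have hFc := H.continuous_kernel
  have hec := H.continuous_fun
  have hL := H.nonneg
  have hNL : (0 : ℝ) ≤ N * L := by positivity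
  obtain ⟨κ, hκ0, hκ1, hκ⟩ := H.exists_neg_le
  -- The partial sum costs at most $\kappa$ and the remainder at most $(1-\kappa)/2$, which leaves
  -- $\delta = (1-\kappa)/2$.
  obtain ⟨n, hn⟩ := H.uniform ((1 - κ) / (2 * (N * L + 1))) (by
    have : 0 < 1 - κ := by linarith
    positivity)
  have hsc := continuous_sumKernel (c := c) hec (s n)
  refine ⟨(1 - κ) / 2, by linarith, by linarith, fun x hx h hh => ?_⟩
  have hJ : 0 ≤ ∫ t in (0 : ℝ)..x, h t ⬝ᵥ h t := intervalIntegral.integral_nonneg hx.1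
    fun t _ => by simpa using dotProduct_star_self_nonneg (h t)
  have h1 := neg_sum_mul_sq_integral_le hκ0 hec H.orthogonal hκ (s n) hx hh
  have h2 := integral_dotProduct_mulVec_le (D := fun t y => F t y - sumKernel c e (s n) t y)
    (fun t ht y hy a b => hn n le_rfl t ht y hy a b) hx hh
  rw [← integral_dotProduct_sumKernel hec (s n) x hh] at h1
  rw [integral_dotProduct_sub_mulVec hFc hsc x hh] at h2
  have h4 : (1 - κ) / (2 * (N * L + 1)) * N * x ≤ (1 - κ) / 2 := by
    rw [div_mul_eq_mul_div, div_mul_eq_mul_div, div_le_div_iff₀ (by positivity) (by positivity)]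
    have : (N : ℝ) * x ≤ N * L := by have := hx.2; gcongr
    nlinarith
  have h5 := (neg_le_abs _).trans (h2.trans (mul_le_mul_of_nonneg_right h4 hJ))
  linarith

/-- Coercivity bounds each row of `h` in $L^2(0,x)$; this bounds $\int_0^x\|h\|$, hence $\int_0^x
hF$ in sup norm, and `h` is the given small quantity minus a multiple of that integral. -/
theorem exists_uniformlyBoundedBelow (H : OrthogonalExpansion L c e s F) :
    ∃ C, 0 ≤ C ∧ UniformlyBoundedBelow L C F := by
  have hFc := H.continuous_kernel
  have hL := H.nonneg
  obtain ⟨δ, hδ0, hδ1, hδ⟩ := H.exists_coercive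
  obtain ⟨M, hM0, hM⟩ := exists_norm_le_of_continuous L hFc
  -- Solves $\delta J \le \tfrac{\delta}{2}J + LN\varepsilon^2/(2\delta)$ for $J = \int_0^x
  -- |h_a|^2$.
  set B : ℝ := N * L / δ ^ 2 with hB
  have hB0 : 0 ≤ B := by positivity
  set C : ℝ := 1 + M * (N * N * (L + B) / 2) with hC
  have hC0 : 0 ≤ C := by positivity
  -- Strict positivity is needed because $\varepsilon$ is also a weight in $|a| \le \varepsilon/2 +
  -- a^2/(2\varepsilon)$; $\varepsilon = 0$ is reached by a limit.
  have main : ∀ σ ∈ Icc (0 : ℝ) 1, ∀ x ∈ Icc 0 L, ∀ h : ℝ → Matrix (Fin N) (Fin N) ℝ,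
      Continuous h → ∀ ε > 0,
      (∀ y ∈ Icc 0 L, ‖h y + σ • ∫ t in (0 : ℝ)..x, h t * F t y‖ ≤ ε) →
      ∀ y ∈ Icc 0 L, ‖h y‖ ≤ C * ε := by
    intro σ hσ x hx h hh ε hε hbd y hy
    have hrow : ∀ a, ∫ t in (0 : ℝ)..x, h t a ⬝ᵥ h t a ≤ B * ε ^ 2 := by
      intro a
      have hr : Continuous fun t => h t a := by fun_prop
      have h1 := hδ x hx (fun t => h t a) hr
      set J := ∫ t in (0 : ℝ)..x, h t a ⬝ᵥ h t a with hJ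
      set Q := ∫ y in (0 : ℝ)..x, ∫ t in (0 : ℝ)..x, h t a ⬝ᵥ (F t y *ᵥ h y a) with hQ
      have hJ0 : 0 ≤ J := intervalIntegral.integral_nonneg hx.1 fun t _ => by
        simpa using dotProduct_star_self_nonneg (h t a)
      have hE : ∫ y in (0 : ℝ)..x, (h y + σ • ∫ t in (0 : ℝ)..x, h t * F t y) a ⬝ᵥ h y a =
          J + σ * Q := by
        rw [hJ, hQ, ← intervalIntegral.integral_const_mul, ← intervalIntegral.integral_add]
        · refine intervalIntegral.integral_congr fun y _ => ?_
          show (h y a + σ • (∫ t in (0 : ℝ)..x, h t * F t y) a) ⬝ᵥ h y a = _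
          rw [add_dotProduct, smul_dotProduct, smul_eq_mul]
          congr 2
          have h5 := (LinearMap.toContinuousLinearMap
            ((dotProductBilin ℝ ℝ (h y a)).comp
              (LinearMap.proj (R := ℝ) (φ := fun _ : Fin N => Fin N → ℝ) a))
            ).intervalIntegral_comp_comm
            (f := fun t => (h t * F t y : Fin N → Fin N → ℝ)) (μ := volume) (a := 0) (b := x)
            (Continuous.intervalIntegrable (by fun_prop) _ _)
          rw [dotProduct_comm]
          refine Eq.trans h5.symm (intervalIntegral.integral_congr fun t _ => ?_)
          show h y a ⬝ᵥ (h t a ᵥ* F t y) = _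
          rw [dotProduct_comm, dotProduct_mulVec]
        all_goals exact Continuous.intervalIntegrable (by fun_prop) _ _
      -- Weighted AM-GM entry by entry, with the weight chosen so that half of the coercive term can
      -- be absorbed.
      have hupper : J + σ * Q ≤ δ / 2 * J + x * (N * (ε ^ 2 / (2 * δ))) := by
        rw [← hE, hJ, ← intervalIntegral.integral_const_mul]
        have h6 : x * (N * (ε ^ 2 / (2 * δ))) =
            ∫ _ in (0 : ℝ)..x, (N : ℝ) * (ε ^ 2 / (2 * δ)) := by
          rw [intervalIntegral.integral_const, sub_zero, smul_eq_mul]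
        rw [h6, ← intervalIntegral.integral_add
          (Continuous.intervalIntegrable (by fun_prop) _ _)
          (Continuous.intervalIntegrable (by fun_prop) _ _)]
        refine intervalIntegral.integral_mono_on hx.1
          (Continuous.intervalIntegrable (by fun_prop) _ _)
          (Continuous.intervalIntegrable (by fun_prop) _ _) fun y hy => ?_
        have h7 := hbd y ⟨hy.1, hy.2.trans hx.2⟩
        have h8 : δ / 2 * (h y a ⬝ᵥ h y a) + N * (ε ^ 2 / (2 * δ)) =
            ∑ b, (δ / 2 * (h y a b * h y a b) + ε ^ 2 / (2 * δ)) := by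
          simp [dotProduct, Finset.mul_sum, Finset.sum_add_distrib]
        rw [h8]
        refine Finset.sum_le_sum fun b _ => ?_
        have h9 := (abs_entry_le_linfty_opNorm _ a b).trans h7
        set u := (h y + σ • ∫ t in (0 : ℝ)..x, h t * F t y) a b
        have h10 : u * h y a b ≤ ε * |h y a b| := by
          refine (le_abs_self _).trans ?_
          rw [abs_mul]
          exact mul_le_mul_of_nonneg_right h9 (abs_nonneg _)
        refine h10.trans ?_
        rw [← abs_mul_abs_self (h y a b)]
        have h11 : δ / 2 * (|h y a b| * |h y a b|) + ε ^ 2 / (2 * δ) - ε * |h y a b| =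
            (δ * |h y a b| - ε) ^ 2 / (2 * δ) := by field_simp; ring
        have h12 : 0 ≤ (δ * |h y a b| - ε) ^ 2 / (2 * δ) := by positivity
        linarith
      -- $J+\sigma Q = \sigma(J+Q) + (1-\sigma)J$, and both parts dominate since $\delta \le 1$.
      have hlow : δ * J ≤ J + σ * Q := by
        nlinarith [hσ.1, hσ.2, mul_nonneg hσ.1 (sub_nonneg.2 h1),
          mul_nonneg (mul_nonneg (sub_nonneg.2 hσ.2) (sub_nonneg.2 hδ1)) hJ0]
      have hx2 : x * (N * (ε ^ 2 / (2 * δ))) ≤ L * (N * (ε ^ 2 / (2 * δ))) := by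
        have := hx.2
        gcongr
      have h13 : δ / 2 * J ≤ δ / 2 * (B * ε ^ 2) := by
        have : δ / 2 * (B * ε ^ 2) = L * (N * (ε ^ 2 / (2 * δ))) := by
          rw [hB]; field_simp
        linarith
      exact le_of_mul_le_mul_left h13 (by positivity)
    have hint : ∫ t in (0 : ℝ)..x, ‖h t‖ ≤ N * N * (L + B) / 2 * ε := by
      have h1 : ∀ t, ‖h t‖ ≤ N * N * (ε / 2) + ∑ a, 1 / (2 * ε) * (h t a ⬝ᵥ h t a) := by
        intro t
        have h2 : ‖h t‖ ≤ ∑ a, ∑ b, |h t a b| := by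
          rw [linfty_opNorm_def]
          have h3 : ((Finset.univ.sup fun a => ∑ b, ‖h t a b‖₊ : NNReal) : ℝ) ≤
              ((∑ a, ∑ b, ‖h t a b‖₊ : NNReal) : ℝ) := by
            refine NNReal.coe_le_coe.2 (Finset.sup_le fun a ha => ?_)
            exact Finset.single_le_sum (f := fun a => ∑ b, ‖h t a b‖₊) (fun _ _ => zero_le) ha
          simpa using h3
        have h4 : (N : ℝ) * N * (ε / 2) + ∑ a, 1 / (2 * ε) * (h t a ⬝ᵥ h t a) =
            ∑ a, ∑ b, (ε / 2 + 1 / (2 * ε) * (h t a b * h t a b)) := by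
          simp [dotProduct, Finset.mul_sum, Finset.sum_add_distrib]
          ring
        rw [h4]
        refine h2.trans (Finset.sum_le_sum fun a _ => Finset.sum_le_sum fun b _ => ?_)
        rw [← abs_mul_abs_self (h t a b)]
        have h11 : ε / 2 + 1 / (2 * ε) * (|h t a b| * |h t a b|) - |h t a b| =
            (|h t a b| - ε) ^ 2 / (2 * ε) := by field_simp; ring
        have h12 : 0 ≤ (|h t a b| - ε) ^ 2 / (2 * ε) := by positivity
        linarith
      have h2 := intervalIntegral.integral_mono_on (μ := volume) hx.1
        (Continuous.intervalIntegrable (by fun_prop) _ _)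
        (Continuous.intervalIntegrable (by fun_prop) _ _) fun t _ => h1 t
      refine h2.trans ?_
      rw [intervalIntegral.integral_add (Continuous.intervalIntegrable (by fun_prop) _ _)
        (Continuous.intervalIntegrable (by fun_prop) _ _), intervalIntegral.integral_finsetSum
        (fun a _ => Continuous.intervalIntegrable (by fun_prop) _ _)]
      simp only [intervalIntegral.integral_const_mul, intervalIntegral.integral_const, sub_zero,
        smul_eq_mul]
      have h3 : ∑ a, 1 / (2 * ε) * ∫ t in (0 : ℝ)..x, h t a ⬝ᵥ h t a ≤ N * (B * ε / 2) := by
        refine (Finset.sum_le_card_nsmul _ _ (B * ε / 2) fun a _ => ?_).trans (by simp)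
        refine (mul_le_mul_of_nonneg_left (hrow a) (by positivity)).trans (le_of_eq ?_)
        field_simp
      have h5 : (N : ℝ) * (B * ε / 2) ≤ N * N * (B * ε / 2) := by
        rcases Nat.eq_zero_or_pos N with rfl | hN
        · simp
        · have : (1 : ℝ) ≤ N := by exact_mod_cast hN
          refine mul_le_mul_of_nonneg_right ?_ (by positivity)
          nlinarith
      have h6 : x * (N * N * (ε / 2)) ≤ L * (N * N * (ε / 2)) := by
        have := hx.2
        gcongr
      linarith
    have h1 : ‖σ • ∫ t in (0 : ℝ)..x, h t * F t y‖ ≤ M * (N * N * (L + B) / 2 * ε) := by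
      have h2 : ‖∫ t in (0 : ℝ)..x, h t * F t y‖ ≤ M * ∫ t in (0 : ℝ)..x, ‖h t‖ := by
        rw [← intervalIntegral.integral_const_mul]
        refine intervalIntegral.norm_integral_le_of_norm_le hx.1 (Eventually.of_forall
          fun t ht => ?_) (Continuous.intervalIntegrable (by fun_prop) _ _)
        refine (norm_mul_le _ _).trans ?_
        rw [mul_comm]
        gcongr
        exact hM t ⟨ht.1.le, ht.2.trans hx.2⟩ y hy
      rw [norm_smul, Real.norm_of_nonneg hσ.1]
      refine (mul_le_of_le_one_left (norm_nonneg _) hσ.2).trans (h2.trans ?_)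
      gcongr
    have h2 := hbd y hy
    have h3 : ‖h y‖ ≤ ‖h y + σ • ∫ t in (0 : ℝ)..x, h t * F t y‖ +
        ‖σ • ∫ t in (0 : ℝ)..x, h t * F t y‖ := by
      simpa using norm_sub_le (h y + σ • ∫ t in (0 : ℝ)..x, h t * F t y)
        (σ • ∫ t in (0 : ℝ)..x, h t * F t y)
    rw [hC]
    linarith
  refine ⟨C, hC0, fun σ hσ x hx h hh ε hbd y hy => ?_⟩
  have hε : 0 ≤ ε := (norm_nonneg _).trans (hbd y hy)
  refine le_of_forall_pos_le_add fun η hη => ?_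
  -- The excess $\eta/(C+1)$ is scaled so that multiplication by `C` costs at most $\eta$.
  have h1 := main σ hσ x hx h hh (ε + η / (C + 1)) (by positivity)
    (fun y hy => (hbd y hy).trans (by have : 0 < η / (C + 1) := by positivity
                                      linarith)) y hy
  have h2 : C * (η / (C + 1)) ≤ η := by
    rw [← mul_div_assoc, div_le_iff₀ (by positivity)]
    nlinarith
  linarith

end OrthogonalExpansion

end Coercivity

/-! ### The hyperbolic equation for $K$ and the intertwining property -/

section Transmutation

variable {R : Type*} [NormedRing R] [NormedAlgebra ℝ R]

/-- `F` is twice differentiable in each variable on `[0, L]²`, with the given continuous partial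
derivatives, and the chain rule holds along the diagonal. -/
structure HasSecondPartials (L : ℝ) (F F10 F01 F20 F02 : ℝ → ℝ → R) : Prop where
  continuous : Continuous (uncurry F)
  continuous10 : Continuous (uncurry F10)
  continuous01 : Continuous (uncurry F01)
  continuous20 : Continuous (uncurry F20)
  continuous02 : Continuous (uncurry F02)
  deriv10 : ∀ x ∈ Icc 0 L, ∀ y ∈ Icc 0 L,
    HasDerivWithinAt (fun x => F x y) (F10 x y) (Icc 0 L) x
  deriv01 : ∀ x ∈ Icc 0 L, ∀ y ∈ Icc 0 L, HasDerivWithinAt (F x) (F01 x y) (Icc 0 L) y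
  deriv20 : ∀ x ∈ Icc 0 L, ∀ y ∈ Icc 0 L,
    HasDerivWithinAt (fun x => F10 x y) (F20 x y) (Icc 0 L) x
  deriv02 : ∀ x ∈ Icc 0 L, ∀ y ∈ Icc 0 L, HasDerivWithinAt (F01 x) (F02 x y) (Icc 0 L) y
  deriv_diag : ∀ x ∈ Icc 0 L,
    HasDerivWithinAt (fun x => F x x) (F10 x x + F01 x x) (Icc 0 L) x

variable [CompleteSpace R]

theorem integral_const_mul_of_continuous (r : R) {f : ℝ → R} (hf : Continuous f) (a b : ℝ) :
    ∫ t in a..b, r * f t = r * ∫ t in a..b, f t :=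
  (ContinuousLinearMap.mul ℝ R r).intervalIntegral_comp_comm (hf.intervalIntegrable a b)

theorem integral_mul_const_of_continuous (r : R) {f : ℝ → R} (hf : Continuous f) (a b : ℝ) :
    ∫ t in a..b, f t * r = (∫ t in a..b, f t) * r :=
  ((ContinuousLinearMap.mul ℝ R).flip r).intervalIntegral_comp_comm (hf.intervalIntegrable a b)

/-- Green's formula. -/
theorem integral_mul_deriv_sub_deriv_mul {L : ℝ} {a a' a'' b b' b'' : ℝ → R}
    (ha : ∀ x ∈ Icc 0 L, HasDerivWithinAt a (a' x) (Icc 0 L) x)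
    (ha' : ∀ x ∈ Icc 0 L, HasDerivWithinAt a' (a'' x) (Icc 0 L) x)
    (hb : ∀ x ∈ Icc 0 L, HasDerivWithinAt b (b' x) (Icc 0 L) x)
    (hb' : ∀ x ∈ Icc 0 L, HasDerivWithinAt b' (b'' x) (Icc 0 L) x)
    (hac : Continuous a) (hac'' : Continuous a'') (hbc : Continuous b) (hbc'' : Continuous b'')
    {x : ℝ} (hx : x ∈ Icc 0 L) :
    ∫ t in (0 : ℝ)..x, (a t * b'' t - a'' t * b t) =
      (a x * b' x - a' x * b x) - (a 0 * b' 0 - a' 0 * b 0) := by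
  refine integral_eq_sub_of_hasDerivWithinAt_Icc (f := fun x => a x * b' x - a' x * b x)
    (fun t ht => ?_) (by fun_prop) hx
  refine (((ha t ht).mul (hb' t ht)).sub ((ha' t ht).mul (hb t ht))).congr_deriv ?_
  abel

/-- The variable $y$ enters the equation only through `F`, so `K01` and `K02` are explicit. The
$x$-derivatives come from the differentiated integral equation, used twice; the second use needs the
derivative of $K(x,x)$. -/
theorem UniformlyBoundedBelow.exists_hasSecondPartials {L C : ℝ}
    {F F10 F01 F20 F02 : ℝ → ℝ → R} (hB : UniformlyBoundedBelow L C F) (hL : 0 ≤ L) (hC : 0 ≤ C)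
    (hF : HasSecondPartials L F F10 F01 F20 F02) {K : ℝ → ℝ → R} (hK : Continuous (uncurry K))
    (hKF : ∀ x ∈ Icc 0 L, ∀ y ∈ Icc 0 L,
      K x y + F x y + ∫ t in (0 : ℝ)..x, K x t * F t y = 0) :
    ∃ K10 K01 K20 K02 : ℝ → ℝ → R, HasSecondPartials L K K10 K01 K20 K02 ∧
      (∀ x ∈ Icc 0 L, ∀ y ∈ Icc 0 L,
        K10 x y + (F10 x y + K x x * F x y) + ∫ t in (0 : ℝ)..x, K10 x t * F t y = 0) ∧
      (∀ x ∈ Icc 0 L, ∀ y ∈ Icc 0 L,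
        K20 x y + (F20 x y + ((K10 x x + K01 x x) * F x y + K x x * F10 x y) +
          K10 x x * F x y) + ∫ t in (0 : ℝ)..x, K20 x t * F t y = 0) ∧
      (∀ x ∈ Icc 0 L, ∀ y ∈ Icc 0 L,
        K01 x y + F01 x y + ∫ t in (0 : ℝ)..x, K x t * F01 t y = 0) ∧
      (∀ x ∈ Icc 0 L, ∀ y ∈ Icc 0 L,
        K02 x y + F02 x y + ∫ t in (0 : ℝ)..x, K x t * F02 t y = 0) := by
  have hF0 := hF.continuous
  have hF1 := hF.continuous10
  have hF2 := hF.continuous01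
  have hF3 := hF.continuous20
  have hF4 := hF.continuous02
  obtain ⟨K10, hK10, hK10d, hK10e⟩ := hB.exists_hasDerivWithinAt hL hC hF0 hK hF1 hF.deriv10 hKF
  let K01 : ℝ → ℝ → R := fun x y => -F01 x y - ∫ t in (0 : ℝ)..x, K x t * F01 t y
  let K02 : ℝ → ℝ → R := fun x y => -F02 x y - ∫ t in (0 : ℝ)..x, K x t * F02 t y
  have hK01 : Continuous (uncurry K01) := by fun_prop
  have hK02 : Continuous (uncurry K02) := by fun_prop
  have heq : ∀ x ∈ Icc 0 L, ∀ y ∈ Icc 0 L,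
      K x y = -F x y - ∫ t in (0 : ℝ)..x, K x t * F t y := by
    intro x hx y hy
    rw [← sub_eq_zero, ← hKF x hx y hy]
    abel
  have hK01d : ∀ x ∈ Icc 0 L, ∀ y ∈ Icc 0 L, HasDerivWithinAt (K x) (K01 x y) (Icc 0 L) y := by
    intro x hx y hy
    have h1 := (hF.deriv01 x hx y hy).neg.sub (hasDerivWithinAt_integral_param (L := L)
      (f := fun y t => K x t * F t y) (f1 := fun y t => K x t * F01 t y) (by fun_prop)
      (by fun_prop) (fun y hy t ht => (hF.deriv01 t ht y hy).const_mul _) hx hy)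
    exact h1.congr (fun z hz => heq x hx z hz) (heq x hx y hy)
  have hK02d : ∀ x ∈ Icc 0 L, ∀ y ∈ Icc 0 L,
      HasDerivWithinAt (K01 x) (K02 x y) (Icc 0 L) y := by
    intro x hx y hy
    exact (hF.deriv02 x hx y hy).neg.sub (hasDerivWithinAt_integral_param (L := L)
      (f := fun y t => K x t * F01 t y) (f1 := fun y t => K x t * F02 t y) (by fun_prop)
      (by fun_prop) (fun y hy t ht => (hF.deriv02 t ht y hy).const_mul _) hx hy)
  have hdiag : ∀ x ∈ Icc 0 L,
      HasDerivWithinAt (fun x => K x x) (K10 x x + K01 x x) (Icc 0 L) x := by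
    intro x hx
    have h1 := (hF.deriv_diag x hx).neg.sub (hasDerivWithinAt_integral_leibniz (L := L)
      (f := fun x t => K x t * F t x) (f1 := fun x t => K10 x t * F t x + K x t * F01 t x)
      (by fun_prop) (by fun_prop)
      (fun x hx t ht => (hK10d x hx t ht).mul (hF.deriv01 t ht x hx)) hx)
    refine (h1.congr (fun z hz => heq z hz z hz) (heq x hx x hx)).congr_deriv ?_
    have h2 := hK10e x hx x hx
    have h3 : ∫ t in (0 : ℝ)..x, (K10 x t * F t x + K x t * F01 t x) =
        (∫ t in (0 : ℝ)..x, K10 x t * F t x) + ∫ t in (0 : ℝ)..x, K x t * F01 t x := by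
      rw [← intervalIntegral.integral_add]
      all_goals exact Continuous.intervalIntegrable (by fun_prop) _ _
    rw [h3, ← sub_eq_zero, ← neg_eq_zero, ← h2]
    simp only [K01]
    abel
  obtain ⟨K20, hK20, hK20d, hK20e⟩ := hB.exists_hasDerivWithinAt hL hC hF0 hK10
    (H := fun x y => F10 x y + K x x * F x y)
    (H1 := fun x y => F20 x y + ((K10 x x + K01 x x) * F x y + K x x * F10 x y)) (by fun_prop)
    (fun x hx y hy => (hF.deriv20 x hx y hy).add ((hdiag x hx).mul (hF.deriv10 x hx y hy)))
    hK10e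
  refine ⟨K10, K01, K20, K02, ⟨hK, hK10, hK01, hK20, hK02, hK10d, hK01d, hK20d, hK02d, hdiag⟩,
    hK10e, hK20e, fun x _ y _ => ?_, fun x _ y _ => ?_⟩
  · simp only [K01]; abel
  · simp only [K02]; abel

/-- The resolvent kernel satisfies the transformed hyperbolic equation. -/
theorem UniformlyBoundedBelow.kernel_equation {L C : ℝ} {F F10 F01 F20 F02 : ℝ → ℝ → R}
    (hB : UniformlyBoundedBelow L C F) (hF : HasSecondPartials L F F10 F01 F20 F02)
    {K K10 K01 K20 K02 : ℝ → ℝ → R} (hK : HasSecondPartials L K K10 K01 K20 K02)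
    (hKF : ∀ x ∈ Icc 0 L, ∀ y ∈ Icc 0 L,
      K x y + F x y + ∫ t in (0 : ℝ)..x, K x t * F t y = 0)
    (hK20 : ∀ x ∈ Icc 0 L, ∀ y ∈ Icc 0 L,
        K20 x y + (F20 x y + ((K10 x x + K01 x x) * F x y + K x x * F10 x y) +
          K10 x x * F x y) + ∫ t in (0 : ℝ)..x, K20 x t * F t y = 0)
    (hK02 : ∀ x ∈ Icc 0 L, ∀ y ∈ Icc 0 L,
        K02 x y + F02 x y + ∫ t in (0 : ℝ)..x, K x t * F02 t y = 0)
    {P Q : ℝ → R} (hP : Continuous P)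
    (hQ : ∀ x ∈ Icc 0 L, Q x = P x + (2 : ℝ) • (K10 x x + K01 x x))
    (hFP : ∀ x ∈ Icc 0 L, ∀ y ∈ Icc 0 L,
      F20 x y - P x * F x y = F02 x y - F x y * P y)
    (hb : ∀ x ∈ Icc 0 L, ∀ y ∈ Icc 0 L, K x 0 * F10 0 y - K01 x 0 * F 0 y = 0) :
    ∀ x ∈ Icc 0 L, ∀ y ∈ Icc 0 L, K20 x y - Q x * K x y = K02 x y - K x y * P y := by
  have hF0 := hF.continuous
  have hF3 := hF.continuous20
  have hF4 := hF.continuous02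
  have hK0 := hK.continuous
  have hK3 := hK.continuous20
  have hK4 := hK.continuous02
  intro x hx
  suffices h : ∀ y ∈ Icc 0 L, (K20 x y - Q x * K x y) - (K02 x y - K x y * P y) = 0 from
    fun y hy => sub_eq_zero.1 (h y hy)
  refine hB.eq_zero hx (by fun_prop) fun y hy => ?_
  -- The equation of `F` exchanges $P(t)F$ for $F_{tt}$ and terms in $y$, so that Green's formula
  -- can move two $t$-derivatives from `K` to `F`. Its boundary term at $t = x$ contributes to the
  -- factor $2\,\frac{d}{dx}K(x,x)$ in `Q`.
  have hint : ∫ t in (0 : ℝ)..x, ((K20 x t - Q x * K x t) - (K02 x t - K x t * P t)) * F t y =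
      (∫ t in (0 : ℝ)..x, K20 x t * F t y) - Q x * (∫ t in (0 : ℝ)..x, K x t * F t y) +
      (∫ t in (0 : ℝ)..x, (K x t * F20 t y - K02 x t * F t y)) -
      (∫ t in (0 : ℝ)..x, K x t * F02 t y) + (∫ t in (0 : ℝ)..x, K x t * F t y) * P y := by
    rw [← integral_const_mul_of_continuous _ (by fun_prop),
      ← integral_mul_const_of_continuous _ (by fun_prop),
      ← intervalIntegral.integral_sub, ← intervalIntegral.integral_add,
      ← intervalIntegral.integral_sub, ← intervalIntegral.integral_add]
    · refine intervalIntegral.integral_congr fun t ht => ?_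
      rw [uIcc_of_le hx.1] at ht
      have h1 := hFP t ⟨ht.1, ht.2.trans hx.2⟩ y hy
      rw [sub_eq_iff_eq_add] at h1
      simp only [h1]
      noncomm_ring
    all_goals exact Continuous.intervalIntegrable (by fun_prop) _ _
  have hgreen := integral_mul_deriv_sub_deriv_mul (L := L) (a := K x) (a' := K01 x)
    (a'' := K02 x) (b := fun t => F t y) (b' := fun t => F10 t y) (b'' := fun t => F20 t y)
    (hK.deriv01 x hx) (hK.deriv02 x hx) (fun t ht => hF.deriv10 t ht y hy)
    (fun t ht => hF.deriv20 t ht y hy) (by fun_prop) (by fun_prop) (by fun_prop) (by fun_prop) hx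
  have e1 := eq_neg_of_add_eq_zero_right (hKF x hx y hy)
  have e2 := eq_neg_of_add_eq_zero_right (hK20 x hx y hy)
  have e3 := eq_neg_of_add_eq_zero_right (hK02 x hx y hy)
  have e4 := hFP x hx y hy
  rw [sub_eq_iff_eq_add] at e4
  rw [hint, hgreen, hb x hx y hy, e1, e2, e3, hQ x hx, e4, two_smul]
  noncomm_ring

/-- The transmutation operator `1 + K` intertwines the two differential equations. -/
theorem HasSecondPartials.transmutation {L : ℝ} {K K10 K01 K20 K02 : ℝ → ℝ → R}
    (hK : HasSecondPartials L K K10 K01 K20 K02) {P Q : ℝ → R} (hP : Continuous P)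
    (hQ : ∀ x ∈ Icc 0 L, Q x = P x + (2 : ℝ) • (K10 x x + K01 x x))
    (hKP : ∀ x ∈ Icc 0 L, ∀ y ∈ Icc 0 L, K20 x y - Q x * K x y = K02 x y - K x y * P y)
    {l : ℝ} {U V : ℝ → R} (hUc : Continuous U)
    (hU : ∀ x ∈ Icc 0 L, HasDerivWithinAt U (V x) (Icc 0 L) x)
    (hV : ∀ x ∈ Icc 0 L, HasDerivWithinAt V (P x * U x - l • U x) (Icc 0 L) x)
    (hb : ∀ x ∈ Icc 0 L, K x 0 * V 0 - K01 x 0 * U 0 = 0) :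
    ∀ x ∈ Icc 0 L,
      HasDerivWithinAt (fun x => U x + ∫ t in (0 : ℝ)..x, K x t * U t)
        (V x + (K x x * U x + ∫ t in (0 : ℝ)..x, K10 x t * U t)) (Icc 0 L) x ∧
      HasDerivWithinAt (fun x => V x + (K x x * U x + ∫ t in (0 : ℝ)..x, K10 x t * U t))
        (Q x * (U x + ∫ t in (0 : ℝ)..x, K x t * U t) -
          l • (U x + ∫ t in (0 : ℝ)..x, K x t * U t)) (Icc 0 L) x := by
  have hK0 := hK.continuous
  have hK1 := hK.continuous10
  have hK3 := hK.continuous20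
  have hK4 := hK.continuous02
  intro x hx
  constructor
  · exact (hU x hx).add (hasDerivWithinAt_integral_leibniz (L := L)
      (f := fun x t => K x t * U t) (f1 := fun x t => K10 x t * U t) (by fun_prop) (by fun_prop)
      (fun x hx t ht => (hK.deriv10 x hx t ht).mul_const _) hx)
  · have h1 := (hV x hx).add (((hK.deriv_diag x hx).mul (hU x hx)).add
      (hasDerivWithinAt_integral_leibniz (L := L)
      (f := fun x t => K10 x t * U t) (f1 := fun x t => K20 x t * U t) (by fun_prop) (by fun_prop)
      (fun x hx t ht => (hK.deriv20 x hx t ht).mul_const _) hx))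
    refine h1.congr_deriv ?_
    have hgreen := integral_mul_deriv_sub_deriv_mul (L := L) (a := K x) (a' := K01 x)
      (a'' := K02 x) (b := U) (b' := V) (b'' := fun t => P t * U t - l • U t)
      (hK.deriv01 x hx) (hK.deriv02 x hx) hU hV (by fun_prop) (by fun_prop) (by fun_prop)
      (by fun_prop) hx
    -- The equation of `K` turns this into $Q$ and $\lambda$ times the transform plus a Green
    -- integral; the boundary terms at $t = x$ supply the rest of `Q`.
    have hint : ∫ t in (0 : ℝ)..x, K20 x t * U t =
        Q x * (∫ t in (0 : ℝ)..x, K x t * U t) - l • (∫ t in (0 : ℝ)..x, K x t * U t) -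
        ∫ t in (0 : ℝ)..x, (K x t * (P t * U t - l • U t) - K02 x t * U t) := by
      rw [← integral_const_mul_of_continuous _ (by fun_prop), ← intervalIntegral.integral_smul,
        ← intervalIntegral.integral_sub, ← intervalIntegral.integral_sub]
      · refine intervalIntegral.integral_congr fun t ht => ?_
        rw [uIcc_of_le hx.1] at ht
        have h2 := hKP x hx t ⟨ht.1, ht.2.trans hx.2⟩
        rw [sub_eq_iff_eq_add] at h2
        simp only [h2, mul_sub, mul_smul_comm]
        noncomm_ring
      all_goals exact Continuous.intervalIntegrable (by fun_prop) _ _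
    rw [hint, hgreen, hb x hx, hQ x hx, two_smul, smul_add]
    noncomm_ring

end Transmutation

/-! ### Linear algebra of selfadjoint boundary conditions -/

section Boundary

variable {N : ℕ} {A B : Matrix (Fin N) (Fin N) ℝ}

/-- The null space of a selfadjoint boundary condition is parametrized by `z ↦ (B* z, -A* z)`. -/
theorem exists_eq_transpose_mulVec (hsymm : B * Aᵀ = A * Bᵀ)
    (hrank : (fromCols A B).rank = N) {u v : Fin N → ℝ} (h : B *ᵥ v + A *ᵥ u = 0) :
    ∃ z, u = Bᵀ *ᵥ z ∧ v = -(Aᵀ *ᵥ z) := by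
  let T : (Fin N → ℝ) →ₗ[ℝ] (Fin N ⊕ Fin N → ℝ) := (fromRows Bᵀ (-Aᵀ)).mulVecLin
  have hT : ∀ z, T z = Sum.elim (Bᵀ *ᵥ z) (-(Aᵀ *ᵥ z)) := by
    intro z
    simp [T, fromRows_mulVec, neg_mulVec]
  have hinj : LinearMap.ker T = ⊥ := by
    have h1 := LinearMap.finrank_range_add_finrank_ker (fromCols A B)ᵀ.mulVecLin
    have h2 : Module.finrank ℝ (LinearMap.range (fromCols A B)ᵀ.mulVecLin) = N :=
      (rank_transpose (fromCols A B)).trans hrank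
    rw [h2, Module.finrank_fin_fun] at h1
    have h3 : LinearMap.ker (fromCols A B)ᵀ.mulVecLin = ⊥ :=
      Submodule.finrank_eq_zero.1 (by omega)
    rw [eq_bot_iff] at h3 ⊢
    intro z hz
    refine h3 ?_
    rw [LinearMap.mem_ker, hT] at hz
    have hz1 : Bᵀ *ᵥ z = 0 := by
      ext i; simpa using congrFun hz (Sum.inl i)
    have hz2 : Aᵀ *ᵥ z = 0 := by
      ext i; simpa using congrFun hz (Sum.inr i)
    rw [LinearMap.mem_ker, mulVecLin_apply, transpose_fromCols, fromRows_mulVec, hz1, hz2]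
    ext i
    cases i <;> rfl
  have hle : LinearMap.range T ≤ LinearMap.ker (fromCols A B).mulVecLin := by
    rintro _ ⟨z, rfl⟩
    rw [LinearMap.mem_ker, mulVecLin_apply, hT, fromCols_mulVec_sumElim, mulVec_neg, mulVec_mulVec,
      mulVec_mulVec, hsymm, add_neg_cancel]
  have hker : Module.finrank ℝ (LinearMap.ker (fromCols A B).mulVecLin) = N := by
    have h1 := LinearMap.finrank_range_add_finrank_ker (fromCols A B).mulVecLin
    have h2 : Module.finrank ℝ (LinearMap.range (fromCols A B).mulVecLin) = N := hrank
    rw [h2, Module.finrank_fintype_fun_eq_card] at h1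
    simp only [Fintype.card_sum, Fintype.card_fin] at h1
    omega
  have hran : Module.finrank ℝ (LinearMap.range T) = N := by
    rw [LinearMap.finrank_range_of_inj (LinearMap.ker_eq_bot.1 hinj), Module.finrank_fin_fun]
  -- Symmetry puts the range in the null space; the rank condition gives both dimension $N$.
  have heq := Submodule.eq_of_le_of_finrank_eq hle (hran.trans hker.symm)
  have hmem : Sum.elim u v ∈ LinearMap.range T := by
    rw [heq, LinearMap.mem_ker, mulVecLin_apply, fromCols_mulVec_sumElim, add_comm, h]
  obtain ⟨z, hz⟩ := hmem
  rw [hT] at hz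
  refine ⟨z, ?_, ?_⟩
  · ext i; simpa using (congrFun hz (Sum.inl i)).symm
  · ext i; simpa using (congrFun hz (Sum.inr i)).symm

/-- A selfadjoint condition cuts out a Lagrangian subspace, so the Wronskian form vanishes on it.
Parametrizing one pair by `z` leaves the condition on the other. -/
theorem dotProduct_eq_of_boundary (hsymm : B * Aᵀ = A * Bᵀ)
    (hrank : (fromCols A B).rank = N) {u v u' v' : Fin N → ℝ} (h : B *ᵥ v + A *ᵥ u = 0)
    (h' : B *ᵥ v' + A *ᵥ u' = 0) : u ⬝ᵥ v' = v ⬝ᵥ u' := by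
  obtain ⟨z, rfl, rfl⟩ := exists_eq_transpose_mulVec hsymm hrank h
  rw [mulVec_transpose, ← dotProduct_mulVec, eq_neg_of_add_eq_zero_left h', mulVec_transpose,
    neg_dotProduct, ← dotProduct_mulVec, dotProduct_neg]

/-- This is what kills the boundary terms in Green's formula: a kernel satisfies the condition from
the right, a solution from the left. The columns of the solution are parametrized one at a time. -/
theorem mul_sub_mul_eq_zero_of_boundary (hsymm : B * Aᵀ = A * Bᵀ)
    (hrank : (fromCols A B).rank = N) {X X' Y Y' : Matrix (Fin N) (Fin N) ℝ}
    (hX : X' * Bᵀ + X * Aᵀ = 0) (hY : B * Y' + A * Y = 0) : X * Y' - X' * Y = 0 := by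
  have h1 : ∀ j, ∃ z, Y.col j = Bᵀ *ᵥ z ∧ Y'.col j = -(Aᵀ *ᵥ z) := fun j => by
    refine exists_eq_transpose_mulVec hsymm hrank ?_
    ext i
    exact congrFun (congrFun hY i) j
  choose Z hZ hZ' using h1
  let W : Matrix (Fin N) (Fin N) ℝ := Matrix.of fun i j => Z j i
  have hY1 : Y = Bᵀ * W := by
    ext i j
    exact congrFun (hZ j) i
  have hY2 : Y' = -(Aᵀ * W) := by
    ext i j
    exact congrFun (hZ' j) i
  rw [hY1, hY2, mul_neg, ← mul_assoc, ← mul_assoc, ← neg_add', ← add_mul, add_comm, hX, zero_mul,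
    neg_zero]

/-- The change is right multiplication by a unipotent block matrix. -/
theorem rank_fromCols_sub_mul (K : Matrix (Fin N) (Fin N) ℝ) :
    (fromCols (A - B * K) B).rank = (fromCols A B).rank := by
  have h : fromCols (A - B * K) B = fromCols A B *
      (fromBlocks 1 0 (-K) 1 : Matrix (Fin N ⊕ Fin N) (Fin N ⊕ Fin N) ℝ) := by
    rw [fromCols_mul_fromBlocks]
    simp [sub_eq_add_neg]
  rw [h]
  exact rank_mul_eq_left_of_isUnit_det _ _ (by simp)

end Boundary

/-! ### Extension from $[0,\pi]$ to the line -/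

section Clamp

/-- The retraction of `ℝ` onto `[0, π]`. -/
noncomputable def clampPi (x : ℝ) : ℝ := max 0 (min x Real.pi)

@[fun_prop]
theorem continuous_clampPi : Continuous clampPi := by
  unfold clampPi
  fun_prop

theorem clampPi_mem (x : ℝ) : clampPi x ∈ Icc 0 Real.pi :=
  ⟨le_max_left _ _, max_le Real.pi_pos.le (min_le_right _ _)⟩

theorem clampPi_of_mem {x : ℝ} (hx : x ∈ Icc 0 Real.pi) : clampPi x = x := by
  rw [clampPi, min_eq_left hx.2, max_eq_right hx.1]

theorem ContinuousOn.comp_clampPi {X : Type*} [TopologicalSpace X] {f : ℝ → X}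
    (hf : ContinuousOn f (Icc 0 Real.pi)) : Continuous fun x => f (clampPi x) :=
  hf.comp_continuous continuous_clampPi clampPi_mem

theorem HasDerivWithinAt.comp_clampPi {E : Type*} [NormedAddCommGroup E] [NormedSpace ℝ E]
    {f : ℝ → E} {f' : E} {x : ℝ} (hf : HasDerivWithinAt f f' (Icc 0 Real.pi) x)
    (hx : x ∈ Icc 0 Real.pi) :
    HasDerivWithinAt (fun x => f (clampPi x)) f' (Icc 0 Real.pi) x :=
  hf.congr (fun y hy => by rw [clampPi_of_mem hy]) (by rw [clampPi_of_mem hx])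

theorem integral_comp_clampPi {E : Type*} [NormedAddCommGroup E] [NormedSpace ℝ E]
    (f : ℝ → ℝ → E) {x : ℝ} (hx : x ∈ Icc 0 Real.pi) :
    ∫ t in (0 : ℝ)..x, f t (clampPi t) = ∫ t in (0 : ℝ)..x, f t t := by
  refine intervalIntegral.integral_congr fun t ht => ?_
  rw [uIcc_of_le hx.1] at ht
  simp only [clampPi_of_mem ⟨ht.1, ht.2.trans hx.2⟩]

theorem derivWithin_unique_Icc {E : Type*} [NormedAddCommGroup E] [NormedSpace ℝ E]
    {f g : ℝ → E} {f' g' : E} {x : ℝ} (hx : x ∈ Icc 0 Real.pi)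
    (hf : HasDerivWithinAt f f' (Icc 0 Real.pi) x) (hg : HasDerivWithinAt g g' (Icc 0 Real.pi) x)
    (hfg : ∀ y ∈ Icc 0 Real.pi, f y = g y) : f' = g' :=
  (uniqueDiffOn_Icc Real.pi_pos x hx).eq_deriv _ hf (hg.congr hfg (hfg x hx))

theorem HasDerivWithinAt.dotProduct {n : Type*} [Fintype n] {f g : ℝ → n → ℝ} {f' g' : n → ℝ}
    {s : Set ℝ} {x : ℝ} (hf : HasDerivWithinAt f f' s x) (hg : HasDerivWithinAt g g' s x) :
    HasDerivWithinAt (fun x => f x ⬝ᵥ g x) (f' ⬝ᵥ g x + f x ⬝ᵥ g') s x := by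
  have := HasDerivWithinAt.fun_sum (u := Finset.univ) fun i _ =>
    (hasDerivWithinAt_pi.1 hf i).mul (hasDerivWithinAt_pi.1 hg i)
  exact this.congr_deriv (by simp [_root_.dotProduct, Finset.sum_add_distrib])

end Clamp

/-! ### Orthogonality, completeness and matrix solutions -/

namespace SLProblem

attribute [local instance] Matrix.linftyOpNormedAddCommGroup Matrix.linftyOpNormedSpace
  Matrix.linftyOpNormedRing Matrix.linftyOpNormedAlgebra

variable {N : ℕ} {p : SLProblem N}

theorem integral_entry {f : ℝ → Matrix (Fin N) (Fin N) ℝ} (hf : Continuous f) (x y : ℝ)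
    (a b : Fin N) : (∫ t in x..y, f t) a b = ∫ t in x..y, f t a b :=
  ((LinearMap.toContinuousLinearMap (entryLinearMap ℝ ℝ a b
    : Matrix (Fin N) (Fin N) ℝ →ₗ[ℝ] ℝ)).intervalIntegral_comp_comm
    (hf.intervalIntegrable x y)).symm

theorem IsSolution.continuousOn {l : ℝ} {u : ℝ → Fin N → ℝ} (h : p.IsSolution l u) :
    ContinuousOn u (Icc 0 Real.pi) := by
  obtain ⟨v, hu, -⟩ := h
  exact fun x hx => (hu x hx).continuousWithinAt

theorem continuousOn_of_mem_eigenspace {l : ℝ} {u : ℝ → Fin N → ℝ} (h : u ∈ p.eigenspace l) :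
    ContinuousOn u (Icc 0 Real.pi) :=
  h.2.continuousOn

/-- Eigenfunctions for different eigenvalues are orthogonal. -/
theorem IsSelfAdjoint.integral_dotProduct_eq_zero (hp : p.IsSelfAdjoint) {l l' : ℝ} (hne : l ≠ l')
    {u w : ℝ → Fin N → ℝ} (hu : u ∈ p.eigenspace l) (hw : w ∈ p.eigenspace l') :
    ∫ x in (0 : ℝ)..Real.pi, u x ⬝ᵥ w x = 0 := by
  have huc := (continuousOn_of_mem_eigenspace hu).comp_clampPi
  have hwc := (continuousOn_of_mem_eigenspace hw).comp_clampPi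
  obtain ⟨-, v, hu1, hv1, hu0, hupi⟩ := hu
  obtain ⟨-, z, hw1, hz1, hw0, hwpi⟩ := hw
  -- The Wronskian $u\cdot w' - u'\cdot w$ has derivative $(l-l')\,u\cdot w$ by symmetry of `P`, and
  -- vanishes at both end points.
  have h := integral_eq_sub_of_hasDerivWithinAt_Icc (L := Real.pi)
    (f := fun x => u x ⬝ᵥ z x - v x ⬝ᵥ w x)
    (f' := fun x => (l - l') * (u (clampPi x) ⬝ᵥ w (clampPi x))) (fun x hx => ?_)
    (continuous_const.mul (huc.dotProduct hwc))
    (right_mem_Icc.2 Real.pi_pos.le)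
  · rw [intervalIntegral.integral_const_mul, integral_comp_clampPi (fun _ x => u x ⬝ᵥ w x)
      (right_mem_Icc.2 Real.pi_pos.le), dotProduct_eq_of_boundary hp.symm_zero hp.rank_zero hu0 hw0,
      dotProduct_eq_of_boundary hp.symm_pi hp.rank_pi hupi hwpi, sub_self, sub_self,
      sub_self] at h
    exact (mul_eq_zero.1 h).resolve_left (sub_ne_zero.2 hne)
  · refine (((hu1 x hx).dotProduct (hz1 x hx)).sub
      ((hv1 x hx).dotProduct (hw1 x hx))).congr_deriv ?_
    have h1 : (p.P x *ᵥ u x) ⬝ᵥ w x = u x ⬝ᵥ (p.P x *ᵥ w x) := by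
      rw [dotProduct_mulVec, ← mulVec_transpose, hp.symm_P x hx]
    rw [clampPi_of_mem hx, dotProduct_sub, sub_dotProduct, h1, dotProduct_smul, smul_dotProduct]
    simp only [smul_eq_mul]
    ring

theorem CompleteEigenfunctions.eq_zero (hc : p.CompleteEigenfunctions) {f : ℝ → Fin N → ℝ}
    (hf : Continuous f)
    (h : ∀ l, ∀ u ∈ p.eigenspace l, ∫ x in (0 : ℝ)..Real.pi, f x ⬝ᵥ u x = 0) :
    ∀ x ∈ Icc 0 Real.pi, f x = 0 := by
  obtain ⟨M, hM⟩ := (isCompact_Icc (a := (0 : ℝ)) (b := Real.pi)).exists_bound_of_continuousOn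
    hf.continuousOn
  have h1 := hc f (MemLp.of_bound hf.aestronglyMeasurable M
    ((ae_restrict_iff' measurableSet_Icc).2 (Eventually.of_forall hM))) h
  exact Measure.eqOn_Icc_of_ae_eq volume Real.pi_pos.ne h1 hf.continuousOn continuousOn_const

/-- Row by row; since all columns of the test matrix are equal, a diagonal entry of the product
already gives the scalar integral of a row. -/
theorem CompleteEigenfunctions.matrix_eq_zero (hc : p.CompleteEigenfunctions)
    {G : ℝ → Matrix (Fin N) (Fin N) ℝ} (hG : Continuous G)
    (h : ∀ l, ∀ u ∈ p.eigenspace l,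
      ∫ x in (0 : ℝ)..Real.pi, G x * replicateCol (Fin N) (u (clampPi x)) = 0) :
    ∀ x ∈ Icc 0 Real.pi, G x = 0 := by
  intro x hx
  ext a b
  have h1 := hc.eq_zero (f := fun x => G x a) (by fun_prop) (fun l u hu => ?_) x hx
  · exact congrFun h1 b
  · have huc := (continuousOn_of_mem_eigenspace hu).comp_clampPi
    have h2 := integral_entry (f := fun x => G x * replicateCol (Fin N) (u (clampPi x)))
      (hG.mul (huc.matrix_replicateCol (ι := Fin N))) 0 Real.pi a a
    rw [h l u hu] at h2
    rw [← integral_comp_clampPi (fun t s => G t a ⬝ᵥ u s) (right_mem_Icc.2 Real.pi_pos.le)]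
    exact h2.symm

/-- `U` is a matrix solution of the boundary value problem, with continuous extensions of the
coefficient and of the solution to the real line. -/
structure IsMatrixSolution (p : SLProblem N) (l : ℝ) (U V : ℝ → Matrix (Fin N) (Fin N) ℝ) :
    Prop where
  continuous : Continuous U
  continuous_deriv : Continuous V
  deriv : ∀ x ∈ Icc (0 : ℝ) Real.pi, HasDerivWithinAt U (V x) (Icc 0 Real.pi) x
  deriv2 : ∀ x ∈ Icc (0 : ℝ) Real.pi,
    HasDerivWithinAt V (p.P (clampPi x) * U x - l • U x) (Icc 0 Real.pi) x
  boundary_zero : p.B * V 0 + p.A * U 0 = 0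
  boundary_pi : p.Bpi * V Real.pi + p.Api * U Real.pi = 0

/-- Repeating a vector as equal columns puts kernels and solutions in one normed algebra, where the
preceding calculus applies. -/
theorem IsSolution.exists_isMatrixSolution {l : ℝ} {u : ℝ → Fin N → ℝ} (h : p.IsSolution l u) :
    ∃ v : ℝ → Fin N → ℝ, p.IsMatrixSolution l (fun x => replicateCol (Fin N) (u (clampPi x)))
      fun x => replicateCol (Fin N) (v (clampPi x)) := by
  have huc := h.continuousOn.comp_clampPi
  obtain ⟨v, hu, hv, h0, hpi⟩ := h
  have hvc : ContinuousOn v (Icc 0 Real.pi) := fun x hx => (hv x hx).continuousWithinAt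
  have hvc' := hvc.comp_clampPi
  have m0 : (0 : ℝ) ∈ Icc 0 Real.pi := left_mem_Icc.2 Real.pi_pos.le
  have mpi : Real.pi ∈ Icc 0 Real.pi := right_mem_Icc.2 Real.pi_pos.le
  refine ⟨v, huc.matrix_replicateCol,
    hvc'.matrix_replicateCol,
    fun x hx => ?_, fun x hx => ?_, ?_, ?_⟩
  · rw [clampPi_of_mem hx]
    exact hasDerivWithinAt_pi.2 fun a => hasDerivWithinAt_pi.2 fun b =>
      hasDerivWithinAt_pi.1 ((hu x hx).comp_clampPi hx) a
  · rw [clampPi_of_mem hx]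
    have := (hv x hx).comp_clampPi hx
    rw [← replicateCol_mulVec, ← replicateCol_smul]
    exact hasDerivWithinAt_pi.2 fun a => hasDerivWithinAt_pi.2 fun b =>
      hasDerivWithinAt_pi.1 ((hv x hx).comp_clampPi hx) a
  · simp only [clampPi_of_mem m0, ← replicateCol_mulVec, ← replicateCol_add, h0]
    rfl
  · simp only [clampPi_of_mem mpi, ← replicateCol_mulVec, ← replicateCol_add, hpi]
    rfl

end SLProblem

/-! ### Differential equation and boundary conditions of $\mathcal F$ and $K$ -/

namespace SLProblem

attribute [local instance] Matrix.linftyOpNormedAddCommGroup Matrix.linftyOpNormedSpace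
  Matrix.linftyOpNormedRing Matrix.linftyOpNormedAlgebra

variable {N : ℕ} {p : SLProblem N}

theorem zero_mem_Icc_pi : (0 : ℝ) ∈ Icc 0 Real.pi := left_mem_Icc.2 Real.pi_pos.le

theorem pi_mem_Icc_pi : Real.pi ∈ Icc 0 Real.pi := right_mem_Icc.2 Real.pi_pos.le

/-- The matrix function on the line whose columns are all equal to `u` on `[0, π]`. -/
noncomputable def colExt (u : ℝ → Fin N → ℝ) (x : ℝ) : Matrix (Fin N) (Fin N) ℝ :=
  replicateCol (Fin N) (u (clampPi x))

theorem continuous_colExt {l : ℝ} {u : ℝ → Fin N → ℝ} (hu : u ∈ p.eigenspace l) :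
    Continuous (colExt u) :=
  (continuousOn_of_mem_eigenspace hu).comp_clampPi.matrix_replicateCol

theorem exists_isMatrixSolution_colExt {l : ℝ} {u : ℝ → Fin N → ℝ} (hu : u ∈ p.eigenspace l) :
    ∃ v : ℝ → Fin N → ℝ, p.IsMatrixSolution l (colExt u) (colExt v) :=
  hu.2.exists_isMatrixSolution

/-- A kernel that commutes with the boundary value problem `p` and has no eigenvalue `≤ -1`. -/
structure AdmissibleKernel (p : SLProblem N) (F F10 F01 F20 F02 : ℝ → ℝ → Matrix (Fin N) (Fin N) ℝ)
    (C : ℝ) : Prop where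
  partials : HasSecondPartials Real.pi F F10 F01 F20 F02
  symm : ∀ x ∈ Icc 0 Real.pi, ∀ y ∈ Icc 0 Real.pi, (F x y)ᵀ = F y x
  nonneg : 0 ≤ C
  bound : UniformlyBoundedBelow Real.pi C F
  map_mem : ∀ l, ∀ u ∈ p.eigenspace l, ∃ g ∈ p.eigenspace l, ∀ x ∈ Icc 0 Real.pi,
    colExt g x = ∫ y in (0 : ℝ)..Real.pi, F x y * colExt u y
  exists_preimage : ∀ l, ∀ u ∈ p.eigenspace l, ∃ w ∈ p.eigenspace l, ∀ x ∈ Icc 0 Real.pi,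
    colExt u x = colExt w x + ∫ y in (0 : ℝ)..Real.pi, F x y * colExt w y

namespace AdmissibleKernel

variable {F F10 F01 F20 F02 : ℝ → ℝ → Matrix (Fin N) (Fin N) ℝ} {C : ℝ}

theorem transpose_deriv (H : p.AdmissibleKernel F F10 F01 F20 F02 C) :
    ∀ x ∈ Icc 0 Real.pi, ∀ y ∈ Icc 0 Real.pi, (F10 x y)ᵀ = F01 y x := by
  intro x hx y hy
  have h1 : HasDerivWithinAt (fun x => (F x y)ᵀ) (F10 x y)ᵀ (Icc 0 Real.pi) x :=
    hasDerivWithinAt_pi.2 fun a => hasDerivWithinAt_pi.2 fun b =>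
      hasDerivWithinAt_pi.1 (hasDerivWithinAt_pi.1 (H.partials.deriv10 x hx y hy) b) a
  exact derivWithin_unique_Icc hx h1 (H.partials.deriv01 y hy x hx)
    fun z hz => H.symm z hz y hy

/-- The image of an eigenfunction under `F` is again a solution for `l`. Its derivatives may be
computed under the integral sign, which identifies the images under `F10` and `F20` without
differentiating the series. -/
theorem exists_image (H : p.AdmissibleKernel F F10 F01 F20 F02 C) {l : ℝ} {u : ℝ → Fin N → ℝ}
    (hu : u ∈ p.eigenspace l) :
    ∃ G G', p.IsMatrixSolution l G G' ∧ ∀ x ∈ Icc 0 Real.pi,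
      ∫ y in (0 : ℝ)..Real.pi, F x y * colExt u y = G x ∧
      ∫ y in (0 : ℝ)..Real.pi, F10 x y * colExt u y = G' x ∧
      ∫ y in (0 : ℝ)..Real.pi, F20 x y * colExt u y = p.P (clampPi x) * G x - l • G x := by
  have hc := continuous_colExt hu
  have hF0 := H.partials.continuous
  have hF1 := H.partials.continuous10
  have hF2 := H.partials.continuous20
  obtain ⟨g, hg, hgF⟩ := H.map_mem l u hu
  obtain ⟨v, hv⟩ := exists_isMatrixSolution_colExt hg
  have h1 : ∀ x ∈ Icc 0 Real.pi, ∫ y in (0 : ℝ)..Real.pi, F10 x y * colExt u y = colExt v x :=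
    fun x hx => derivWithin_unique_Icc hx (hasDerivWithinAt_integral_param
      (f := fun x y => F x y * colExt u y) (f1 := fun x y => F10 x y * colExt u y)
      (by fun_prop) (by fun_prop)
      (fun x hx t ht => (H.partials.deriv10 x hx t ht).mul_const _) pi_mem_Icc_pi hx)
      (hv.deriv x hx) (fun z hz => (hgF z hz).symm)
  refine ⟨colExt g, colExt v, hv, fun x hx => ⟨(hgF x hx).symm, h1 x hx, ?_⟩⟩
  exact derivWithin_unique_Icc hx (hasDerivWithinAt_integral_param
      (f := fun x y => F10 x y * colExt u y) (f1 := fun x y => F20 x y * colExt u y)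
      (by fun_prop) (by fun_prop)
      (fun x hx t ht => (H.partials.deriv20 x hx t ht).mul_const _) pi_mem_Icc_pi hx)
      (hv.deriv2 x hx) h1

/-- Tested against an eigenfunction, the left sides become boundary expressions of its image under
`F`, which vanish; completeness concludes. -/
theorem boundary (H : p.AdmissibleKernel F F10 F01 F20 F02 C) (hc : p.CompleteEigenfunctions) :
    ∀ y ∈ Icc 0 Real.pi, p.B * F10 0 y + p.A * F 0 y = 0 ∧
      p.Bpi * F10 Real.pi y + p.Api * F Real.pi y = 0 := by
  have hF0 := H.partials.continuous
  have hF1 := H.partials.continuous10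
  have key : ∀ (A B : Matrix (Fin N) (Fin N) ℝ) (x : ℝ), (∀ l, ∀ u ∈ p.eigenspace l,
      B * (∫ y in (0 : ℝ)..Real.pi, F10 x y * colExt u y) +
      A * (∫ y in (0 : ℝ)..Real.pi, F x y * colExt u y) = 0) →
      ∀ y ∈ Icc 0 Real.pi, B * F10 x y + A * F x y = 0 := by
    intro A B x h
    refine hc.matrix_eq_zero (by fun_prop) fun l u hu => ?_
    have huc := continuous_colExt hu
    rw [← h l u hu, ← integral_const_mul_of_continuous _ (by fun_prop),
      ← integral_const_mul_of_continuous _ (by fun_prop), ← intervalIntegral.integral_add]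
    · simp only [colExt, add_mul, mul_assoc]
    all_goals exact Continuous.intervalIntegrable (by fun_prop) _ _
  refine fun y hy => ⟨key _ _ _ (fun l u hu => ?_) y hy, key _ _ _ (fun l u hu => ?_) y hy⟩
  · obtain ⟨G, G', hG, h⟩ := H.exists_image hu
    rw [(h 0 zero_mem_Icc_pi).1, (h 0 zero_mem_Icc_pi).2.1, hG.boundary_zero]
  · obtain ⟨G, G', hG, h⟩ := H.exists_image hu
    rw [(h _ pi_mem_Icc_pi).1, (h _ pi_mem_Icc_pi).2.1, hG.boundary_pi]

theorem boundary_transpose (H : p.AdmissibleKernel F F10 F01 F20 F02 C)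
    (hc : p.CompleteEigenfunctions) :
    ∀ x ∈ Icc 0 Real.pi, F01 x 0 * p.Bᵀ + F x 0 * p.Aᵀ = 0 ∧
      F01 x Real.pi * p.Bpiᵀ + F x Real.pi * p.Apiᵀ = 0 := by
  intro x hx
  have h := H.boundary hc x hx
  constructor
  · rw [← H.transpose_deriv 0 zero_mem_Icc_pi x hx, ← H.symm 0 zero_mem_Icc_pi x hx,
      ← transpose_mul, ← transpose_mul, ← transpose_add, h.1, transpose_zero]
  · rw [← H.transpose_deriv _ pi_mem_Icc_pi x hx, ← H.symm _ pi_mem_Icc_pi x hx,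
      ← transpose_mul, ← transpose_mul, ← transpose_add, h.2, transpose_zero]

/-- For fixed $x$ the defect is orthogonal to every eigenfunction: the $x$-part acts on the image of
`u` as $-\lambda$, and Green's formula moves the $y$-part onto `u`, where it acts as $-\lambda$ too.
-/
theorem equation (H : p.AdmissibleKernel F F10 F01 F20 F02 C) (hp : p.IsSelfAdjoint)
    (hc : p.CompleteEigenfunctions) :
    ∀ x ∈ Icc 0 Real.pi, ∀ y ∈ Icc 0 Real.pi,
      F20 x y - p.P (clampPi x) * F x y = F02 x y - F x y * p.P (clampPi y) := by
  have hF0 := H.partials.continuous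
  have hF1 := H.partials.continuous10
  have hF3 := H.partials.continuous20
  have hF4 := H.partials.continuous02
  have hP := hp.continuousOn_P.comp_clampPi
  intro x hx
  suffices h : ∀ y ∈ Icc 0 Real.pi, (F20 x y - p.P (clampPi x) * F x y) -
      (F02 x y - F x y * p.P (clampPi y)) = 0 from fun y hy => sub_eq_zero.1 (h y hy)
  set P : ℝ → Matrix (Fin N) (Fin N) ℝ := fun x => p.P (clampPi x) with hPdef
  change ∀ y ∈ Icc 0 Real.pi, (F20 x y - P x * F x y) - (F02 x y - F x y * P y) = 0
  refine hc.matrix_eq_zero (by fun_prop) fun l u hu => ?_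
  have huc := continuous_colExt hu
  obtain ⟨G, G', hG, h⟩ := H.exists_image hu
  obtain ⟨v, hv⟩ := exists_isMatrixSolution_colExt hu
  have hgreen := integral_mul_deriv_sub_deriv_mul (L := Real.pi) (a := F x) (a' := F01 x)
    (a'' := F02 x) (b := colExt u) (b' := colExt v)
    (b'' := fun t => P t * colExt u t - l • colExt u t)
    (H.partials.deriv01 x hx) (H.partials.deriv02 x hx) hv.deriv hv.deriv2 (by fun_prop)
    (by fun_prop) (by fun_prop) (by fun_prop) pi_mem_Icc_pi
  rw [mul_sub_mul_eq_zero_of_boundary hp.symm_zero hp.rank_zero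
    (H.boundary_transpose hc x hx).1 hv.boundary_zero,
    mul_sub_mul_eq_zero_of_boundary hp.symm_pi hp.rank_pi
    (H.boundary_transpose hc x hx).2 hv.boundary_pi, sub_zero] at hgreen
  obtain ⟨h0, -, h2⟩ := h x hx
  have hint : ∫ t in (0 : ℝ)..Real.pi,
      ((F20 x t - P x * F x t) - (F02 x t - F x t * P t)) * colExt u t =
      (∫ t in (0 : ℝ)..Real.pi, F20 x t * colExt u t) -
      P x * (∫ t in (0 : ℝ)..Real.pi, F x t * colExt u t) +
      (∫ t in (0 : ℝ)..Real.pi, (F x t * (P t * colExt u t - l • colExt u t) -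
        F02 x t * colExt u t)) + l • (∫ t in (0 : ℝ)..Real.pi, F x t * colExt u t) := by
    rw [← integral_const_mul_of_continuous _ (by fun_prop), ← intervalIntegral.integral_smul,
      ← intervalIntegral.integral_sub, ← intervalIntegral.integral_add,
      ← intervalIntegral.integral_add]
    · refine intervalIntegral.integral_congr fun t _ => ?_
      simp only [mul_sub, mul_smul_comm]
      noncomm_ring
    all_goals exact Continuous.intervalIntegrable (by fun_prop) _ _
  refine hint.trans ?_
  rw [hgreen, h0, h2]
  simp only [hPdef]
  abel

/-- In the equations for `K` and `K01` the variable $y$ sits only in `F` and `F01`, so `K` inherits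
the condition of `F` at $y=0$. -/
theorem kernel_boundary (H : p.AdmissibleKernel F F10 F01 F20 F02 C)
    (hc : p.CompleteEigenfunctions) {K K01 : ℝ → ℝ → Matrix (Fin N) (Fin N) ℝ}
    (hKc : Continuous (uncurry K))
    (hKF : ∀ x ∈ Icc 0 Real.pi, ∀ y ∈ Icc 0 Real.pi,
      K x y + F x y + ∫ t in (0 : ℝ)..x, K x t * F t y = 0)
    (hK01 : ∀ x ∈ Icc 0 Real.pi, ∀ y ∈ Icc 0 Real.pi,
      K01 x y + F01 x y + ∫ t in (0 : ℝ)..x, K x t * F01 t y = 0) :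
    ∀ x ∈ Icc 0 Real.pi, K01 x 0 * p.Bᵀ + K x 0 * p.Aᵀ = 0 := by
  have hF0 := H.partials.continuous
  have hF1 := H.partials.continuous01
  intro x hx
  have e1 := eq_neg_of_add_eq_zero_left ((add_assoc _ _ _).symm.trans
    (hKF x hx 0 zero_mem_Icc_pi))
  have e2 := eq_neg_of_add_eq_zero_left ((add_assoc _ _ _).symm.trans
    (hK01 x hx 0 zero_mem_Icc_pi))
  have h0 : (∫ t in (0 : ℝ)..x, K x t * F01 t 0) * p.Bᵀ +
      (∫ t in (0 : ℝ)..x, K x t * F t 0) * p.Aᵀ = 0 := by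
    rw [← integral_mul_const_of_continuous _ (by fun_prop),
      ← integral_mul_const_of_continuous _ (by fun_prop), ← intervalIntegral.integral_add]
    · rw [intervalIntegral.integral_congr (g := fun _ => 0), intervalIntegral.integral_zero]
      intro t ht
      rw [uIcc_of_le hx.1] at ht
      simp only [mul_assoc, ← mul_add]
      rw [(H.boundary_transpose hc t ⟨ht.1, ht.2.trans hx.2⟩).1, mul_zero]
    all_goals exact Continuous.intervalIntegrable (by fun_prop) _ _
  rw [e1, e2, neg_mul, neg_mul, add_mul, add_mul, ← neg_add, add_add_add_comm, h0,
    (H.boundary_transpose hc x hx).1, add_zero, neg_zero]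

/-- Substituting the transposed equation for $F(t,x)$ writes $K(x,x)$ as $-F(x,x) + \int KK^* +
\iint K(x,t)F(s,t)^*K(x,s)^*$, a sum of symmetric terms. -/
theorem transpose_diag (H : p.AdmissibleKernel F F10 F01 F20 F02 C)
    {K : ℝ → ℝ → Matrix (Fin N) (Fin N) ℝ} (hKc : Continuous (uncurry K))
    (hKF : ∀ x ∈ Icc 0 Real.pi, ∀ y ∈ Icc 0 Real.pi,
      K x y + F x y + ∫ t in (0 : ℝ)..x, K x t * F t y = 0) :
    ∀ x ∈ Icc 0 Real.pi, (K x x)ᵀ = K x x := by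
  have hF0 := H.partials.continuous
  intro x hx
  have htr : ∀ f : ℝ → Matrix (Fin N) (Fin N) ℝ, Continuous f →
      (∫ t in (0 : ℝ)..x, f t)ᵀ = ∫ t in (0 : ℝ)..x, (f t)ᵀ := by
    intro f hf
    ext a b
    rw [transpose_apply, integral_entry hf, integral_entry (by fun_prop)]
    rfl
  have hFK : ∀ t ∈ Icc 0 Real.pi, F t x = -((K x t)ᵀ + ∫ s in (0 : ℝ)..x, (K x s * F s t)ᵀ) := by
    intro t ht
    rw [← H.symm x hx t ht, ← htr _ (by fun_prop), ← transpose_add, ← transpose_neg]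
    congr 1
    have := hKF x hx t ht
    rw [add_right_comm] at this
    exact eq_neg_of_add_eq_zero_right this
  have hdiag : K x x = -F x x + ((∫ t in (0 : ℝ)..x, K x t * (K x t)ᵀ) +
      ∫ t in (0 : ℝ)..x, ∫ s in (0 : ℝ)..x, K x t * (K x s * F s t)ᵀ) := by
    have e1 := eq_neg_of_add_eq_zero_left ((add_assoc _ _ _).symm.trans (hKF x hx x hx))
    rw [e1, neg_add, ← intervalIntegral.integral_neg, ← intervalIntegral.integral_add]
    · congr 1
      refine intervalIntegral.integral_congr fun t ht => ?_
      rw [uIcc_of_le hx.1] at ht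
      rw [hFK t ⟨ht.1, ht.2.trans hx.2⟩, integral_const_mul_of_continuous _ (by fun_prop), mul_neg,
        neg_neg, mul_add]
    all_goals exact Continuous.intervalIntegrable (by fun_prop) _ _
  -- Transposition exchanges the roles of `s` and `t`, using the symmetry of `F`; Fubini restores
  -- the order.
  have hdouble : (∫ t in (0 : ℝ)..x, ∫ s in (0 : ℝ)..x, K x t * (K x s * F s t)ᵀ)ᵀ =
      ∫ t in (0 : ℝ)..x, ∫ s in (0 : ℝ)..x, K x t * (K x s * F s t)ᵀ := by
    rw [htr _ (by fun_prop)]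
    rw [intervalIntegral.integral_congr
      (g := fun t => ∫ s in (0 : ℝ)..x, K x s * (K x t * F t s)ᵀ)]
    · exact intervalIntegral_swap (by fun_prop) _ _ _ _
    intro t ht
    rw [uIcc_of_le hx.1] at ht
    simp only
    rw [htr _ (by fun_prop)]
    refine intervalIntegral.integral_congr fun s hs => ?_
    rw [uIcc_of_le hx.1] at hs
    simp only [transpose_mul, transpose_transpose]
    rw [H.symm t ⟨ht.1, ht.2.trans hx.2⟩ s ⟨hs.1, hs.2.trans hx.2⟩, mul_assoc]
  rw [hdiag, transpose_add, transpose_add, hdouble, transpose_neg, H.symm x hx x hx,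
    htr _ (by fun_prop)]
  simp only [transpose_mul, transpose_transpose]

end AdmissibleKernel

end SLProblem

/-! ### The transformed problem and the images of eigenfunctions -/

namespace SLProblem

attribute [local instance] Matrix.linftyOpNormedAddCommGroup Matrix.linftyOpNormedSpace
  Matrix.linftyOpNormedRing Matrix.linftyOpNormedAlgebra

variable {N : ℕ} {p : SLProblem N}

/-- `K` is a `C²` extension to the square of the resolvent kernel `K₀` of the kernel `F`, and
`1 + K` intertwines `p` and `p.transform K₀`. -/
structure TransmutationKernel (p : SLProblem N)
    (F F10 K K10 K01 K20 K02 K₀ : ℝ → ℝ → Matrix (Fin N) (Fin N) ℝ) : Prop where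
  partials : HasSecondPartials Real.pi K K10 K01 K20 K02
  continuous_F : Continuous (uncurry F)
  continuous_F10 : Continuous (uncurry F10)
  deriv_F : ∀ x ∈ Icc 0 Real.pi, ∀ y ∈ Icc 0 Real.pi,
    HasDerivWithinAt (fun x => F x y) (F10 x y) (Icc 0 Real.pi) x
  resolvent : ∀ x ∈ Icc 0 Real.pi, ∀ y ∈ Icc 0 Real.pi,
    K x y + F x y + ∫ t in (0 : ℝ)..x, K x t * F t y = 0
  resolvent10 : ∀ x ∈ Icc 0 Real.pi, ∀ y ∈ Icc 0 Real.pi,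
    K10 x y + (F10 x y + K x x * F x y) + ∫ t in (0 : ℝ)..x, K10 x t * F t y = 0
  symm_diag : ∀ x ∈ Icc 0 Real.pi, (K x x)ᵀ = K x x
  diag : ∀ x ∈ Icc 0 Real.pi, K₀ x x = K x x
  boundary : ∀ x ∈ Icc 0 Real.pi, K01 x 0 * p.Bᵀ + K x 0 * p.Aᵀ = 0
  equation : ∀ x ∈ Icc 0 Real.pi, ∀ y ∈ Icc 0 Real.pi,
    K20 x y - (p.P (clampPi x) + (2 : ℝ) • (K10 x x + K01 x x)) * K x y =
      K02 x y - K x y * p.P (clampPi y)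
  exists_preimage : ∀ l, ∀ u ∈ p.eigenspace l, ∃ w ∈ p.eigenspace l, ∀ x ∈ Icc 0 Real.pi,
    colExt u x = colExt w x + ∫ y in (0 : ℝ)..Real.pi, F x y * colExt w y

theorem AdmissibleKernel.exists_transmutationKernel
    {F F10 F01 F20 F02 : ℝ → ℝ → Matrix (Fin N) (Fin N) ℝ} {C : ℝ}
    (H : p.AdmissibleKernel F F10 F01 F20 F02 C) (hp : p.IsSelfAdjoint)
    (hc : p.CompleteEigenfunctions) {K K₀ : ℝ → ℝ → Matrix (Fin N) (Fin N) ℝ}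
    (hK : Continuous (uncurry K))
    (hKF : ∀ x ∈ Icc 0 Real.pi, ∀ y ∈ Icc 0 Real.pi,
      K x y + F x y + ∫ t in (0 : ℝ)..x, K x t * F t y = 0)
    (hK₀ : ∀ x ∈ Icc 0 Real.pi, K₀ x x = K x x) :
    ∃ K10 K01 K20 K02, p.TransmutationKernel F F10 K K10 K01 K20 K02 K₀ := by
  obtain ⟨K10, K01, K20, K02, hKp, h10, h20, h01, h02⟩ :=
    H.bound.exists_hasSecondPartials Real.pi_pos.le H.nonneg H.partials hK hKF
  have hbd := H.kernel_boundary hc hK hKF h01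
  refine ⟨K10, K01, K20, K02, hKp, H.partials.continuous, H.partials.continuous10,
    H.partials.deriv10, hKF, h10, H.transpose_diag hK hKF, hK₀, hbd, ?_, H.exists_preimage⟩
  exact H.bound.kernel_equation H.partials hKp hKF h20 h02 hp.continuousOn_P.comp_clampPi
    (fun _ _ => rfl) (H.equation hp hc) fun x hx y hy =>
      mul_sub_mul_eq_zero_of_boundary hp.symm_zero hp.rank_zero (hbd x hx) (H.boundary hc y hy).1

namespace TransmutationKernel

variable {F F10 K K10 K01 K20 K02 K₀ : ℝ → ℝ → Matrix (Fin N) (Fin N) ℝ}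

theorem hasDerivWithinAt_diag (H : p.TransmutationKernel F F10 K K10 K01 K20 K02 K₀) {x : ℝ}
    (hx : x ∈ Icc 0 Real.pi) (a b : Fin N) :
    HasDerivWithinAt (fun t => K₀ t t a b) ((K10 x x + K01 x x) a b) (Icc 0 Real.pi) x :=
  (hasDerivWithinAt_pi.1 (hasDerivWithinAt_pi.1 (H.partials.deriv_diag x hx) a) b).congr
    (fun z hz => by rw [H.diag z hz]) (by rw [H.diag x hx])

theorem contDiffOn_diag (H : p.TransmutationKernel F F10 K K10 K01 K20 K02 K₀) (a b : Fin N) :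
    ContDiffOn ℝ 1 (fun x => K₀ x x a b) (Icc 0 Real.pi) := by
  have h1 := H.partials.continuous10
  have h2 := H.partials.continuous01
  have hu := uniqueDiffOn_Icc Real.pi_pos
  rw [show (1 : WithTop ℕ∞) = 0 + 1 by norm_num, contDiffOn_succ_iff_derivWithin hu]
  refine ⟨fun x hx => (H.hasDerivWithinAt_diag hx a b).differentiableWithinAt, by simp, ?_⟩
  rw [contDiffOn_zero]
  have h3 : Continuous fun x => (K10 x x + K01 x x) a b := by fun_prop
  exact h3.continuousOn.congr fun x hx => (H.hasDerivWithinAt_diag hx a b).derivWithin (hu x hx)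

theorem transform_P (H : p.TransmutationKernel F F10 K K10 K01 K20 K02 K₀) {x : ℝ}
    (hx : x ∈ Icc 0 Real.pi) :
    (p.transform K₀).P x = p.P (clampPi x) + (2 : ℝ) • (K10 x x + K01 x x) := by
  rw [clampPi_of_mem hx]
  simp only [transform]
  congr 2
  ext a b
  exact (H.hasDerivWithinAt_diag hx a b).derivWithin (uniqueDiffOn_Icc Real.pi_pos x hx)

theorem transform_A (H : p.TransmutationKernel F F10 K K10 K01 K20 K02 K₀) :
    (p.transform K₀).A = p.A - p.B * K 0 0 := by
  simp only [transform, H.diag 0 zero_mem_Icc_pi]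

theorem transform_Api (H : p.TransmutationKernel F F10 K K10 K01 K20 K02 K₀) :
    (p.transform K₀).Api = p.Api - p.Bpi * K Real.pi Real.pi := by
  simp only [transform, H.diag _ pi_mem_Icc_pi]

/-- All symmetry claims rest on that of $K(x,x)$, differentiated for the potential and evaluated at
the end points for the boundary matrices. -/
theorem isSelfAdjoint_transform (H : p.TransmutationKernel F F10 K K10 K01 K20 K02 K₀)
    (hp : p.IsSelfAdjoint) : (p.transform K₀).IsSelfAdjoint := by
  have h1 := H.partials.continuous10
  have h2 := H.partials.continuous01
  have hP := hp.continuousOn_P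
  have hbc : ∀ A B M : Matrix (Fin N) (Fin N) ℝ, B * Aᵀ = A * Bᵀ → Mᵀ = M →
      B * (A - B * M)ᵀ = (A - B * M) * Bᵀ := by
    intro A B M h hM
    rw [transpose_sub, transpose_mul, hM, mul_sub, sub_mul, h, mul_assoc]
  refine ⟨?_, fun x hx => ?_, ?_, ?_, ?_, ?_⟩
  · have h3 : Continuous fun x => (2 : ℝ) • (K10 x x + K01 x x) := by fun_prop
    refine (hP.add h3.continuousOn).congr fun x hx => ?_
    rw [H.transform_P hx, clampPi_of_mem hx]
    rfl
  · rw [H.transform_P hx, transpose_add, clampPi_of_mem hx, hp.symm_P x hx, transpose_smul]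
    congr 2
    have h3 := H.partials.deriv_diag x hx
    have h4 : HasDerivWithinAt (fun x => (K x x)ᵀ) (K10 x x + K01 x x)ᵀ (Icc 0 Real.pi) x :=
      hasDerivWithinAt_pi.2 fun a => hasDerivWithinAt_pi.2 fun b =>
        hasDerivWithinAt_pi.1 (hasDerivWithinAt_pi.1 h3 b) a
    exact derivWithin_unique_Icc hx h4 h3 H.symm_diag
  · rw [H.transform_A]
    exact hbc _ _ _ hp.symm_zero (H.symm_diag 0 zero_mem_Icc_pi)
  · rw [H.transform_Api]
    exact hbc _ _ _ hp.symm_pi (H.symm_diag _ pi_mem_Icc_pi)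
  · rw [H.transform_A]
    exact (rank_fromCols_sub_mul _).trans hp.rank_zero
  · rw [H.transform_Api]
    exact (rank_fromCols_sub_mul _).trans hp.rank_pi

/-- At `x = π` the operators `1 + F` and `1 + K` are inverse to each other, up to adjoints. -/
theorem _root_.integral_mul_add_integral {k h : ℝ → Matrix (Fin N) (Fin N) ℝ}
    {W : ℝ → Matrix (Fin N) (Fin N) ℝ} (hF : Continuous (uncurry F)) (hk : Continuous k)
    (hW : Continuous W)
    (he : ∀ y ∈ Icc 0 Real.pi, k y + h y + ∫ t in (0 : ℝ)..Real.pi, k t * F t y = 0) :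
    ∫ t in (0 : ℝ)..Real.pi, k t * (W t + ∫ y in (0 : ℝ)..Real.pi, F t y * W y) =
      -∫ y in (0 : ℝ)..Real.pi, h y * W y := by
  have h1 : ∫ t in (0 : ℝ)..Real.pi, k t * (W t + ∫ y in (0 : ℝ)..Real.pi, F t y * W y) =
      (∫ t in (0 : ℝ)..Real.pi, k t * W t) +
        ∫ y in (0 : ℝ)..Real.pi, (∫ t in (0 : ℝ)..Real.pi, k t * F t y) * W y := by
    have h2 : ∫ y in (0 : ℝ)..Real.pi, (∫ t in (0 : ℝ)..Real.pi, k t * F t y) * W y =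
        ∫ t in (0 : ℝ)..Real.pi, k t * ∫ y in (0 : ℝ)..Real.pi, F t y * W y := by
      have h3 : ∀ y, (∫ t in (0 : ℝ)..Real.pi, k t * F t y) * W y =
          ∫ t in (0 : ℝ)..Real.pi, k t * F t y * W y := fun y =>
        (integral_mul_const_of_continuous _ (by fun_prop) _ _).symm
      have h4 : ∀ t, k t * (∫ y in (0 : ℝ)..Real.pi, F t y * W y) =
          ∫ y in (0 : ℝ)..Real.pi, k t * F t y * W y := fun t => by
        rw [← integral_const_mul_of_continuous _ (by fun_prop)]
        simp only [mul_assoc]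
      simp only [h3, h4]
      exact intervalIntegral_swap (by fun_prop) _ _ _ _
    rw [h2, ← intervalIntegral.integral_add]
    · simp only [mul_add]
    all_goals exact Continuous.intervalIntegrable (by fun_prop) _ _
  rw [h1, ← intervalIntegral.integral_neg, ← intervalIntegral.integral_add]
  · refine intervalIntegral.integral_congr fun y hy => ?_
    rw [uIcc_of_le Real.pi_pos.le] at hy
    have h5 := he y hy
    rw [add_right_comm] at h5
    rw [← add_mul, eq_neg_of_add_eq_zero_left h5, neg_mul]
  all_goals exact Continuous.intervalIntegrable (by fun_prop) _ _

/-- The delicate point is the condition at $\pi$, where the integral terms do not vanish; they are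
evaluated through a preimage `w` of `u` under $1+F$. -/
theorem isSolution_matrix (H : p.TransmutationKernel F F10 K K10 K01 K20 K02 K₀)
    (hp : p.IsSelfAdjoint) {l : ℝ} {u v : ℝ → Fin N → ℝ} (hu : u ∈ p.eigenspace l)
    (hv : p.IsMatrixSolution l (colExt u) (colExt v)) :
    let U := fun x => colExt u x + ∫ t in (0 : ℝ)..x, K x t * colExt u t
    let V := fun x => colExt v x + (K x x * colExt u x + ∫ t in (0 : ℝ)..x, K10 x t * colExt u t)
    (∀ x ∈ Icc 0 Real.pi, HasDerivWithinAt U (V x) (Icc 0 Real.pi) x ∧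
      HasDerivWithinAt V ((p.transform K₀).P x * U x - l • U x) (Icc 0 Real.pi) x) ∧
    p.B * V 0 + (p.transform K₀).A * U 0 = 0 ∧
    p.Bpi * V Real.pi + (p.transform K₀).Api * U Real.pi = 0 := by
  have hK := H.partials.continuous
  have hK1 := H.partials.continuous10
  have hF := H.continuous_F
  have hF1 := H.continuous_F10
  have huc := hv.continuous
  intro U V
  refine ⟨fun x hx => ?_, ?_, ?_⟩
  · exact H.partials.transmutation hp.continuousOn_P.comp_clampPi
      (fun x hx => H.transform_P hx) (fun x hx y hy => by rw [H.transform_P hx]; exact H.equation x hx y hy)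
      huc hv.deriv hv.deriv2 (fun x hx => mul_sub_mul_eq_zero_of_boundary hp.symm_zero hp.rank_zero
        (H.boundary x hx) hv.boundary_zero) x hx
  · rw [H.transform_A, ← hv.boundary_zero]
    simp only [U, V, intervalIntegral.integral_same]
    noncomm_ring
  · obtain ⟨w, hw, hwu⟩ := H.exists_preimage l u hu
    obtain ⟨z, hz⟩ := exists_isMatrixSolution_colExt hw
    have hwc := hz.continuous
    have hvz : ∀ x ∈ Icc 0 Real.pi,
        colExt v x = colExt z x + ∫ y in (0 : ℝ)..Real.pi, F10 x y * colExt w y := fun x hx =>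
      derivWithin_unique_Icc hx (hv.deriv x hx) ((hz.deriv x hx).add
        (hasDerivWithinAt_integral_param
          (f := fun x y => F x y * colExt w y) (f1 := fun x y => F10 x y * colExt w y)
          (by fun_prop) (by fun_prop)
          (fun x hx t ht => (H.deriv_F x hx t ht).mul_const _) pi_mem_Icc_pi hx)) hwu
    have hsub : ∀ k : ℝ → Matrix (Fin N) (Fin N) ℝ,
        ∫ t in (0 : ℝ)..Real.pi, k t * colExt u t = ∫ t in (0 : ℝ)..Real.pi,
          k t * (colExt w t + ∫ y in (0 : ℝ)..Real.pi, F t y * colExt w y) := fun k => by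
      refine intervalIntegral.integral_congr fun t ht => ?_
      rw [uIcc_of_le Real.pi_pos.le] at ht
      simp only [hwu t ht]
    -- Since $K(\pi,\cdot)$ composed with $1+F$ is $-F(\pi,\cdot)$, the integral cancels the `F`
    -- part of $u(\pi) = w(\pi) + \int F(\pi,y)w(y)\,dy$. The differentiated equation does the same
    -- for `V`, leaving the extra term $K(\pi,\pi)w(\pi)$ that the shift of `Api` absorbs.
    have hU : U Real.pi = colExt w Real.pi := by
      simp only [U]
      rw [hsub, integral_mul_add_integral hF (by fun_prop) hwc (H.resolvent _ pi_mem_Icc_pi),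
        hwu _ pi_mem_Icc_pi, add_neg_cancel_right]
    have hV : V Real.pi = colExt z Real.pi + K Real.pi Real.pi * colExt w Real.pi := by
      simp only [V]
      rw [hsub, integral_mul_add_integral hF (by fun_prop) hwc (H.resolvent10 _ pi_mem_Icc_pi),
        hwu _ pi_mem_Icc_pi, hvz _ pi_mem_Icc_pi]
      have h1 : ∫ y in (0 : ℝ)..Real.pi, (F10 Real.pi y + K Real.pi Real.pi * F Real.pi y) *
          colExt w y = (∫ y in (0 : ℝ)..Real.pi, F10 Real.pi y * colExt w y) +
          K Real.pi Real.pi * ∫ y in (0 : ℝ)..Real.pi, F Real.pi y * colExt w y := by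
        rw [← integral_const_mul_of_continuous _ (by fun_prop), ← intervalIntegral.integral_add]
        · simp only [add_mul, mul_assoc]
        all_goals exact Continuous.intervalIntegrable (by fun_prop) _ _
      rw [h1]
      noncomm_ring
    rw [H.transform_Api, hU, hV, ← hz.boundary_pi]
    noncomm_ring

theorem _root_.integral_mul_replicateCol {k : ℝ → Matrix (Fin N) (Fin N) ℝ} {f : ℝ → Fin N → ℝ}
    (hk : Continuous k) (hf : Continuous f) (a b : ℝ) :
    ∫ t in a..b, k t * replicateCol (Fin N) (f t) =
      replicateCol (Fin N) (∫ t in a..b, k t *ᵥ f t) := by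
  ext i j
  rw [integral_entry (f := fun t => k t * replicateCol (Fin N) (f t)) (hk.mul hf.matrix_replicateCol)]
  exact (ContinuousLinearMap.proj (R := ℝ) (φ := fun _ : Fin N => ℝ) i).intervalIntegral_comp_comm
    (f := fun t => k t *ᵥ f t) (Continuous.intervalIntegrable (by fun_prop) _ _)

theorem _root_.hasDerivWithinAt_of_replicateCol {f : ℝ → Fin N → ℝ} {f' : Fin N → ℝ} {s : Set ℝ}
    {x : ℝ} (h : HasDerivWithinAt (fun x => replicateCol (Fin N) (f x))
      (replicateCol (Fin N) f') s x) : HasDerivWithinAt f f' s x :=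
  hasDerivWithinAt_pi.2 fun a => hasDerivWithinAt_pi.1 (hasDerivWithinAt_pi.1 h a) a

/-- The transmutation operator `u ↦ u + ∫_0^x K(x, t) u(t) dt`, with values vanishing
outside of `[0, π]`. -/
noncomputable def _root_.SLProblem.transmute (K : ℝ → ℝ → Matrix (Fin N) (Fin N) ℝ)
    (u : ℝ → Fin N → ℝ) : ℝ → Fin N → ℝ :=
  (Icc 0 Real.pi).indicator fun x => u (clampPi x) + ∫ t in (0 : ℝ)..x, K x t *ᵥ u (clampPi t)

theorem transmute_mem (H : p.TransmutationKernel F F10 K K10 K01 K20 K02 K₀)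
    (hp : p.IsSelfAdjoint) {l : ℝ} {u : ℝ → Fin N → ℝ} (hu : u ∈ p.eigenspace l) :
    transmute K u ∈ (p.transform K₀).eigenspace l := by
  have hK := H.partials.continuous
  have hK1 := H.partials.continuous10
  have huc := (continuousOn_of_mem_eigenspace hu).comp_clampPi
  obtain ⟨v, hv⟩ := exists_isMatrixSolution_colExt hu
  have hU : ∀ x, colExt u x + ∫ t in (0 : ℝ)..x, K x t * colExt u t = replicateCol (Fin N)
      (u (clampPi x) + ∫ t in (0 : ℝ)..x, K x t *ᵥ u (clampPi t)) := fun x =>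
    congrArg (colExt u x + ·) (integral_mul_replicateCol (hK.uncurry_left x) huc 0 x)
  have hV : ∀ x, colExt v x + (K x x * colExt u x + ∫ t in (0 : ℝ)..x, K10 x t * colExt u t) =
      replicateCol (Fin N) (v (clampPi x) +
        (K x x *ᵥ u (clampPi x) + ∫ t in (0 : ℝ)..x, K10 x t *ᵥ u (clampPi t))) := fun x => by
    rw [replicateCol_add, replicateCol_add, replicateCol_mulVec]
    exact congrArg (fun M => colExt v x + (K x x * colExt u x + M))
      (integral_mul_replicateCol (hK1.uncurry_left x) huc 0 x)
  have h := H.isSolution_matrix hp hu hv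
  simp only [hU, hV] at h
  obtain ⟨h1, h2, h3⟩ := h
  have heq : ∀ x ∈ Icc 0 Real.pi, transmute K u x =
      u (clampPi x) + ∫ t in (0 : ℝ)..x, K x t *ᵥ u (clampPi t) := fun x hx =>
    indicator_of_mem hx _
  refine ⟨fun x hx => indicator_of_notMem hx _, fun x => v (clampPi x) +
    (K x x *ᵥ u (clampPi x) + ∫ t in (0 : ℝ)..x, K10 x t *ᵥ u (clampPi t)),
    fun x hx => ?_, fun x hx => ?_, ?_, ?_⟩
  · exact (hasDerivWithinAt_of_replicateCol (h1 x hx).1).congr heq (heq x hx)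
  · rw [heq x hx]
    exact hasDerivWithinAt_of_replicateCol ((h1 x hx).2.congr_deriv (by
      rw [← replicateCol_mulVec, ← replicateCol_smul]; rfl))
  · rw [heq 0 zero_mem_Icc_pi]
    ext a
    exact congrFun (congrFun h2 a) a
  · rw [heq _ pi_mem_Icc_pi]
    ext a
    exact congrFun (congrFun h3 a) a

end TransmutationKernel

end SLProblem

/-! ### Bijectivity on eigenspaces and equality of multiplicities -/

namespace SLProblem

attribute [local instance] Matrix.linftyOpNormedAddCommGroup Matrix.linftyOpNormedSpace
  Matrix.linftyOpNormedRing Matrix.linftyOpNormedAlgebra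

variable {N : ℕ} {p : SLProblem N}

theorem _root_.dotProduct_integral (v : Fin N → ℝ) {f : ℝ → Fin N → ℝ} (hf : Continuous f)
    (a b : ℝ) : v ⬝ᵥ (∫ t in a..b, f t) = ∫ t in a..b, v ⬝ᵥ f t :=
  ((LinearMap.toContinuousLinearMap (dotProductBilin ℝ ℝ v)).intervalIntegral_comp_comm
    (hf.intervalIntegrable a b)).symm

theorem _root_.eq_zero_of_volterra {K : ℝ → ℝ → Matrix (Fin N) (Fin N) ℝ}
    (hK : Continuous (uncurry K)) {f : ℝ → Fin N → ℝ} (hf : Continuous f)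
    (h : ∀ x ∈ Icc 0 Real.pi, f x + ∫ t in (0 : ℝ)..x, K x t *ᵥ f t = 0) :
    ∀ x ∈ Icc 0 Real.pi, f x = 0 := by
  obtain ⟨M, hM0, hM⟩ := exists_norm_le_of_continuous Real.pi hK
  refine eq_zero_of_norm_le_integral (C := M) hf fun x hx => ?_
  rw [eq_neg_of_add_eq_zero_left (h x hx), norm_neg, ← intervalIntegral.integral_const_mul]
  refine intervalIntegral.norm_integral_le_of_norm_le hx.1 (Eventually.of_forall
    fun t ht => ?_) (Continuous.intervalIntegrable (by fun_prop) _ _)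
  refine (linfty_opNorm_mulVec _ _).trans ?_
  gcongr
  exact hM x hx t ⟨ht.1.le, ht.2.trans hx.2⟩

theorem eq_zero_of_mem_eigenspace {l : ℝ} {u : ℝ → Fin N → ℝ} (hu : u ∈ p.eigenspace l)
    (h : ∀ x ∈ Icc 0 Real.pi, u x = 0) : u = 0 := by
  ext1 x
  by_cases hx : x ∈ Icc 0 Real.pi
  · exact h x hx
  · exact hu.1 x hx

/-- The `L²` inner product on an eigenspace. -/
noncomputable def eigenspaceForm (p : SLProblem N) (l : ℝ) :
    LinearMap.BilinForm ℝ (p.eigenspace l) :=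
  have hint : ∀ u w : p.eigenspace l, IntervalIntegrable
      (fun x => (u : ℝ → Fin N → ℝ) x ⬝ᵥ (w : ℝ → Fin N → ℝ) x) volume 0 Real.pi := by
    intro u w
    refine ContinuousOn.intervalIntegrable_of_Icc Real.pi_pos.le ?_
    have hu := continuousOn_of_mem_eigenspace u.2
    have hw := continuousOn_of_mem_eigenspace w.2
    simp only [dotProduct]
    fun_prop
  LinearMap.mk₂ ℝ (fun u w => ∫ x in (0 : ℝ)..Real.pi,
      (u : ℝ → Fin N → ℝ) x ⬝ᵥ (w : ℝ → Fin N → ℝ) x)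
    (fun u v w => by
      rw [← intervalIntegral.integral_add (hint u w) (hint v w)]
      simp [add_dotProduct])
    (fun c u w => by
      rw [smul_eq_mul, ← intervalIntegral.integral_const_mul]
      simp)
    (fun u v w => by
      rw [← intervalIntegral.integral_add (hint u v) (hint u w)]
      simp [dotProduct_add])
    (fun c u w => by
      rw [smul_eq_mul, ← intervalIntegral.integral_const_mul]
      simp)

theorem eigenspaceForm_apply (l : ℝ) (u w : p.eigenspace l) :
    p.eigenspaceForm l u w =
      ∫ x in (0 : ℝ)..Real.pi, (u : ℝ → Fin N → ℝ) x ⬝ᵥ (w : ℝ → Fin N → ℝ) x := rfl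

theorem eq_zero_of_eigenspaceForm_self {l : ℝ} {u : p.eigenspace l}
    (h : p.eigenspaceForm l u u = 0) : u = 0 := by
  have huc := (continuousOn_of_mem_eigenspace u.2).comp_clampPi
  rw [eigenspaceForm_apply, ← integral_comp_clampPi
    (fun _ x => (u : ℝ → Fin N → ℝ) x ⬝ᵥ (u : ℝ → Fin N → ℝ) x) pi_mem_Icc_pi,
    intervalIntegral.integral_eq_zero_iff_of_le_of_nonneg_ae Real.pi_pos.le
    (Eventually.of_forall fun x => by
      simpa using dotProduct_star_self_nonneg ((u : ℝ → Fin N → ℝ) (clampPi x)))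
    ((huc.dotProduct huc).intervalIntegrable _ _)] at h
  rw [Measure.restrict_congr_set Ioc_ae_eq_Icc] at h
  have h1 := Measure.eqOn_Icc_of_ae_eq volume Real.pi_pos.ne h
    (huc.dotProduct huc).continuousOn continuousOn_const
  refine Subtype.ext (eq_zero_of_mem_eigenspace u.2 fun x hx => dotProduct_self_eq_zero.1 ?_)
  have h2 : (u : ℝ → Fin N → ℝ) (clampPi x) ⬝ᵥ (u : ℝ → Fin N → ℝ) (clampPi x) = 0 := h1 hx
  rwa [clampPi_of_mem hx] at h2

namespace TransmutationKernel

variable {F F10 K K10 K01 K20 K02 K₀ : ℝ → ℝ → Matrix (Fin N) (Fin N) ℝ}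

/-- The range of `1 + K` on the eigenfunctions of `p` is dense. -/
theorem eq_zero_of_orthogonal (hc : p.CompleteEigenfunctions) (hK : Continuous (uncurry K))
    {w : ℝ → Fin N → ℝ} (hw : Continuous w)
    (h : ∀ l, ∀ u ∈ p.eigenspace l, ∫ x in (0 : ℝ)..Real.pi, w x ⬝ᵥ transmute K u x = 0) :
    ∀ x ∈ Icc 0 Real.pi, w x = 0 := by
  have hKt : Continuous (uncurry fun x t => (K x t)ᵀ) := by fun_prop
  -- The adjoint of $1+K$ applied to `w`. It is orthogonal to the eigenfunctions of `p` by Fubini on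
  -- the triangle, hence zero by completeness.
  let f : ℝ → Fin N → ℝ := fun t => w t + ∫ x in t..Real.pi, (K x t)ᵀ *ᵥ w x
  have hf : Continuous f := by fun_prop
  have hf0 : ∀ x ∈ Icc 0 Real.pi, f x = 0 := by
    refine hc.eq_zero hf fun l u hu => ?_
    have huc := (continuousOn_of_mem_eigenspace hu).comp_clampPi
    rw [← integral_comp_clampPi (fun t s => f t ⬝ᵥ u s) pi_mem_Icc_pi]
    refine Eq.trans ?_ (h l u hu)
    generalize hU : (fun x => u (clampPi x)) = U at huc
    have hUx : ∀ x, u (clampPi x) = U x := fun x => congrFun hU x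
    have h1 : ∫ x in (0 : ℝ)..Real.pi, w x ⬝ᵥ transmute K u x =
        ∫ x in (0 : ℝ)..Real.pi, (w x ⬝ᵥ U x + ∫ t in (0 : ℝ)..x, w x ⬝ᵥ (K x t *ᵥ U t)) := by
      refine intervalIntegral.integral_congr fun x hx => ?_
      rw [uIcc_of_le Real.pi_pos.le] at hx
      simp only [transmute, indicator_of_mem hx, hUx]
      rw [dotProduct_add, dotProduct_integral _ (by fun_prop)]
    have h2 : ∀ t, f t ⬝ᵥ U t = w t ⬝ᵥ U t + ∫ x in t..Real.pi, w x ⬝ᵥ (K x t *ᵥ U t) := by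
      intro t
      simp only [f]
      rw [add_dotProduct, dotProduct_comm (intervalIntegral _ _ _ _),
        dotProduct_integral _ (by fun_prop)]
      congr 1
      refine intervalIntegral.integral_congr fun x _ => ?_
      rw [dotProduct_comm, mulVec_transpose, dotProduct_mulVec]
    simp only [h1, hUx, h2]
    rw [intervalIntegral.integral_add (Continuous.intervalIntegrable (by fun_prop) _ _)
      (Continuous.intervalIntegrable (by fun_prop) _ _),
      intervalIntegral.integral_add (Continuous.intervalIntegrable (by fun_prop) _ _)
      (Continuous.intervalIntegrable (by fun_prop) _ _)]
    congr 1
    exact (integral_triangle_swap Real.pi_pos.le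
      (g := fun s t => w s ⬝ᵥ (K s t *ᵥ U t)) (by fun_prop)).symm
  -- The adjoint integrates over $[t,\pi]$; the reflection $t = \pi - s$ makes it an ordinary
  -- Volterra equation.
  have h3 := eq_zero_of_volterra (f := fun s => w (Real.pi - s))
    (K := fun s r => (K (Real.pi - r) (Real.pi - s))ᵀ) (by fun_prop) (by fun_prop)
    (fun s hs => by
      rw [← hf0 (Real.pi - s) ⟨by linarith [hs.2], by linarith [hs.1]⟩]
      simp only [f]
      congr 1
      rw [intervalIntegral.integral_comp_sub_left
        (fun x => (K x (Real.pi - s))ᵀ *ᵥ w x) Real.pi, sub_zero])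
  intro x hx
  have := h3 (Real.pi - x) ⟨by linarith [hx.2], by linarith [hx.1]⟩
  simpa using this

/-- The transmutation operator as a linear map between eigenspaces. -/
noncomputable def eigenspaceMap (H : p.TransmutationKernel F F10 K K10 K01 K20 K02 K₀)
    (hp : p.IsSelfAdjoint) (l : ℝ) : p.eigenspace l →ₗ[ℝ] (p.transform K₀).eigenspace l where
  toFun u := ⟨transmute K u, H.transmute_mem hp u.2⟩
  map_add' u v := by
    have hK := H.partials.continuous
    have hu := (continuousOn_of_mem_eigenspace u.2).comp_clampPi
    have hv := (continuousOn_of_mem_eigenspace v.2).comp_clampPi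
    ext1
    ext1 x
    by_cases hx : x ∈ Icc 0 Real.pi
    · simp only [transmute, indicator_of_mem hx, Submodule.coe_add, Pi.add_apply, mulVec_add]
      rw [intervalIntegral.integral_add, add_add_add_comm]
      · exact ((hK.uncurry_left x).matrix_mulVec hu).intervalIntegrable _ _
      · exact ((hK.uncurry_left x).matrix_mulVec hv).intervalIntegrable _ _
    · simp [transmute, indicator_of_notMem hx]
  map_smul' c u := by
    ext1
    ext1 x
    by_cases hx : x ∈ Icc 0 Real.pi
    · simp only [transmute, indicator_of_mem hx, Submodule.coe_smul, Pi.smul_apply, mulVec_smul,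
        RingHom.id_apply, smul_add, intervalIntegral.integral_smul]
    · simp [transmute, indicator_of_notMem hx]

theorem eigenspaceMap_injective (H : p.TransmutationKernel F F10 K K10 K01 K20 K02 K₀)
    (hp : p.IsSelfAdjoint) (l : ℝ) : Injective (H.eigenspaceMap hp l) := by
  rw [injective_iff_map_eq_zero]
  intro u hu
  have huc := (continuousOn_of_mem_eigenspace u.2).comp_clampPi
  refine Subtype.ext (eq_zero_of_mem_eigenspace u.2 fun x hx => ?_)
  have h := eq_zero_of_volterra H.partials.continuous huc (fun x hx => ?_) x hx
  · rwa [clampPi_of_mem hx] at h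
  · have h1 := congrFun (congrArg Subtype.val hu) x
    exact (indicator_of_mem hx fun x => (u : ℝ → Fin N → ℝ) (clampPi x) +
      ∫ t in (0 : ℝ)..x, K x t *ᵥ (u : ℝ → Fin N → ℝ) (clampPi t)).symm.trans h1

/-- Subtract from `v` its orthogonal projection onto the image. The remainder is orthogonal to
transforms of eigenfunctions for `l` by construction, and to the others by selfadjointness of the
new problem, so totality makes it zero. With a trivial eigenspace of `p` this excludes new
eigenvalues. -/
theorem eigenspaceMap_surjective (H : p.TransmutationKernel F F10 K K10 K01 K20 K02 K₀)
    (hp : p.IsSelfAdjoint) (hc : p.CompleteEigenfunctions) (l : ℝ)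
    [FiniteDimensional ℝ (p.eigenspace l)] : Surjective (H.eigenspaceMap hp l) := by
  have hq := H.isSelfAdjoint_transform hp
  let W := LinearMap.range (H.eigenspaceMap hp l)
  let b := (p.transform K₀).eigenspaceForm l
  -- Nondegeneracy on the finite-dimensional image yields the projection without assuming the target
  -- eigenspace finite-dimensional.
  have hnd : (b.restrict W).Nondegenerate :=
    ⟨fun u hu => Subtype.ext (eq_zero_of_eigenspaceForm_self (hu u)),
      fun u hu => Subtype.ext (eq_zero_of_eigenspaceForm_self (hu u))⟩
  intro v
  let w : W := ((b.restrict W).toDual hnd).symm ((b v).comp W.subtype)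
  have hw : ∀ z : W, b (v - w) z = 0 := by
    intro z
    have h1 : b w z = b v z :=
      LinearMap.BilinForm.apply_toDual_symm_apply (hB := hnd) ((b v).comp W.subtype) z
    rw [map_sub, LinearMap.sub_apply, h1, sub_self]
  have hzero : v - w = 0 := by
    have hwc := (continuousOn_of_mem_eigenspace (v - w).2).comp_clampPi
    refine Subtype.ext (eq_zero_of_mem_eigenspace (v - w).2 fun x hx => ?_)
    have h := eq_zero_of_orthogonal hc H.partials.continuous hwc (fun l' u hu => ?_) x hx
    · rwa [clampPi_of_mem hx] at h
    · rw [integral_comp_clampPi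
        (fun t s => ((v - w : _) : ℝ → Fin N → ℝ) s ⬝ᵥ transmute K u t) pi_mem_Icc_pi]
      by_cases hl : l = l'
      · subst hl
        exact hw ⟨H.eigenspaceMap hp l ⟨u, hu⟩, ⟨_, rfl⟩⟩
      · exact hq.integral_dotProduct_eq_zero hl (v - w).2 (H.transmute_mem hp hu)
  rw [sub_eq_zero.1 hzero]
  exact w.2

theorem multiplicity_transform (H : p.TransmutationKernel F F10 K K10 K01 K20 K02 K₀)
    (hp : p.IsSelfAdjoint) (hc : p.CompleteEigenfunctions) (l : ℝ)
    [FiniteDimensional ℝ (p.eigenspace l)] :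
    (p.transform K₀).multiplicity l = p.multiplicity l :=
  (LinearEquiv.ofBijective (H.eigenspaceMap hp l)
    ⟨H.eigenspaceMap_injective hp l, H.eigenspaceMap_surjective hp hc l⟩).finrank_eq.symm

end TransmutationKernel

/-! ### Enumeration of the eigenvalues with multiplicity -/

/-- The sequence that takes each value `a k` exactly `m k` times, in order of `k`. -/
theorem _root_.exists_monotone_encard_eq {a : ℕ → ℝ} (ha : StrictMono a) {m : ℕ → ℕ}
    (hm : ∀ k, 0 < m k) : ∃ μ : ℕ → ℝ, Monotone μ ∧ (∀ k, {n | μ n = a k}.encard = m k) ∧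
      ∀ n, μ n ∈ range a := by
  let s : ℕ → ℕ := fun k => ∑ j ∈ Finset.range k, m j
  have hs : StrictMono s := strictMono_nat_of_lt_succ fun k => by
    simp only [s, Finset.sum_range_succ]
    exact Nat.lt_add_of_pos_right (hm k)
  have hex : ∀ n, ∃ k, n < s (k + 1) := fun n => ⟨n, hs.id_le (n + 1)⟩
  -- The index of the block $[s_k, s_{k+1})$ containing `n`; the blocks have the prescribed lengths
  -- `m k`.
  let κ : ℕ → ℕ := fun n => Nat.find (hex n)
  have hκ1 : ∀ n, n < s (κ n + 1) := fun n => Nat.find_spec (hex n)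
  have hκ2 : ∀ n, s (κ n) ≤ n := by
    intro n
    rcases Nat.eq_zero_or_pos (κ n) with h | h
    · rw [h]; simp [s]
    · have h1 : ¬ n < s (κ n - 1 + 1) := Nat.find_min (hex n) (Nat.sub_lt h one_pos)
      rwa [Nat.sub_add_cancel h, not_lt] at h1
  have hiff : ∀ n k, κ n = k ↔ n ∈ Ico (s k) (s (k + 1)) := by
    intro n k
    refine ⟨fun h => h ▸ ⟨hκ2 n, hκ1 n⟩, fun h => ?_⟩
    have h1 := hs.lt_iff_lt.1 ((hκ2 n).trans_lt h.2)
    have h2 := hs.lt_iff_lt.1 (h.1.trans_lt (hκ1 n))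
    omega
  refine ⟨fun n => a (κ n), fun n n' h => ha.monotone ?_, fun k => ?_, fun n => ⟨κ n, rfl⟩⟩
  · have := hs.lt_iff_lt.1 ((hκ2 n).trans_lt (h.trans_lt (hκ1 n')))
    omega
  · have : {n | a (κ n) = a k} = Ico (s k) (s (k + 1)) := by
      ext n
      rw [mem_ofPred_eq, ha.injective.eq_iff, hiff]
    rw [this, ← Finset.coe_Ico, encard_coe_eq_coe_finsetCard, Nat.card_Ico]
    simp [s, Finset.sum_range_succ]

theorem exists_isEigenvalueSequence {lam : ℕ → ℝ} (hlam : StrictMono lam)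
    (hrange : range lam = p.eigenvalues) (hfin : ∀ l, FiniteDimensional ℝ (p.eigenspace l)) :
    ∃ μ, p.IsEigenvalueSequence μ := by
  obtain ⟨μ, hμ, hm, hr⟩ := exists_monotone_encard_eq hlam
    (m := fun k => p.multiplicity (lam k)) fun k => by
      have h1 : lam k ∈ p.eigenvalues := hrange ▸ mem_range_self k
      have := hfin (lam k)
      exact Nat.pos_of_ne_zero fun h => h1 (Submodule.finrank_eq_zero.1 h)
  refine ⟨μ, hμ, fun l => ?_⟩
  by_cases hl : l ∈ range lam
  · obtain ⟨k, rfl⟩ := hl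
    exact hm k
  · have h1 : {n | μ n = l} = ∅ := eq_empty_of_forall_notMem fun n hn => hl (hn ▸ hr n)
    have h2 : p.eigenspace l = ⊥ := by
      by_contra h
      exact hl (hrange ▸ h)
    rw [h1, encard_empty, multiplicity, h2, finrank_bot]
    rfl

end SLProblem

/-! ### Partial derivatives on the closed square -/

section Partials

/-- Partial derivatives of a `C^{n+1}` function on a closed square. -/
theorem exists_partials_of_contDiffOn {g : ℝ × ℝ → ℝ} {n : ℕ}
    (hg : ContDiffOn ℝ (n + 1 : ℕ) g (Icc 0 Real.pi ×ˢ Icc 0 Real.pi)) :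
    ∃ g1 g2 : ℝ × ℝ → ℝ,
      ContDiffOn ℝ n g1 (Icc 0 Real.pi ×ˢ Icc 0 Real.pi) ∧
      ContDiffOn ℝ n g2 (Icc 0 Real.pi ×ˢ Icc 0 Real.pi) ∧
      (∀ x ∈ Icc 0 Real.pi, ∀ y ∈ Icc 0 Real.pi,
        HasDerivWithinAt (fun x => g (x, y)) (g1 (x, y)) (Icc 0 Real.pi) x) ∧
      (∀ x ∈ Icc 0 Real.pi, ∀ y ∈ Icc 0 Real.pi,
        HasDerivWithinAt (fun y => g (x, y)) (g2 (x, y)) (Icc 0 Real.pi) y) ∧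
      ∀ x ∈ Icc 0 Real.pi,
        HasDerivWithinAt (fun x => g (x, x)) (g1 (x, x) + g2 (x, x)) (Icc 0 Real.pi) x := by
  have hu : UniqueDiffOn ℝ (Icc 0 Real.pi ×ˢ Icc 0 Real.pi) :=
    (uniqueDiffOn_Icc Real.pi_pos).prod (uniqueDiffOn_Icc Real.pi_pos)
  have hf := hg.fderivWithin (m := n) hu (by norm_cast)
  have hd : ∀ z ∈ Icc 0 Real.pi ×ˢ Icc 0 Real.pi, HasFDerivWithinAt g
      (fderivWithin ℝ g (Icc 0 Real.pi ×ˢ Icc 0 Real.pi) z) (Icc 0 Real.pi ×ˢ Icc 0 Real.pi) z :=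
    fun z hz => (hg.differentiableOn (by norm_num) z hz).hasFDerivWithinAt
  refine ⟨fun z => fderivWithin ℝ g (Icc 0 Real.pi ×ˢ Icc 0 Real.pi) z (1, 0),
    fun z => fderivWithin ℝ g (Icc 0 Real.pi ×ˢ Icc 0 Real.pi) z (0, 1),
    hf.clm_apply contDiffOn_const, hf.clm_apply contDiffOn_const, fun x hx y hy => ?_,
    fun x hx y hy => ?_, fun x hx => ?_⟩
  · exact (hd (x, y) ⟨hx, hy⟩).comp_hasDerivWithinAt (f := fun x => (x, y)) x
      ((hasDerivWithinAt_id x _).prodMk (hasDerivWithinAt_const x _ y)) fun z hz => ⟨hz, hy⟩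
  · exact (hd (x, y) ⟨hx, hy⟩).comp_hasDerivWithinAt (f := fun y => (x, y)) y
      ((hasDerivWithinAt_const y _ x).prodMk (hasDerivWithinAt_id y _)) fun z hz => ⟨hx, hz⟩
  · refine ((hd (x, x) ⟨hx, hx⟩).comp_hasDerivWithinAt (f := fun x => (x, x)) x
      ((hasDerivWithinAt_id x _).prodMk (hasDerivWithinAt_id x _))
      fun z hz => ⟨hz, hz⟩).congr_deriv ?_
    rw [← map_add]
    simp

end Partials

/-! ### From the series to an admissible kernel, and solutions on the triangle -/

namespace SLProblem

attribute [local instance] Matrix.linftyOpNormedAddCommGroup Matrix.linftyOpNormedSpace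
  Matrix.linftyOpNormedRing Matrix.linftyOpNormedAlgebra

variable {N : ℕ} {p : SLProblem N}

/-- The continuous extension of a kernel on the square to the plane. -/
noncomputable def clampKernel (F : ℝ → ℝ → Matrix (Fin N) (Fin N) ℝ) (x y : ℝ) :
    Matrix (Fin N) (Fin N) ℝ :=
  F (clampPi x) (clampPi y)

theorem clampKernel_of_mem (F : ℝ → ℝ → Matrix (Fin N) (Fin N) ℝ) {x y : ℝ}
    (hx : x ∈ Icc 0 Real.pi) (hy : y ∈ Icc 0 Real.pi) : clampKernel F x y = F x y := by
  rw [clampKernel, clampPi_of_mem hx, clampPi_of_mem hy]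

theorem continuous_clampKernel {F : ℝ → ℝ → Matrix (Fin N) (Fin N) ℝ}
    (hF : ∀ a b, ContinuousOn (fun z : ℝ × ℝ => F z.1 z.2 a b)
      (Icc 0 Real.pi ×ˢ Icc 0 Real.pi)) : Continuous (uncurry (clampKernel F)) := by
  refine continuous_pi fun a => continuous_pi fun b => ?_
  exact (hF a b).comp_continuous (f := fun z : ℝ × ℝ => (clampPi z.1, clampPi z.2))
    (by fun_prop) fun z => ⟨clampPi_mem _, clampPi_mem _⟩

theorem hasSecondPartials_clampKernel {F : ℝ → ℝ → Matrix (Fin N) (Fin N) ℝ}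
    (hF2 : ∀ a b : Fin N, ContDiffOn ℝ 2 (fun q : ℝ × ℝ => F q.1 q.2 a b)
      (Icc 0 Real.pi ×ˢ Icc 0 Real.pi)) :
    ∃ F10 F01 F20 F02 : ℝ → ℝ → Matrix (Fin N) (Fin N) ℝ,
      HasSecondPartials Real.pi (clampKernel F) F10 F01 F20 F02 := by
  choose g1 g2 hg1 hg2 hd1 hd2 hdd using fun a b =>
    exists_partials_of_contDiffOn (n := 1) (hF2 a b)
  choose g11 g12 hg11 _ hd11 _ _ using fun a b => exists_partials_of_contDiffOn (n := 0) (hg1 a b)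
  choose g21 g22 _ hg22 _ hd22 _ using fun a b => exists_partials_of_contDiffOn (n := 0) (hg2 a b)
  let M (g : Fin N → Fin N → ℝ × ℝ → ℝ) : ℝ → ℝ → Matrix (Fin N) (Fin N) ℝ :=
    fun x y => Matrix.of fun a b => g a b (x, y)
  have hx : ∀ {A B : ℝ → ℝ → Matrix (Fin N) (Fin N) ℝ}, (∀ a b, ∀ x ∈ Icc 0 Real.pi,
      ∀ y ∈ Icc 0 Real.pi, HasDerivWithinAt (fun x => A x y a b) (B x y a b) (Icc 0 Real.pi) x) →
      ∀ x ∈ Icc 0 Real.pi, ∀ y ∈ Icc 0 Real.pi,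
      HasDerivWithinAt (fun x => clampKernel A x y) (clampKernel B x y) (Icc 0 Real.pi) x := by
    intro A B h x hx y hy
    rw [clampKernel_of_mem B hx hy]
    have h1 : HasDerivWithinAt (fun x => A x y) (B x y) (Icc 0 Real.pi) x :=
      hasDerivWithinAt_pi.2 fun a => hasDerivWithinAt_pi.2 fun b => h a b x hx y hy
    exact h1.congr (fun z hz => clampKernel_of_mem A hz hy) (clampKernel_of_mem A hx hy)
  have hy : ∀ {A B : ℝ → ℝ → Matrix (Fin N) (Fin N) ℝ}, (∀ a b, ∀ x ∈ Icc 0 Real.pi,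
      ∀ y ∈ Icc 0 Real.pi, HasDerivWithinAt (fun y => A x y a b) (B x y a b) (Icc 0 Real.pi) y) →
      ∀ x ∈ Icc 0 Real.pi, ∀ y ∈ Icc 0 Real.pi,
      HasDerivWithinAt (clampKernel A x) (clampKernel B x y) (Icc 0 Real.pi) y := by
    intro A B h x hx y hy
    rw [clampKernel_of_mem B hx hy]
    have h1 : HasDerivWithinAt (A x) (B x y) (Icc 0 Real.pi) y :=
      hasDerivWithinAt_pi.2 fun a => hasDerivWithinAt_pi.2 fun b => h a b x hx y hy
    exact h1.congr (fun z hz => clampKernel_of_mem A hx hz) (clampKernel_of_mem A hx hy)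
  refine ⟨clampKernel (M g1), clampKernel (M g2), clampKernel (M g11), clampKernel (M g22),
    continuous_clampKernel fun a b => (hF2 a b).continuousOn,
    continuous_clampKernel fun a b => (hg1 a b).continuousOn,
    continuous_clampKernel fun a b => (hg2 a b).continuousOn,
    continuous_clampKernel fun a b => (hg11 a b).continuousOn,
    continuous_clampKernel fun a b => (hg22 a b).continuousOn,
    hx hd1, hy hd2, hx hd11, hy hd22, fun x hx => ?_⟩
  rw [clampKernel_of_mem _ hx hx, clampKernel_of_mem _ hx hx]
  have h1 : HasDerivWithinAt (fun x => F x x) (M g1 x x + M g2 x x) (Icc 0 Real.pi) x :=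
    hasDerivWithinAt_pi.2 fun a => hasDerivWithinAt_pi.2 fun b => hdd a b x hx
  exact h1.congr (fun z hz => clampKernel_of_mem F hz hz) (clampKernel_of_mem F hx hx)

theorem finiteDimensional_eigenspace {lam : ℕ → ℝ} (hrange : range lam = p.eigenvalues)
    {φ : (k : ℕ) → Fin (p.multiplicity (lam k)) → ℝ → Fin N → ℝ}
    (hφ : ∀ k, p.IsOrthogonalEigenbasis (lam k) (φ k)) (l : ℝ) :
    FiniteDimensional ℝ (p.eigenspace l) := by
  by_cases hl : p.eigenspace l = ⊥
  · rw [hl]; infer_instance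
  · obtain ⟨k, rfl⟩ : l ∈ range lam := hrange ▸ hl
    rw [← (hφ k).1]
    exact FiniteDimensional.span_of_finite ℝ (finite_range _)

/-- The pairs $(k,i)$ form one orthogonal family: within an eigenspace by the choice of basis,
across eigenspaces by selfadjointness. Partial sums take whole eigenspaces, matching the given mode
of convergence. -/
theorem orthogonalExpansion (hp : p.IsSelfAdjoint) {lam : ℕ → ℝ} (hlam : StrictMono lam)
    {φ : (k : ℕ) → Fin (p.multiplicity (lam k)) → ℝ → Fin N → ℝ}
    (hφ : ∀ k, p.IsOrthogonalEigenbasis (lam k) (φ k))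
    {c : (k : ℕ) → Fin (p.multiplicity (lam k)) → ℝ}
    (hc : ∀ k i, 0 < 1 + c k i * ∫ x in (0 : ℝ)..Real.pi, φ k i x ⬝ᵥ φ k i x)
    {F : ℝ → ℝ → Matrix (Fin N) (Fin N) ℝ}
    (hF : ∀ a b : Fin N, TendstoUniformlyOn
      (fun (n : ℕ) (q : ℝ × ℝ) => ∑ k ∈ Finset.range n, ∑ i, c k i * (φ k i q.1 a * φ k i q.2 b))
      (fun q : ℝ × ℝ => F q.1 q.2 a b) atTop (Icc 0 Real.pi ×ˢ Icc 0 Real.pi))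
    (hFc : Continuous (uncurry (clampKernel F))) :
    OrthogonalExpansion Real.pi (fun q : Σ k, Fin (p.multiplicity (lam k)) => c q.1 q.2)
      (fun q x => φ q.1 q.2 (clampPi x))
      (fun n => (Finset.range n).sigma fun _ => Finset.univ) (clampKernel F) := by
  have hmem : ∀ k i, φ k i ∈ p.eigenspace (lam k) := fun k i => by
    rw [← (hφ k).1]
    exact Submodule.subset_span (mem_range_self i)
  refine ⟨Real.pi_pos.le, hFc, fun q => (continuousOn_of_mem_eigenspace (hmem _ _)).comp_clampPi,
    fun q r hqr => ?_, fun q => ⟨q.1 + 1, fun n hn => ?_⟩, fun ε hε => ?_, fun q => ?_⟩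
  · rw [integral_comp_clampPi (fun _ x => φ q.1 q.2 x ⬝ᵥ φ r.1 r.2 x) pi_mem_Icc_pi]
    obtain ⟨k, i⟩ := q
    obtain ⟨k', j⟩ := r
    by_cases hk : k = k'
    · subst hk
      exact (hφ k).2 i j fun h => hqr (by rw [h])
    · exact hp.integral_dotProduct_eq_zero (hlam.injective.ne hk) (hmem k i) (hmem k' j)
  · simp only [Finset.mem_sigma, Finset.mem_range, Finset.mem_univ, and_true]
    omega
  · have h1 : ∀ᶠ n in atTop, ∀ a b : Fin N, ∀ z ∈ Icc 0 Real.pi ×ˢ Icc 0 Real.pi,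
        dist (F z.1 z.2 a b) (∑ k ∈ Finset.range n, ∑ i, c k i * (φ k i z.1 a * φ k i z.2 b)) <
          ε :=
      eventually_all.2 fun a => eventually_all.2 fun b =>
        Metric.tendstoUniformlyOn_iff.1 (hF a b) ε hε
    obtain ⟨n₀, hn₀⟩ := eventually_atTop.1 h1
    refine ⟨n₀, fun n hn x hx y hy a b => ?_⟩
    have h2 := (hn₀ n hn a b (x, y) ⟨hx, hy⟩).le
    rw [Real.dist_eq] at h2
    rw [clampKernel_of_mem F hx hy]
    refine le_trans (le_of_eq ?_) h2
    congr 2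
    rw [sumKernel, Finset.sum_sigma, Matrix.sum_apply]
    refine Finset.sum_congr rfl fun k _ => ?_
    rw [Matrix.sum_apply]
    refine Finset.sum_congr rfl fun i _ => ?_
    simp only [clampPi_of_mem hx, clampPi_of_mem hy]
    rfl
  · rw [integral_comp_clampPi (fun _ x => φ q.1 q.2 x ⬝ᵥ φ q.1 q.2 x) pi_mem_Icc_pi]
    exact hc _ _

theorem exists_admissibleKernel (hp : p.IsSelfAdjoint) {lam : ℕ → ℝ} (hlam : StrictMono lam)
    (hrange : range lam = p.eigenvalues)
    {φ : (k : ℕ) → Fin (p.multiplicity (lam k)) → ℝ → Fin N → ℝ}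
    (hφ : ∀ k, p.IsOrthogonalEigenbasis (lam k) (φ k))
    {c : (k : ℕ) → Fin (p.multiplicity (lam k)) → ℝ}
    (hc : ∀ k i, 0 < 1 + c k i * ∫ x in (0 : ℝ)..Real.pi, φ k i x ⬝ᵥ φ k i x)
    {F : ℝ → ℝ → Matrix (Fin N) (Fin N) ℝ}
    (hF : ∀ a b : Fin N, TendstoUniformlyOn
      (fun (n : ℕ) (q : ℝ × ℝ) => ∑ k ∈ Finset.range n, ∑ i, c k i * (φ k i q.1 a * φ k i q.2 b))
      (fun q : ℝ × ℝ => F q.1 q.2 a b) atTop (Icc 0 Real.pi ×ˢ Icc 0 Real.pi))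
    (hF2 : ∀ a b : Fin N, ContDiffOn ℝ 2 (fun q : ℝ × ℝ => F q.1 q.2 a b)
      (Icc 0 Real.pi ×ˢ Icc 0 Real.pi)) :
    ∃ F10 F01 F20 F02 C, p.AdmissibleKernel (clampKernel F) F10 F01 F20 F02 C := by
  obtain ⟨F10, F01, F20, F02, hpart⟩ := hasSecondPartials_clampKernel hF2
  have hFc := hpart.continuous
  have hE := orthogonalExpansion hp hlam hφ hc hF hFc
  obtain ⟨C, hC, hB⟩ := hE.exists_uniformlyBoundedBelow
  have hmem : ∀ k i, φ k i ∈ p.eigenspace (lam k) := fun k i => by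
    rw [← (hφ k).1]
    exact Submodule.subset_span (mem_range_self i)
  set γ : (k : ℕ) → Fin (p.multiplicity (lam k)) → ℝ := fun k i =>
    c k i * ∫ x in (0 : ℝ)..Real.pi, φ k i x ⬝ᵥ φ k i x with hγ
  have hφF : ∀ k i, ∀ x ∈ Icc 0 Real.pi,
      ∫ y in (0 : ℝ)..Real.pi, clampKernel F x y *ᵥ φ k i (clampPi y) = γ k i • φ k i x := by
    intro k i x hx
    have h := hE.integral_mulVec ⟨k, i⟩ hx
    rw [integral_comp_clampPi (fun _ x => φ k i x ⬝ᵥ φ k i x) pi_mem_Icc_pi,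
      clampPi_of_mem hx] at h
    exact h
  have hcol : ∀ l, ∀ u ∈ p.eigenspace l, ∀ x, ∫ y in (0 : ℝ)..Real.pi, clampKernel F x y *
      colExt u y = replicateCol (Fin N)
        (∫ y in (0 : ℝ)..Real.pi, clampKernel F x y *ᵥ u (clampPi y)) := fun l u hu x =>
    integral_mul_replicateCol (hFc.uncurry_left x)
      (continuousOn_of_mem_eigenspace hu).comp_clampPi _ _
  have hsum : ∀ k (r : Fin (p.multiplicity (lam k)) → ℝ), ∀ x ∈ Icc 0 Real.pi,
      ∫ y in (0 : ℝ)..Real.pi, clampKernel F x y *ᵥ (∑ i, r i • φ k i) (clampPi y) =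
        ∑ i, (r i * γ k i) • φ k i x := by
    intro k r x hx
    simp only [Finset.sum_apply, Pi.smul_apply, mulVec_sum, mulVec_smul]
    rw [intervalIntegral.integral_finsetSum]
    · refine Finset.sum_congr rfl fun i _ => ?_
      rw [intervalIntegral.integral_smul, hφF k i x hx, smul_smul]
    · intro i _
      exact (((hFc.uncurry_left x).matrix_mulVec
        (continuousOn_of_mem_eigenspace (hmem k i)).comp_clampPi).fun_const_smul
          _).intervalIntegrable _ _
  have hexp : ∀ l, ∀ u ∈ p.eigenspace l, u = 0 ∨ ∃ k, l = lam k ∧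
      ∃ r : Fin (p.multiplicity (lam k)) → ℝ, u = ∑ i, r i • φ k i := by
    intro l u hu
    by_cases hl : p.eigenspace l = ⊥
    · rw [hl, Submodule.mem_bot] at hu
      exact Or.inl hu
    · obtain ⟨k, rfl⟩ : l ∈ range lam := hrange ▸ hl
      rw [← (hφ k).1] at hu
      obtain ⟨r, hr⟩ := (Submodule.mem_span_range_iff_exists_fun ℝ).1 hu
      exact Or.inr ⟨k, rfl, r, hr.symm⟩
  have hlin : ∀ k (r : Fin (p.multiplicity (lam k)) → ℝ),
      ∑ i, r i • φ k i ∈ p.eigenspace (lam k) := fun k r =>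
    Submodule.sum_mem _ fun i _ => Submodule.smul_mem _ _ (hmem k i)
  have hzero : ∀ x, ∫ y in (0 : ℝ)..Real.pi, clampKernel F x y * colExt (0 : ℝ → Fin N → ℝ) y =
      0 := by
    intro x
    have h : ∀ y, colExt (0 : ℝ → Fin N → ℝ) y = 0 := fun y => rfl
    simp [h]
  refine ⟨F10, F01, F20, F02, C, hpart, fun x hx y hy => ?_, hC, hB, fun l u hu => ?_,
    fun l u hu => ?_⟩
  · rw [clampKernel_of_mem F hx hy, clampKernel_of_mem F hy hx]
    ext a b
    have h1 := (hF b a).tendsto_at (x := (x, y)) ⟨hx, hy⟩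
    have h2 := (hF a b).tendsto_at (x := (y, x)) ⟨hy, hx⟩
    refine tendsto_nhds_unique h1 (h2.congr fun n => ?_)
    simp only [mul_comm (φ _ _ y a)]
  · rcases hexp l u hu with rfl | ⟨k, rfl, r, rfl⟩
    · exact ⟨0, zero_mem _, fun x _ => by rw [hzero]; rfl⟩
    · refine ⟨∑ i, (r i * γ k i) • φ k i, hlin k _, fun x hx => ?_⟩
      rw [hcol _ _ hu, hsum k r x hx, colExt, clampPi_of_mem hx]
      simp only [Finset.sum_apply, Pi.smul_apply]
  · rcases hexp l u hu with rfl | ⟨k, rfl, r, rfl⟩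
    · exact ⟨0, zero_mem _, fun x _ => by rw [hzero, add_zero]⟩
    -- On this eigenspace $1+F$ is diagonal with entries $1+\gamma_{k,i} > 0$, so it is inverted
    -- coordinatewise.
    · refine ⟨∑ i, (r i / (1 + γ k i)) • φ k i, hlin k _, fun x hx => ?_⟩
      rw [hcol _ _ (hlin k _), hsum k _ x hx, colExt, colExt, clampPi_of_mem hx,
        ← replicateCol_add]
      congr 1
      simp only [Finset.sum_apply, Pi.smul_apply]
      rw [← Finset.sum_add_distrib]
      refine Finset.sum_congr rfl fun i _ => ?_
      rw [← add_smul]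
      congr 1
      have h : 1 + γ k i ≠ 0 := (hc k i).ne'
      field_simp

/-- A solution of the integral equation on the triangle extends to the square. -/
theorem SolvesIE.exists_extension {F K₀ : ℝ → ℝ → Matrix (Fin N) (Fin N) ℝ} (h : SolvesIE F K₀)
    (hFc : Continuous (uncurry (clampKernel F))) :
    ∃ K, Continuous (uncurry K) ∧ (∀ x ∈ Icc 0 Real.pi, ∀ y ∈ Icc 0 Real.pi,
      K x y + clampKernel F x y + ∫ t in (0 : ℝ)..x, K x t * clampKernel F t y = 0) ∧
      ∀ x ∈ Icc 0 Real.pi, K₀ x x = K x x := by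
  obtain ⟨hcont, heq⟩ := h
  -- Above the diagonal the value at $t = x$ is kept, which makes a continuous extension.
  let T : ℝ → ℝ → Matrix (Fin N) (Fin N) ℝ :=
    fun x t => K₀ (clampPi x) (min (clampPi t) (clampPi x))
  have hT : Continuous (uncurry T) := by
    refine hcont.comp_continuous
      (f := fun z : ℝ × ℝ => (clampPi z.1, min (clampPi z.2) (clampPi z.1))) (by fun_prop) fun z => ?_
    exact ⟨le_min (clampPi_mem _).1 (clampPi_mem _).1, min_le_right _ _, (clampPi_mem _).2⟩
  have hTK : ∀ x t, 0 ≤ t → t ≤ x → x ≤ Real.pi → T x t = K₀ x t := by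
    intro x t h0 htx hx
    simp only [T]
    rw [clampPi_of_mem ⟨h0.trans htx, hx⟩, clampPi_of_mem ⟨h0, htx.trans hx⟩, min_eq_left htx]
  -- The defect of `T` in the equation. It vanishes for $y \le x$, so subtracting it leaves the
  -- values under the integral unchanged and makes the equation hold on the whole square.
  let D : ℝ → ℝ → Matrix (Fin N) (Fin N) ℝ := fun x y =>
    T x y + clampKernel F x y + ∫ t in (0 : ℝ)..x, T x t * clampKernel F t y
  have hD : Continuous (uncurry D) := by fun_prop
  have hD0 : ∀ x y, 0 ≤ y → y < x → x ≤ Real.pi → D x y = 0 := by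
    intro x y h0 hyx hx
    have hxm : x ∈ Icc 0 Real.pi := ⟨h0.trans hyx.le, hx⟩
    have hym : y ∈ Icc 0 Real.pi := ⟨h0, hyx.le.trans hx⟩
    ext a b
    have h1 := heq x y h0 hyx hx a b
    have h2 : (∫ t in (0 : ℝ)..x, T x t * clampKernel F t y) a b =
        ∫ t in (0 : ℝ)..x, (K₀ x t * F t y) a b := by
      rw [integral_entry (f := fun t => T x t * clampKernel F t y) (by fun_prop)]
      refine intervalIntegral.integral_congr fun t ht => ?_
      rw [uIcc_of_le hxm.1] at ht
      simp only [hTK x t ht.1 ht.2 hx, clampKernel_of_mem F ⟨ht.1, ht.2.trans hx⟩ hym]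
    show T x y a b + clampKernel F x y a b +
      (∫ t in (0 : ℝ)..x, T x t * clampKernel F t y) a b = 0
    rw [h2, hTK x y h0 hyx.le hx, clampKernel_of_mem F hxm hym]
    exact h1
  have hDd : ∀ x ∈ Icc 0 Real.pi, D x x = 0 := by
    intro x hx
    rcases hx.1.eq_or_lt with rfl | hx0
    -- At the corner there is no $y < x$ to approach from, so the limit is taken along $x \downarrow
    -- 0$ with $y = 0$.
    · have hcl : IsClosed {z | D z 0 = 0} := isClosed_eq (by fun_prop) continuous_const
      have hsub : Ioc 0 Real.pi ⊆ {z | D z 0 = 0} := fun z hz => hD0 z 0 le_rfl hz.1 hz.2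
      have := hcl.closure_subset_iff.2 hsub
      rw [closure_Ioc Real.pi_pos.ne] at this
      exact this zero_mem_Icc_pi
    · have hcl : IsClosed {z | D x z = 0} := isClosed_eq (by fun_prop) continuous_const
      have hsub : Ico 0 x ⊆ {z | D x z = 0} := fun z hz => hD0 x z hz.1 hz.2 hx.2
      have := hcl.closure_subset_iff.2 hsub
      rw [closure_Ico hx0.ne] at this
      exact this (right_mem_Icc.2 hx.1)
  let K : ℝ → ℝ → Matrix (Fin N) (Fin N) ℝ := fun x y => T x y - D x y
  have hKT : ∀ x ∈ Icc 0 Real.pi, ∀ t ∈ Icc 0 x, K x t = T x t := by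
    intro x hx t ht
    rcases ht.2.eq_or_lt with rfl | h
    · simp only [K, hDd t hx, sub_zero]
    · simp only [K, hD0 x t ht.1 h hx.2, sub_zero]
  refine ⟨K, by fun_prop, fun x hx y hy => ?_, fun x hx => ?_⟩
  · have h1 : ∫ t in (0 : ℝ)..x, K x t * clampKernel F t y =
        ∫ t in (0 : ℝ)..x, T x t * clampKernel F t y := by
      refine intervalIntegral.integral_congr fun t ht => ?_
      rw [uIcc_of_le hx.1] at ht
      simp only [hKT x hx t ht]
    rw [h1]
    simp only [K, D]
    abel
  · rw [hKT x hx x ⟨hx.1, le_rfl⟩, hTK x x hx.1 le_rfl hx.2]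

theorem solvesIE_of_clampKernel {F K : ℝ → ℝ → Matrix (Fin N) (Fin N) ℝ}
    (hFc : Continuous (uncurry (clampKernel F))) (hK : Continuous (uncurry K))
    (h : ∀ x ∈ Icc 0 Real.pi, ∀ y ∈ Icc 0 Real.pi,
      K x y + clampKernel F x y + ∫ t in (0 : ℝ)..x, K x t * clampKernel F t y = 0) :
    SolvesIE F K := by
  refine ⟨hK.continuousOn, fun x y h0 hyx hx a b => ?_⟩
  have hxm : x ∈ Icc 0 Real.pi := ⟨h0.trans hyx.le, hx⟩
  have hym : y ∈ Icc 0 Real.pi := ⟨h0, hyx.le.trans hx⟩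
  have h1 := congrFun (congrFun (h x hxm y hym) a) b
  have h2 : (∫ t in (0 : ℝ)..x, K x t * clampKernel F t y) a b =
      ∫ t in (0 : ℝ)..x, (K x t * F t y) a b := by
    rw [integral_entry (f := fun t => K x t * clampKernel F t y) (by fun_prop)]
    refine intervalIntegral.integral_congr fun t ht => ?_
    rw [uIcc_of_le hxm.1] at ht
    simp only [clampKernel_of_mem F ⟨ht.1, ht.2.trans hx⟩ hym]
  rw [← h2, ← clampKernel_of_mem F hxm hym]
  exact h1

theorem AdmissibleKernel.exists_solvesIE {F F10 F01 F20 F02 : ℝ → ℝ → Matrix (Fin N) (Fin N) ℝ}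
    {C : ℝ} (H : p.AdmissibleKernel (clampKernel F) F10 F01 F20 F02 C) : ∃ K, SolvesIE F K := by
  have hFc := H.partials.continuous
  obtain ⟨K, hK, hKe⟩ := H.bound.exists_solution Real.pi_pos.le H.nonneg hFc hFc
  exact ⟨K, solvesIE_of_clampKernel hFc hK hKe⟩

/-- Any solution on the triangle extends to one on the square with the same diagonal, and the
transformed problem depends on the diagonal alone; uniqueness of solutions is not needed. -/
theorem AdmissibleKernel.transform_of_solvesIE
    {F F10 F01 F20 F02 : ℝ → ℝ → Matrix (Fin N) (Fin N) ℝ}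
    {C : ℝ} (H : p.AdmissibleKernel (clampKernel F) F10 F01 F20 F02 C) (hp : p.IsSelfAdjoint)
    (hcomplete : p.CompleteEigenfunctions) {K₀ : ℝ → ℝ → Matrix (Fin N) (Fin N) ℝ}
    (hK₀ : SolvesIE F K₀) :
    (∀ a b : Fin N, ContDiffOn ℝ 1 (fun x => K₀ x x a b) (Icc 0 Real.pi)) ∧
      (p.transform K₀).IsSelfAdjoint ∧
      ∀ l [FiniteDimensional ℝ (p.eigenspace l)],
        (p.transform K₀).multiplicity l = p.multiplicity l := by
  obtain ⟨K, hK, hKe, hdiag⟩ := hK₀.exists_extension H.partials.continuous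
  obtain ⟨K10, K01, K20, K02, HK⟩ := H.exists_transmutationKernel hp hcomplete hK hKe hdiag
  exact ⟨HK.contDiffOn_diag, HK.isSelfAdjoint_transform hp, HK.multiplicity_transform hp hcomplete⟩

end SLProblem

end Transform

theorem theorem3p1 {N : ℕ} (p : SLProblem N) (hp : p.IsSelfAdjoint)
    (hcomplete : p.CompleteEigenfunctions)
    -- the distinct eigenvalues, in ascending order
    (lam : ℕ → ℝ) (hlam : StrictMono lam) (hrange : Set.range lam = p.eigenvalues)
    -- an orthogonal basis of each eigenspace
    (φ : (k : ℕ) → Fin (p.multiplicity (lam k)) → ℝ → Fin N → ℝ)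
    (hφ : ∀ k, p.IsOrthogonalEigenbasis (lam k) (φ k))
    (c : (k : ℕ) → Fin (p.multiplicity (lam k)) → ℝ)
    (hc : ∀ k i, 0 < 1 + c k i * ∫ x in (0 : ℝ)..Real.pi, φ k i x ⬝ᵥ φ k i x)
    -- the kernel, as the sum of a uniformly convergent series, of class C²
    (F : ℝ → ℝ → Matrix (Fin N) (Fin N) ℝ)
    (hF : ∀ a b : Fin N, TendstoUniformlyOn
      (fun (n : ℕ) (q : ℝ × ℝ) => ∑ k ∈ Finset.range n, ∑ i, c k i * (φ k i q.1 a * φ k i q.2 b))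
      (fun q : ℝ × ℝ => F q.1 q.2 a b) atTop (Icc 0 Real.pi ×ˢ Icc 0 Real.pi))
    (hF2 : ∀ a b : Fin N, ContDiffOn ℝ 2 (fun q : ℝ × ℝ => F q.1 q.2 a b)
      (Icc 0 Real.pi ×ˢ Icc 0 Real.pi)) :
    (∃ K, SLProblem.SolvesIE F K) ∧
    ∀ K, SLProblem.SolvesIE F K →
      (∀ a b : Fin N, ContDiffOn ℝ 1 (fun x => K x x a b) (Icc 0 Real.pi)) ∧
      (p.transform K).IsSelfAdjoint ∧
      p.Isospectral (p.transform K) := by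
  obtain ⟨F10, F01, F20, F02, C, H⟩ :=
    SLProblem.exists_admissibleKernel hp hlam hrange hφ hc hF hF2
  refine ⟨H.exists_solvesIE, fun K hK => ?_⟩
  obtain ⟨hdiff, hself, hmult⟩ := H.transform_of_solvesIE hp hcomplete hK
  refine ⟨hdiff, hself, ?_⟩
  have hfin := SLProblem.finiteDimensional_eigenspace hrange hφ
  obtain ⟨μ, hμ, hm⟩ := SLProblem.exists_isEigenvalueSequence hlam hrange hfin
  refine ⟨μ, ⟨hμ, fun l => ?_⟩, hμ, fun l => ?_⟩
  · exact hm l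
  · have := hfin l
    rw [hmult l]
    exact hm l
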